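/- Proposition (Longinetti's inequality for non-convex domains). Let $\Omega\subset\mathbb R^2$ be an unbounded domain whose boundary $\partial\Omega$ is a ($C^\infty$) smooth Jordan curve, of length $L_{\partial\Omega}$, and let $\Phi>0$ and $\varphi_0\in\mathbb R$. Let $U$ be harmonic in $\Omega$ and continuously differentiable up to the boundary, with $$U=\varphi_0\ \text{ on }\partial\Omega,\qquad -\oint_{\partial\Omega}\boldsymbol n\cdot\nabla U\,ds=\Phi,\qquad U(\boldsymbol r)\sim-\frac{\Phi}{2\pi}\log\frac{2\pi|\boldsymbol r|}{L_{\partial\Omega}}\quad(|\boldsymbol r|\to\infty),$$ where $\boldsymbol n$ is the unit normal of $\partial\Omega$ pointing into $\Omega$, and $\sim$ means that the quotient tends to $1$. For $\varphi\le\varphi_0$ put $\Sigma_\varphi=\{\boldsymbol r\in\Omega\cup\partial\Omega: U(\boldsymbol r)=\varphi\}$ and $E=|\nabla U|$ (on $\partial\Omega$ the gradient is the one-sided one). Then $E>0$ on every $\Sigma_\varphi$, the integral $\oint_{\Sigma_\varphi}\frac{ds}{E}$ is finite and positive, and $$I(\varphi)=\oint_{\Sigma_\varphi}\frac{ds}{E},\qquad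 \mathscr L(\varphi)=\log\oint_{\Sigma_\varphi}\frac{ds}{E}$$ are twice continuously differentiable on $(-\infty,\varphi_0]$ (with one-sided derivatives at $\varphi_0$). Moreover: (i) $\mathscr L$ is convex: for every $\varphi\le\varphi_0$ we have $\mathscr L''(\varphi)\ge0$, namely $I(\varphi)\,I''(\varphi)\ge I'(\varphi)^2$. If equality holds in either inequality for a single $\varphi\le\varphi_0$, then $\partial\Omega$ is a circle. (ii) $\lim_{\varphi\to-\infty}\mathscr L'(\varphi)=-\frac{4\pi}{\Phi}$, and $\mathscr L'(\varphi)\ge-\frac{4\pi}{\Phi}$ for every $\varphi\le\varphi_0$. -/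

import Mathlib

open MeasureTheory Set Filter Topology Asymptotics InnerProductSpace
open scoped ContDiff

noncomputable section

/-- A smooth Jordan curve in the Euclidean plane `ℂ = ℝ²`: the image of a smooth, regular,
`1`-periodic map that is injective on a period. -/
def IsSmoothJordanCurve (J : Set ℂ) : Prop :=
  ∃ γ : ℝ → ℂ, ContDiff ℝ ∞ γ ∧ Function.Periodic γ 1 ∧ (∀ t, deriv γ t ≠ 0) ∧
    InjOn γ (Ico 0 1) ∧ range γ = J

/-- The line integral `∮_Σ f ds` with respect to arc length, that is, with respect to the
one-dimensional Hausdorff measure on `Σ`. -/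
def arcIntegral (S : Set ℂ) (f : ℂ → ℝ) : ℝ :=
  ∫ z in S, f z ∂(Measure.hausdorffMeasure 1 : Measure ℂ)

/-- The length `L_Σ = ∮_Σ ds`. -/
def arcLength (S : Set ℂ) : ℝ := arcIntegral S fun _ => 1

/-- The differential `v ↦ v · ∇U(z)` at a point `z` of `Ω ∪ ∂Ω`; on `∂Ω` it is the one-sided
differential, taken from within `Ω ∪ ∂Ω`. -/
def closedDifferential (Ω : Set ℂ) (U : ℂ → ℝ) (z : ℂ) : ℂ →L[ℝ] ℝ :=
  fderivWithin ℝ U (closure Ω) z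

/-- The magnitude of the gradient, `E(z) = |∇U(z)|`, at a point `z` of `Ω ∪ ∂Ω`. -/
def fieldIntensity (Ω : Set ℂ) (U : ℂ → ℝ) (z : ℂ) : ℝ := ‖closedDifferential Ω U z‖

/-- `ν` is the unit normal of the curve `∂Ω` at `z` that points out of the region enclosed by the
curve, that is, into the exterior domain `Ω`. -/
def IsOutwardUnitNormal (Ω : Set ℂ) (z ν : ℂ) : Prop :=
  ‖ν‖ = 1 ∧ (∀ v ∈ tangentConeAt ℝ (frontier Ω) z, inner ℝ ν v = 0) ∧
    ∀ᶠ t : ℝ in 𝓝[>] 0, z + t • ν ∈ Ω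

/-- `U` solves the two-dimensional exterior Dirichlet problem in the unbounded domain `Ω`, with
the constant boundary value `φ₀` and the total flux `Φ`. -/
structure IsExteriorDirichlet (Ω : Set ℂ) (U : ℂ → ℝ) (φ₀ Φ : ℝ) : Prop where
  isOpen : IsOpen Ω
  isConnected : IsConnected Ω
  unbounded : ¬ Bornology.IsBounded Ω
  smooth_boundary : IsSmoothJordanCurve (frontier Ω)
  harmonic : HarmonicOnNhd U Ω
  /-- The gradient exists and is continuous up to the boundary. -/
  regular : ContDiffOn ℝ 1 U (closure Ω)
  dirichlet : ∀ z ∈ frontier Ω, U z = φ₀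
  flux_pos : 0 < Φ
  /-- `-∮_{∂Ω} n · ∇U ds = Φ`. -/
  flux : ∃ n : ℂ → ℂ, (∀ z ∈ frontier Ω, IsOutwardUnitNormal Ω z (n z)) ∧
    -arcIntegral (frontier Ω) (fun z => closedDifferential Ω U z (n z)) = Φ
  asymptotic : U ~[Bornology.cobounded ℂ] fun z =>
    -(Φ / (2 * Real.pi)) * Real.log (2 * Real.pi * ‖z‖ / arcLength (frontier Ω))

/-- The level set `Σ_φ = {z ∈ Ω ∪ ∂Ω | U(z) = φ}`. -/
def potentialLevel (Ω : Set ℂ) (U : ℂ → ℝ) (φ : ℝ) : Set ℂ := {z ∈ closure Ω | U z = φ}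

/-- `φ ↦ ∮_{Σ_φ} ds / E`. -/
def inverseFieldIntegral (Ω : Set ℂ) (U : ℂ → ℝ) (φ : ℝ) : ℝ :=
  arcIntegral (potentialLevel Ω U φ) fun z => 1 / fieldIntensity Ω U z

/-- The Longinetti functional `𝓛(φ) = log ∮_{Σ_φ} ds / E`. -/
def longinetti (Ω : Set ℂ) (U : ℂ → ℝ) (φ : ℝ) : ℝ :=
  Real.log (inverseFieldIntegral Ω U φ)

end

/-! The potential is put into the form `N = c (U - φ₀)` with `c = 2π/Φ`, so that `N` vanishes on
`∂Ω` and behaves like `-log |z|` at infinity. Its complex gradient `f`, given by `dN = Re (f dz)`,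
is holomorphic with residue coefficient exactly `-1` at infinity, so `N = log |h|` for a
single-valued holomorphic `h ~ a/z`. A continuity argument shows that `h` maps `Ω` bijectively onto
the punctured unit disc, without critical points (`existsUnique_preimage`). Let `G` be the inverse
map and put `D ξ = -ξ² G' ξ = -ξ / f (G ξ)`. This density is holomorphic and zero-free in the whole
disc, the origin included, and continuous up to the circle; for the latter, `f` must not vanish on
`∂Ω`, which is Hopf's lemma.

The level curve `N = log ρ` is the image under `G` of the circle of radius `ρ`. There both the speed
of the parametrization and `1/|f|` equal `|D|/ρ`, whence `∮ ds/E = (c/ρ²) ∫ |D|² dθ`. If `D = ∑ d_k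
ξ^k`, Parseval's identity and `ρ = exp (c (φ - φ₀))` give `I(φ) = ∑ w_k exp (α (k - 1) (φ - φ₀))`,
with `w_k = 2πc |d_k|² ≥ 0`, `w_0 > 0` and `α = 4π/Φ`.

A sum of exponentials with nonnegative weights is log-convex by the Cauchy–Schwarz inequality.
Equality at one point forces all exponents that occur to coincide; since `w_0 > 0`, only `k = 0`
remains, so `D` is constant, `G ξ = p + d/ξ` on the circle, and `∂Ω` is a circle. The smallest
exponent is `-α`; it bounds the logarithmic derivative from below and is its limit at `-∞`.

Two derivatives up to the endpoint `φ₀` require `∑ k² |d_k|² < ∞`. Writing `D = exp l`, the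
smoothness of the boundary controls only the argument `Im l`: on the circle, `D / conj D` equals
`-ξ² γ' / conj γ'` and is therefore `C¹`. Hence `Re (ξ l')` is bounded in the disc, so `ξ l'`, and
with it `D' = D l'`, is bounded in mean square on circles (`summable_sq_mul_norm_sq`).

Single-valuedness of `h` rests on the connectedness of the boundary curve: by the Cauchy–Pompeiu
formula a holomorphic function in `Ω` is a superposition of simple poles near `∂Ω` and near
infinity, and all poles near `∂Ω` can be moved to one point of the curve at the cost of exact
derivatives (`exists_primitive_exterior`). -/

/-! ### Hausdorff measure and line integrals along injective `C¹` curves. -/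

section CurveArea

open scoped NNReal ENNReal

/-- On a piece where the velocity is `δ`-close to `v`, a curve distorts length by a factor between
`‖v‖ - δ` and `‖v‖ + δ`. -/
lemma hausdorffMeasure_image_bounds {Γ Γ' : ℝ → ℂ} {S t : Set ℝ} (hS : Convex ℝ S)
    (hΓ : ∀ x ∈ S, HasDerivAt Γ (Γ' x) x) {v : ℂ} {δ : ℝ} (hδ : 0 ≤ δ)
    (hv : ∀ x ∈ S, ‖Γ' x - v‖ ≤ δ) (htS : t ⊆ S) :
    Measure.hausdorffMeasure 1 (Γ '' t) ≤ ENNReal.ofReal (‖v‖ + δ) * volume t ∧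
    ENNReal.ofReal (‖v‖ - δ) * volume t ≤ Measure.hausdorffMeasure 1 (Γ '' t) := by
  -- After subtraction of the uniform motion with velocity `v`, the remainder is `δ`-Lipschitz. This
  -- makes `Γ` Lipschitz with constant `‖v‖ + δ`, and its inverse Lipschitz with constant `(‖v‖ -
  -- δ)⁻¹` when this is positive.
  have hdiff : ∀ x ∈ S, ∀ y ∈ S, ‖(Γ y - v * y) - (Γ x - v * x)‖ ≤ δ * ‖y - x‖ := by
    intro x hx y hy
    refine hS.norm_image_sub_le_of_norm_hasDerivWithin_le (f := fun s : ℝ => Γ s - v * s)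
      (f' := fun s => Γ' s - v) ?_ hv hx hy
    intro z hz
    have h2 : HasDerivAt (fun s : ℝ => v * (s : ℂ)) v z := by
      simpa using (HasDerivAt.ofReal_comp (hasDerivAt_id z)).const_mul v
    exact ((hΓ z hz).sub h2).hasDerivWithinAt
  have key : ∀ x ∈ S, ∀ y ∈ S, (Γ y - Γ x) = ((Γ y - v * y) - (Γ x - v * x)) + v * ((y - x : ℝ) : ℂ) := by
    intro x _ y _; push_cast; ring
  have hnv : ∀ x y : ℝ, ‖v * ((y - x : ℝ) : ℂ)‖ = ‖v‖ * ‖y - x‖ := by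
    intro x y; rw [norm_mul, Complex.norm_real]
  constructor
  · have hL : LipschitzOnWith (‖v‖ + δ).toNNReal Γ t := by
      refine LipschitzOnWith.of_dist_le_mul fun x hx y hy => ?_
      rw [Real.coe_toNNReal _ (by positivity), dist_eq_norm, dist_eq_norm,
        key y (htS hy) x (htS hx)]
      refine (norm_add_le _ _).trans ?_
      rw [hnv]
      have := hdiff y (htS hy) x (htS hx)
      linarith
    have := hL.hausdorffMeasure_image_le (d := 1) zero_le_one
    rw [hausdorffMeasure_real] at this
    simpa [ENNReal.ofReal] using this
  · rcases le_or_gt ‖v‖ δ with hle | hlt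
    · rw [ENNReal.ofReal_of_nonpos (by linarith)]; simp
    have hlow : ∀ x ∈ t, ∀ y ∈ t, (‖v‖ - δ) * dist x y ≤ dist (Γ x) (Γ y) := by
      intro x hx y hy
      rw [dist_eq_norm, dist_eq_norm, key y (htS hy) x (htS hx)]
      have h1 := norm_sub_le_norm_add (v * ((x - y : ℝ) : ℂ)) ((Γ x - v * x) - (Γ y - v * y))
      rw [hnv, add_comm] at h1
      have := hdiff y (htS hy) x (htS hx)
      linarith
    have hpos : 0 < ‖v‖ - δ := by linarith
    have hinj : InjOn Γ t := by
      intro x hx y hy hxy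
      have := hlow x hx y hy
      rw [hxy, dist_self] at this
      have h3 : dist x y ≤ 0 := by
        by_contra hc
        push Not at hc
        nlinarith
      exact dist_le_zero.1 h3
    have hL : LipschitzOnWith (‖v‖ - δ).toNNReal⁻¹ (Function.invFunOn Γ t) (Γ '' t) := by
      refine LipschitzOnWith.of_dist_le_mul ?_
      rintro _ ⟨x, hx, rfl⟩ _ ⟨y, hy, rfl⟩
      rw [hinj.leftInvOn_invFunOn hx, hinj.leftInvOn_invFunOn hy, NNReal.coe_inv,
        Real.coe_toNNReal _ hpos.le, inv_mul_eq_div, le_div_iff₀ hpos, mul_comm]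
      exact hlow x hx y hy
    have := hL.hausdorffMeasure_image_le (d := 1) zero_le_one
    rw [hinj.leftInvOn_invFunOn.image_image, hausdorffMeasure_real] at this
    simp only [ENNReal.rpow_one] at this
    have hne : ((‖v‖ - δ).toNNReal : ℝ≥0∞) ≠ 0 := by simpa using hpos
    rw [ENNReal.coe_inv (by simpa using hpos)] at this
    calc ENNReal.ofReal (‖v‖ - δ) * volume t
        ≤ ENNReal.ofReal (‖v‖ - δ) * (((‖v‖ - δ).toNNReal : ℝ≥0∞)⁻¹ *
            Measure.hausdorffMeasure 1 (Γ '' t)) := by gcongr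
      _ = _ := by
          rw [← mul_assoc, ENNReal.ofReal, ENNReal.mul_inv_cancel hne ENNReal.coe_ne_top, one_mul]

/-- The one-dimensional Hausdorff measure of a piece of an injective `C¹` curve. -/
theorem hausdorffMeasure_image_curve {Γ : ℝ → ℂ} (hΓ : ContDiff ℝ 1 Γ) {a b : ℝ}
    (hinj : InjOn Γ (Ico a b)) {t : Set ℝ} (ht : MeasurableSet t) (hta : t ⊆ Ico a b) :
    Measure.hausdorffMeasure 1 (Γ '' t) = ∫⁻ x in t, ‖deriv Γ x‖ₑ := by
  have hd : ∀ x, HasDerivAt Γ (deriv Γ x) x := fun x =>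
    (hΓ.differentiable one_ne_zero x).hasDerivAt
  have hc : Continuous (deriv Γ) := hΓ.continuous_deriv le_rfl
  have hfin : volume t ≠ ⊤ := ((measure_mono hta).trans_lt (by simp)).ne
  have main : ∀ ε : ℝ≥0, 0 < ε →
      Measure.hausdorffMeasure 1 (Γ '' t) ≤ (∫⁻ x in t, ‖deriv Γ x‖ₑ) + ε * volume t ∧
      (∫⁻ x in t, ‖deriv Γ x‖ₑ) ≤ Measure.hausdorffMeasure 1 (Γ '' t) + ε * volume t := by
    intro ε hε
    have huc := (isCompact_Icc (a := a) (b := b)).uniformContinuousOn_of_continuous hc.continuousOn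
    rw [Metric.uniformContinuousOn_iff] at huc
    obtain ⟨r, hr, hur⟩ := huc (ε / 2) (by positivity)
    -- Cells of length `r / 2`, on which the velocity varies by at most `ε / 2`. On each cell the
    -- speed integral and the measure of the image differ by at most `ε` times the length of the
    -- cell, and these errors add up to `ε * volume t`.
    set P : ℤ → Set ℝ := fun k => t ∩ {x | ⌊x / (r / 2)⌋ = k} with hP
    have hPm : ∀ k, MeasurableSet (P k) := fun k =>
      ht.inter ((Int.measurable_floor.comp (measurable_id.div_const _)) (measurableSet_singleton k))
    have hU : t = ⋃ k, P k := by
      ext x; simp [hP]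
    have hdis : Pairwise (Function.onFun Disjoint P) := by
      intro i j hij
      rw [Function.onFun, Set.disjoint_left]
      rintro x ⟨_, h1⟩ ⟨_, h2⟩
      exact hij (h1.symm.trans h2)
    have hPt : ∀ k, P k ⊆ t := fun k => inter_subset_left
    have hI : Measure.hausdorffMeasure 1 (Γ '' t) = ∑' k, Measure.hausdorffMeasure 1 (Γ '' P k) := by
      conv_lhs => rw [hU, image_iUnion]
      refine measure_iUnion ?_ fun k => ?_
      · intro i j hij
        exact (hdis hij).image hinj ((hPt i).trans hta) ((hPt j).trans hta)
      · exact (hPm k).image_of_continuousOn_injOn hΓ.continuous.continuousOn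
          (hinj.mono ((hPt k).trans hta))
    have hL : ∫⁻ x in t, ‖deriv Γ x‖ₑ = ∑' k, ∫⁻ x in P k, ‖deriv Γ x‖ₑ := by
      conv_lhs => rw [hU]
      exact lintegral_iUnion hPm hdis _
    have hV : volume t = ∑' k, volume (P k) := by
      conv_lhs => rw [hU]
      exact measure_iUnion hdis hPm
    have hpiece : ∀ k, Measure.hausdorffMeasure 1 (Γ '' P k) ≤
          (∫⁻ x in P k, ‖deriv Γ x‖ₑ) + ε * volume (P k) ∧
        (∫⁻ x in P k, ‖deriv Γ x‖ₑ) ≤ Measure.hausdorffMeasure 1 (Γ '' P k) + ε * volume (P k) := by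
      intro k
      rcases (P k).eq_empty_or_nonempty with he | ⟨x₀, hx₀⟩
      · simp [he]
      set S : Set ℝ := Ico a b ∩ Ico (k * (r / 2)) ((k + 1) * (r / 2)) with hSdef
      have hPS : P k ⊆ S := by
        rintro x ⟨hx, hk⟩
        refine ⟨hta hx, ?_⟩
        have h2 := Int.floor_eq_iff.1 hk
        rw [le_div_iff₀ (by positivity), div_lt_iff₀ (by positivity)] at h2
        exact h2
      have hS : Convex ℝ S := (convex_Ico a b).inter (convex_Ico _ _)
      have hclose : ∀ x ∈ S, ‖deriv Γ x - deriv Γ x₀‖ ≤ ε / 2 := by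
        intro x hx
        rw [← dist_eq_norm]
        refine (hur x (Ico_subset_Icc_self hx.1) x₀ (Ico_subset_Icc_self (hPS hx₀).1) ?_).le
        have h1 := hx.2
        have h2 := (hPS hx₀).2
        rw [Real.dist_eq, abs_lt]
        constructor <;> linarith [h1.1, h1.2, h2.1, h2.2]
      obtain ⟨hup, hlo⟩ := hausdorffMeasure_image_bounds hS (fun x _ => hd x)
        (δ := ε / 2) (by positivity) hclose hPS
      set V := deriv Γ x₀
      constructor
      · calc _ ≤ _ := hup
          _ = ∫⁻ x in P k, ENNReal.ofReal (‖V‖ + ε / 2) := by rw [setLIntegral_const]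
          _ ≤ ∫⁻ x in P k, (‖deriv Γ x‖ₑ + ε) := by
              refine setLIntegral_mono' (hPm k) fun x hx => ?_
              rw [← ofReal_norm, ← ENNReal.ofReal_coe_nnreal,
                ← ENNReal.ofReal_add (norm_nonneg _) ε.coe_nonneg]
              refine ENNReal.ofReal_le_ofReal ?_
              have h1 := hclose x (hPS hx)
              have h2 := norm_sub_norm_le V (deriv Γ x)
              rw [norm_sub_rev] at h2
              linarith
          _ = _ := by
              rw [lintegral_add_right _ measurable_const, setLIntegral_const]
      · calc (∫⁻ x in P k, ‖deriv Γ x‖ₑ) ≤ ∫⁻ x in P k, (ENNReal.ofReal (‖V‖ - ε / 2) + ε) := by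
              refine setLIntegral_mono' (hPm k) fun x hx => ?_
              rw [← ofReal_norm, ← ENNReal.ofReal_coe_nnreal]
              refine le_trans ?_ ENNReal.ofReal_add_le
              refine ENNReal.ofReal_le_ofReal ?_
              have h1 := hclose x (hPS hx)
              have h2 := norm_sub_norm_le (deriv Γ x) V
              linarith
          _ = ENNReal.ofReal (‖V‖ - ε / 2) * volume (P k) + ε * volume (P k) := by
              rw [lintegral_add_right _ measurable_const, setLIntegral_const, setLIntegral_const]
          _ ≤ _ := by gcongr
    rw [hI, hL, hV, ← ENNReal.tsum_mul_left, ← ENNReal.tsum_add, ← ENNReal.tsum_add]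
    exact ⟨ENNReal.tsum_le_tsum fun k => (hpiece k).1, ENNReal.tsum_le_tsum fun k => (hpiece k).2⟩
  have lim : ∀ {x y : ℝ≥0∞}, (∀ ε : ℝ≥0, 0 < ε → x ≤ y + ε * volume t) → x ≤ y := by
    intro x y hxy
    have h1 : Tendsto (fun ε : ℝ≥0 => y + (ε : ℝ≥0∞) * volume t) (𝓝[>] 0) (𝓝 (y + 0 * volume t)) := by
      refine tendsto_const_nhds.add (ENNReal.Tendsto.mul_const ?_ (Or.inr hfin))
      exact (ENNReal.continuous_coe.tendsto' 0 0 (by simp)).mono_left nhdsWithin_le_nhds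
    rw [zero_mul, add_zero] at h1
    exact ge_of_tendsto h1 (eventually_mem_nhdsWithin.mono fun ε hε => hxy ε hε)
  exact le_antisymm (lim fun ε hε => (main ε hε).1) (lim fun ε hε => (main ε hε).2)

/-- The line integral along an injective `C¹` curve, computed in the parameter. -/
theorem integral_hausdorffMeasure_image_curve {Γ : ℝ → ℂ} (hΓ : ContDiff ℝ 1 Γ) {a b : ℝ}
    (hinj : InjOn Γ (Ico a b)) (g : ℂ → ℝ) :
    ((IntegrableOn g (Γ '' Ico a b) (Measure.hausdorffMeasure 1)) ↔
      IntegrableOn (fun x => ‖deriv Γ x‖ * g (Γ x)) (Ico a b)) ∧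
    ∫ z in Γ '' Ico a b, g z ∂(Measure.hausdorffMeasure 1) =
      ∫ x in Ico a b, ‖deriv Γ x‖ * g (Γ x) := by
  set φ : Ico a b → ℂ := fun x => Γ x with hφ
  have hemb : MeasurableEmbedding φ :=
    hΓ.continuous.continuousOn.measurableEmbedding measurableSet_Ico hinj
  have hcoe : MeasurableEmbedding (Subtype.val : Ico a b → ℝ) :=
    MeasurableEmbedding.subtype_coe measurableSet_Ico
  set ν : Measure (Ico a b) := (volume.comap Subtype.val).withDensity fun x => ‖deriv Γ x‖₊ with hν
  have hrange : range φ = Γ '' Ico a b := by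
    ext z; simp [hφ, mem_image]
  have hcd : Continuous (deriv Γ) := hΓ.continuous_deriv le_rfl
  -- Pulled back to the parameter interval, the Hausdorff measure is Lebesgue measure with the speed
  -- as density; the rest is a change of variables.
  have hcomap : (Measure.hausdorffMeasure 1 : Measure ℂ).comap φ = ν := by
    ext s hs
    rw [hemb.comap_apply, hν, withDensity_apply _ hs]
    have h1 : φ '' s = Γ '' (Subtype.val '' s) := by rw [image_image]
    have h2 : (∫⁻ x in s, (‖deriv Γ (x : ℝ)‖₊ : ℝ≥0∞) ∂(volume.comap Subtype.val)) =
        ∫⁻ x in Subtype.val '' s, ‖deriv Γ x‖ₑ := by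
      rw [← hcoe.lintegral_map (f := fun x : ℝ => (‖deriv Γ x‖₊ : ℝ≥0∞)), ← preimage_image_eq s Subtype.val_injective,
        ← hcoe.restrict_map, hcoe.map_comap, Subtype.range_coe, Measure.restrict_restrict
          (hcoe.measurableSet_image.2 hs), preimage_image_eq s Subtype.val_injective,
        inter_eq_self_of_subset_left (by rintro _ ⟨x, _, rfl⟩; exact x.2)]
      rfl
    rw [h1, h2, hausdorffMeasure_image_curve hΓ hinj (hcoe.measurableSet_image.2 hs)
      (by rintro _ ⟨x, _, rfl⟩; exact x.2)]
  have hrestr : (Measure.hausdorffMeasure 1 : Measure ℂ).restrict (Γ '' Ico a b) = ν.map φ := by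
    rw [← hcomap, hemb.map_comap, hrange]
  have hmap : (volume.comap (Subtype.val : Ico a b → ℝ)).map Subtype.val =
      volume.restrict (Ico a b) := by
    rw [hcoe.map_comap, Subtype.range_coe]
  have hmeas : Measurable fun x : Ico a b => ‖deriv Γ x‖₊ :=
    (hcd.comp continuous_subtype_val).measurable.nnnorm
  constructor
  · rw [IntegrableOn, hrestr, hemb.integrable_map_iff, hν,
      integrable_withDensity_iff_integrable_smul hmeas, IntegrableOn, ← hmap,
      hcoe.integrable_map_iff]
    rfl
  · rw [hrestr, hemb.integral_map, hν, integral_withDensity_eq_integral_smul hmeas, ← hmap,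
      hcoe.integral_map]
    rfl

end CurveArea

/-! ### The Cauchy–Pompeiu formula. -/

section CauchyPompeiu

/-- Twice the Wirtinger derivative `∂u/∂z̄`. -/
noncomputable def dbar (u : ℂ → ℂ) (z : ℂ) : ℂ := fderiv ℝ u z 1 + Complex.I * fderiv ℝ u z Complex.I

lemma continuous_dbar {u : ℂ → ℂ} (hu : ContDiff ℝ 1 u) : Continuous (dbar u) := by
  have := hu.continuous_fderiv one_ne_zero
  unfold dbar
  fun_prop

lemma dbar_eq_zero_of_differentiableAt {u : ℂ → ℂ} {z : ℂ} (hu : DifferentiableAt ℂ u z) :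
    dbar u z = 0 := by
  have h : fderiv ℝ u z = (fderiv ℂ u z).restrictScalars ℝ := hu.fderiv_restrictScalars ℝ
  have h2 : fderiv ℂ u z Complex.I = Complex.I * fderiv ℂ u z 1 := by
    rw [← smul_eq_mul, ← map_smul, smul_eq_mul, mul_one]
  rw [dbar, h, ContinuousLinearMap.coe_restrictScalars', h2, ← mul_assoc, Complex.I_mul_I]
  ring

lemma dbar_eq_zero_of_eventually_eq_zero {u : ℂ → ℂ} {z : ℂ} (hu : ∀ᶠ w in 𝓝 z, u w = 0) :
    dbar u z = 0 :=
  dbar_eq_zero_of_differentiableAt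
    (((differentiableAt_const (0 : ℂ)).congr_of_eventuallyEq (hu.mono fun w hw => by simpa using hw)))

/-- In polar coordinates `r · (∂_x u + i ∂_y u) / ζ` is `∂_r u + (i/r) ∂_θ u`, the functions `A` and
`B` below. Integration along rays turns the first term into `-u 0`; the second vanishes on each
circle by periodicity. -/
lemma integral_dbar_div {u : ℂ → ℂ} (hu : ContDiff ℝ 1 u) (hc : HasCompactSupport u) :
    ∫ ζ, dbar u ζ / ζ = -(2 * Real.pi * u 0) := by
  have hfd : Continuous (fderiv ℝ u) := hu.continuous_fderiv one_ne_zero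
  obtain ⟨R, hRpos, hR⟩ : ∃ R : ℝ, 0 < R ∧ ∀ z, R ≤ ‖z‖ → fderiv ℝ u z = 0 ∧ u z = 0 := by
    obtain ⟨R, hR⟩ := hc.isCompact.isBounded.subset_closedBall (0 : ℂ)
    refine ⟨|R| + 1, by positivity, fun z hz => ?_⟩
    have hz' : z ∉ tsupport u := fun h => by
      have := hR h
      rw [mem_closedBall_zero_iff] at this
      linarith [le_abs_self R]
    refine ⟨?_, image_eq_zero_of_notMem_tsupport hz'⟩
    have := support_fderiv_subset ℝ (f := u)
    by_contra hne
    exact hz' (this hne)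
  set e : ℝ → ℂ := fun θ => Real.cos θ + Real.sin θ * Complex.I with he
  have hec : Continuous e := by
    rw [he]; fun_prop
  have hnorm : ∀ r θ : ℝ, 0 ≤ r → ‖(r : ℂ) * e θ‖ = r := by
    intro r θ hr
    rw [norm_mul, Complex.norm_real, Real.norm_of_nonneg hr, he]
    simp only [Complex.ofReal_cos, Complex.ofReal_sin]
    rw [Complex.norm_cos_add_sin_mul_I, mul_one]
  set A : ℝ × ℝ → ℂ := fun p => fderiv ℝ u (p.1 * e p.2) (e p.2) with hA
  set B : ℝ × ℝ → ℂ := fun p => fderiv ℝ u (p.1 * e p.2) (Complex.I * e p.2) with hB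
  have hAc : Continuous A := by
    have h1 : Continuous fun p : ℝ × ℝ => (p.1 : ℂ) * e p.2 := by fun_prop
    exact (hfd.comp h1).clm_apply (hec.comp continuous_snd)
  have hBc : Continuous B := by
    have h1 : Continuous fun p : ℝ × ℝ => (p.1 : ℂ) * e p.2 := by fun_prop
    exact (hfd.comp h1).clm_apply (continuous_const.mul (hec.comp continuous_snd))
  have hzero : ∀ p : ℝ × ℝ, R ≤ p.1 → A p = 0 ∧ B p = 0 := by
    intro p hp
    have := (hR (p.1 * e p.2) (by rw [hnorm _ _ (hRpos.le.trans hp)]; exact hp)).1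
    simp [hA, hB, this]
  have hint : ∀ f : ℝ × ℝ → ℂ, Continuous f → (∀ p : ℝ × ℝ, R ≤ p.1 → f p = 0) →
      IntegrableOn f (Ioi 0 ×ˢ Ioo (-Real.pi) Real.pi) := by
    intro f hf h0
    have h1 : IntegrableOn f (Icc 0 R ×ˢ Icc (-Real.pi) Real.pi) :=
      hf.continuousOn.integrableOn_compact (isCompact_Icc.prod isCompact_Icc)
    refine h1.of_forall_sdiff_eq_zero (measurableSet_Ioi.prod measurableSet_Ioo) ?_
    rintro p ⟨⟨hp1, hp2⟩, hp3⟩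
    refine h0 p ?_
    by_contra hlt
    push Not at hlt
    exact hp3 ⟨⟨(mem_Ioi.1 hp1).le, hlt.le⟩, Ioo_subset_Icc_self hp2⟩
  have hAi := hint A hAc fun p hp => (hzero p hp).1
  have hBi := hint B hBc fun p hp => (hzero p hp).2
  have hed : ∀ θ, HasDerivAt e (Complex.I * e θ) θ := by
    intro θ
    have h1 := (Complex.hasDerivAt_cos (θ : ℂ)).comp_ofReal
    have h2 := ((Complex.hasDerivAt_sin (θ : ℂ)).comp_ofReal).mul_const Complex.I
    have h3 := h1.add h2
    have h4 : e = fun y : ℝ => Complex.cos y + Complex.sin y * Complex.I := by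
      funext y; simp [he]
    rw [h4]
    refine h3.congr_deriv ?_
    ring_nf
    rw [Complex.I_sq]; ring
  have hAval : ∀ θ : ℝ, ∫ r in Ioi (0 : ℝ), A (r, θ) = -u 0 := by
    intro θ
    have hd : ∀ r ∈ Ici (0 : ℝ), HasDerivAt (fun r : ℝ => u (r * e θ)) (A (r, θ)) r := by
      intro r _
      have h1 : HasDerivAt (fun r : ℝ => (r : ℂ) * e θ) (e θ) r := by
        simpa using (HasDerivAt.ofReal_comp (hasDerivAt_id r)).mul_const (e θ)
      exact (hu.differentiable one_ne_zero _).hasFDerivAt.comp_hasDerivAt r h1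
    have hi : IntegrableOn (fun r => A (r, θ)) (Ioi 0) := by
      have h1 : IntegrableOn (fun r => A (r, θ)) (Icc 0 R) :=
        (by fun_prop : Continuous fun r => A (r, θ)).continuousOn.integrableOn_compact isCompact_Icc
      refine h1.of_forall_sdiff_eq_zero measurableSet_Ioi ?_
      rintro r ⟨hr1, hr2⟩
      refine (hzero (r, θ) ?_).1
      by_contra hlt
      push Not at hlt
      exact hr2 ⟨(mem_Ioi.1 hr1).le, hlt.le⟩
    have ht : Tendsto (fun r : ℝ => u (r * e θ)) atTop (𝓝 0) := by
      refine tendsto_const_nhds.congr' ?_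
      filter_upwards [eventually_ge_atTop R] with r hr
      exact (hR _ (by rw [hnorm _ _ (hRpos.le.trans hr)]; exact hr)).2.symm
    rw [integral_Ioi_of_hasDerivAt_of_tendsto' hd hi ht]
    simp
  have hBval : ∀ r ∈ Ioi (0 : ℝ), ∫ θ in Ioo (-Real.pi) Real.pi, B (r, θ) = 0 := by
    intro r hr
    rw [← integral_Ioc_eq_integral_Ioo, ← intervalIntegral.integral_of_le (by linarith [Real.pi_pos])]
    have hr0 : (r : ℂ) ≠ 0 := by simpa using (ne_of_gt (mem_Ioi.1 hr))
    have hd : ∀ θ ∈ uIcc (-Real.pi) Real.pi,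
        HasDerivAt (fun θ : ℝ => (r : ℂ)⁻¹ * u (r * e θ)) (B (r, θ)) θ := by
      intro θ _
      have h2 := (hu.differentiable one_ne_zero _).hasFDerivAt.comp_hasDerivAt θ
        ((hed θ).const_mul (r : ℂ))
      have h3 := h2.const_mul ((r : ℂ)⁻¹)
      refine h3.congr_deriv ?_
      have h4 : (r : ℂ) * (Complex.I * e θ) = r • (Complex.I * e θ) := by simp
      rw [h4, map_smul, Complex.real_smul, ← mul_assoc, inv_mul_cancel₀ hr0, one_mul]
    rw [intervalIntegral.integral_eq_sub_of_hasDerivAt hd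
      ((by fun_prop : Continuous fun θ => B (r, θ)).intervalIntegrable _ _)]
    simp [he]
  have hcongr : ∀ p ∈ Complex.polarCoord.target,
      p.1 • (dbar u (Complex.polarCoord.symm p) / Complex.polarCoord.symm p) =
        A p + Complex.I * B p := by
    rintro ⟨r, θ⟩ ⟨hr, -⟩
    have hr0 : (r : ℂ) ≠ 0 := by simpa using (ne_of_gt (mem_Ioi.1 hr))
    rw [Complex.polarCoord_symm_apply]
    have hee : (Real.cos θ + Real.sin θ * Complex.I : ℂ) = e θ := rfl
    simp only [hee, hA, hB, dbar]
    set L := fderiv ℝ u (r * e θ)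
    have h1 : L (e θ) = Real.cos θ * L 1 + Real.sin θ * L Complex.I := by
      have : e θ = Real.cos θ • (1 : ℂ) + Real.sin θ • Complex.I := by simp [he]
      rw [this, map_add, map_smul, map_smul]; simp
    have h2 : L (Complex.I * e θ) = -Real.sin θ * L 1 + Real.cos θ * L Complex.I := by
      have : Complex.I * e θ = (-Real.sin θ) • (1 : ℂ) + Real.cos θ • Complex.I := by
        simp only [he, Complex.real_smul]; push_cast; ring_nf; rw [Complex.I_sq]; ring
      rw [this, map_add, map_smul, map_smul]; simp
    have h3 : e θ * (Real.cos θ - Real.sin θ * Complex.I) = 1 := by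
      have : (Real.cos θ : ℂ) ^ 2 + (Real.sin θ : ℂ) ^ 2 = 1 := by
        exact_mod_cast Real.cos_sq_add_sin_sq θ
      simp only [he]; ring_nf; rw [Complex.I_sq]; linear_combination this
    have he0 : e θ ≠ 0 := left_ne_zero_of_mul_eq_one h3
    rw [h1, h2, Complex.real_smul]
    field_simp
    have : L 1 + Complex.I * L Complex.I = (L 1 + Complex.I * L Complex.I) * 1 := by ring
    rw [this, ← h3]
    ring_nf
    rw [Complex.I_sq]; ring
  rw [← Complex.integral_comp_polarCoord_symm, setIntegral_congr_fun
    (polarCoord.open_target.measurableSet) hcongr]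
  have htarget : polarCoord.target = Ioi (0 : ℝ) ×ˢ Ioo (-Real.pi) Real.pi := rfl
  rw [htarget]
  have hBi' : IntegrableOn (fun p => Complex.I * B p) (Ioi 0 ×ˢ Ioo (-Real.pi) Real.pi) :=
    hBi.const_mul _
  rw [integral_add hAi hBi', Measure.volume_eq_prod, ← setIntegral_prod_swap, setIntegral_prod,
    setIntegral_prod _ hBi']
  · simp only [Prod.swap_prod_mk, hAval, integral_const_mul]
    rw [setIntegral_congr_fun (g := fun _ => (0 : ℂ)) measurableSet_Ioi
      (fun r hr => by simp only [hBval r hr])]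
    simp only [integral_zero, setIntegral_const, measureReal_def, Real.volume_Ioo,
      Complex.real_smul]
    rw [ENNReal.toReal_ofReal (by linarith [Real.pi_pos])]
    push_cast
    ring
  · have := hAi.swap
    simpa [Function.comp_def] using! this

/-- The **Cauchy–Pompeiu formula** for compactly supported functions. -/
theorem cauchyPompeiu {u : ℂ → ℂ} (hu : ContDiff ℝ 1 u) (hc : HasCompactSupport u) (z : ℂ) :
    ∫ ζ, dbar u ζ / (z - ζ) = 2 * Real.pi * u z := by
  have h1 : ContDiff ℝ 1 fun ζ => u (z + ζ) := hu.comp (contDiff_const.add contDiff_id)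
  have h2 : HasCompactSupport fun ζ => u (z + ζ) :=
    hc.comp_homeomorph (Homeomorph.addLeft z)
  have h3 := integral_dbar_div h1 h2
  have h4 : ∀ ζ, dbar (fun ζ => u (z + ζ)) ζ = dbar u (z + ζ) := by
    intro ζ
    simp only [dbar, fderiv_comp_add_left]
  rw [← integral_add_left_eq_self (fun ζ => dbar u ζ / (z - ζ)) z]
  have h5 : ∀ ζ, dbar u (z + ζ) / (z - (z + ζ)) = -(dbar (fun ζ => u (z + ζ)) ζ / ζ) := by
    intro ζ
    rw [h4, sub_add_cancel_left, div_neg]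
  simp only [h5, integral_neg, h3, add_zero]
  ring

end CauchyPompeiu

/-! ### Moving poles along the boundary curve. -/

section Primitive

/-- Moving a simple pole along a curve does not change the logarithm off the curve. -/
lemma exists_primitive_inv_sub_inv {γ : ℝ → ℂ} (hγ : ContDiff ℝ 1 γ) {t : ℝ} (ht : t ∈ Icc (0 : ℝ) 1) :
    ∃ Λ : ℂ → ℂ, ∀ z ∉ γ '' Icc 0 1, HasDerivAt Λ (1 / (z - γ t) - 1 / (z - γ 0)) z := by
  have hd : ∀ s, HasDerivAt γ (deriv γ s) s := fun s => (hγ.differentiable one_ne_zero s).hasDerivAt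
  have hdc : Continuous (deriv γ) := hγ.continuous_deriv le_rfl
  have hJ : IsCompact (γ '' Icc 0 1) := isCompact_Icc.image hγ.continuous
  -- This is `log ((γ t - z) / (γ 0 - z))`, continued along the curve. Its derivative in `z` is the
  -- integral of `γ' / (γ - z)²`, which is the exact derivative of `-1 / (γ - z)`.
  refine ⟨fun z => ∫ s in (0 : ℝ)..t, deriv γ s / (γ s - z), fun z hz => ?_⟩
  obtain ⟨δ, hδ, hball⟩ := Metric.isOpen_iff.1 hJ.isClosed.isOpen_compl z hz
  obtain ⟨M, hM⟩ := (isCompact_Icc (a := (0 : ℝ)) (b := 1)).exists_bound_of_continuousOn hdc.continuousOn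
  have hsub : ∀ s ∈ uIcc 0 t, s ∈ Icc (0 : ℝ) 1 := by
    intro s hs
    rw [uIcc_of_le ht.1] at hs
    exact ⟨hs.1, hs.2.trans ht.2⟩
  have hfar : ∀ s ∈ Icc (0 : ℝ) 1, ∀ w ∈ Metric.ball z (δ / 2), δ / 2 ≤ ‖γ s - w‖ := by
    intro s hs w hw
    by_contra hlt
    push Not at hlt
    refine hball (a := γ s) ?_ ⟨s, hs, rfl⟩
    rw [Metric.mem_ball] at hw ⊢
    have := dist_triangle (γ s) w z
    rw [dist_eq_norm (γ s) w] at this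
    linarith
  have hne : ∀ s ∈ Icc (0 : ℝ) 1, ∀ w ∈ Metric.ball z (δ / 2), γ s - w ≠ 0 := by
    intro s hs w hw h0
    have := hfar s hs w hw
    rw [h0, norm_zero] at this
    linarith
  have hz' : z ∈ Metric.ball z (δ / 2) := Metric.mem_ball_self (by positivity)
  have hcont : ∀ w ∈ Metric.ball z (δ / 2), ContinuousOn (fun s => deriv γ s / (γ s - w)) (uIcc 0 t) :=
    fun w hw => hdc.continuousOn.div (hγ.continuous.continuousOn.sub continuousOn_const)
      fun s hs => hne s (hsub s hs) w hw
  have hcont2 : ContinuousOn (fun s => deriv γ s / (γ s - z) ^ 2) (uIcc 0 t) :=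
    hdc.continuousOn.div ((hγ.continuous.continuousOn.sub continuousOn_const).pow 2)
      fun s hs => pow_ne_zero 2 (hne s (hsub s hs) z hz')
  have key := intervalIntegral.hasDerivAt_integral_of_dominated_loc_of_deriv_le (μ := volume)
    (F := fun w s => deriv γ s / (γ s - w)) (F' := fun w s => deriv γ s / (γ s - w) ^ 2)
    (a := 0) (b := t) (x₀ := z) (s := Metric.ball z (δ / 2)) (bound := fun _ => M / (δ / 2) ^ 2)
    (Metric.ball_mem_nhds _ (by positivity)) ?_ ?_ ?_ ?_ ?_ ?_
  · refine key.2.congr_deriv ?_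
    have hFTC : ∀ s ∈ uIcc 0 t, HasDerivAt (fun s => -(γ s - z)⁻¹) (deriv γ s / (γ s - z) ^ 2) s := by
      intro s hs
      have h1 := ((hd s).sub_const z).fun_inv (hne s (hsub s hs) z hz')
      exact h1.fun_neg.congr_deriv (by ring)
    rw [intervalIntegral.integral_eq_sub_of_hasDerivAt hFTC hcont2.intervalIntegrable]
    have h1 := hne t ht z hz'
    have h2 := hne 0 (by simp) z hz'
    have h1' : z - γ t ≠ 0 := by rw [← neg_sub]; exact neg_ne_zero.2 h1
    have h2' : z - γ 0 ≠ 0 := by rw [← neg_sub]; exact neg_ne_zero.2 h2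
    rw [← neg_sub z (γ t), ← neg_sub z (γ 0), inv_neg, inv_neg, neg_neg, neg_neg]
    simp
  · filter_upwards [Metric.ball_mem_nhds z (by positivity : 0 < δ / 2)] with w hw
    exact ((hcont w hw).mono uIoc_subset_uIcc).aestronglyMeasurable measurableSet_uIoc
  · exact (hcont z hz').intervalIntegrable
  · exact (hcont2.mono uIoc_subset_uIcc).aestronglyMeasurable measurableSet_uIoc
  · refine Eventually.of_forall fun s hs w hw => ?_
    have hs' := hsub s (uIoc_subset_uIcc hs)
    rw [norm_div, norm_pow]
    have h1 := hfar s hs' w hw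
    have h2 := hM s hs'
    have h3 : (0 : ℝ) ≤ M := (norm_nonneg _).trans h2
    gcongr
  · exact intervalIntegrable_const
  · refine Eventually.of_forall fun s hs w hw => ?_
    have h0 := hne s (hsub s (uIoc_subset_uIcc hs)) w hw
    have h1 := ((hasDerivAt_const w (γ s)).sub (hasDerivAt_id w)).fun_inv h0
    exact (h1.const_mul (deriv γ s)).congr_deriv (by simp [div_eq_mul_inv])

/-- Every `z` in a curve is near one of finitely many prescribed points, chosen measurably. -/
lemma exists_measurable_nearby_index {γ : ℝ → ℂ} (hγ : Continuous γ) {ε : ℝ} (hε : 0 < ε) :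
    ∃ (t : ℕ → ℝ) (N : ℕ) (i : ℂ → ℕ), (∀ n, t n ∈ Icc (0 : ℝ) 1) ∧ Measurable i ∧ (∀ z, i z ≤ N) ∧
      ∀ z, Metric.infDist z (γ '' Icc 0 1) ≤ 2 * ε → dist z (γ (t (i z))) < 3 * ε := by
  have : Nonempty (Icc (0 : ℝ) 1) := ⟨⟨0, by simp⟩⟩
  set d : ℕ → Icc (0 : ℝ) 1 := TopologicalSpace.denseSeq (Icc (0 : ℝ) 1) with hd
  have hJ : IsCompact (γ '' Icc 0 1) := isCompact_Icc.image hγ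
  set e : ℕ → ℂ := fun n => γ (d n) with he
  obtain ⟨N, hN⟩ := hJ.elim_directed_cover (fun n : ℕ => ⋃ k ∈ Iic n, Metric.ball (e k) ε)
    (fun n => isOpen_biUnion fun _ _ => Metric.isOpen_ball) (by
      rintro _ ⟨s, hs, rfl⟩
      have hc : Continuous fun x : Icc (0 : ℝ) 1 => γ x := hγ.comp continuous_subtype_val
      have hop : IsOpen {x : Icc (0 : ℝ) 1 | dist (γ s) (γ x) < ε} :=
        isOpen_lt (by fun_prop) continuous_const
      obtain ⟨x, hx, n, rfl⟩ := (TopologicalSpace.denseRange_denseSeq (Icc (0 : ℝ) 1)).inter_open_nonempty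
        _ hop ⟨⟨s, hs⟩, by simp [hε]⟩
      simp only [mem_iUnion]
      exact ⟨n, n, mem_Iic.2 le_rfl, hx⟩)
    (directed_of_isDirected_le fun m n hmn =>
      biUnion_subset_biUnion_left fun k hk => mem_Iic.2 ((mem_Iic.1 hk).trans hmn))
  refine ⟨fun n => d n, N, SimpleFunc.nearestPtInd e N, fun n => (d n).2,
    (SimpleFunc.nearestPtInd e N).measurable, SimpleFunc.nearestPtInd_le e N, fun z hz => ?_⟩
  -- A point of the curve lies within `2ε` of `z`, and a listed point within `ε` of that one; the
  -- nearest listed point is therefore at distance less than `3ε`.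
  obtain ⟨j, hj, hjz⟩ := hJ.exists_infDist_eq_dist ⟨γ 0, 0, by simp, rfl⟩ z
  obtain ⟨k, hk, hkj⟩ : ∃ k ≤ N, j ∈ Metric.ball (e k) ε := by simpa using hN hj
  have h1 := SimpleFunc.edist_nearestPt_le e z hk
  rw [edist_dist, edist_dist, ENNReal.ofReal_le_ofReal_iff dist_nonneg] at h1
  have h2 : dist (e (SimpleFunc.nearestPtInd e N z)) z ≤ dist (e k) z := h1
  have h3 := dist_triangle (e k) j z
  rw [Metric.mem_ball, dist_comm] at hkj
  rw [dist_comm z j] at hjz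
  calc dist z (γ (d (SimpleFunc.nearestPtInd e N z)))
      = dist (e (SimpleFunc.nearestPtInd e N z)) z := dist_comm _ _
    _ < 3 * ε := by linarith

end Primitive

/-! ### Primitives up to one simple pole, away from the boundary and from infinity. -/

section Primitive

open scoped Manifold

/-- A holomorphic function on `Ω`, cut off near the boundary curve and near infinity. -/
lemma exists_cutoff {Ω J : Set ℂ} (hΩ : IsOpen Ω) (hfr : frontier Ω = J) {F : ℂ → ℂ}
    (hF : DifferentiableOn ℂ F Ω) {ε R : ℝ} (hε : 0 < ε) (hR : 0 < R) :
    ∃ u : ℂ → ℂ, ContDiff ℝ 1 u ∧ HasCompactSupport u ∧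
      (∀ z ∈ Ω, 2 * ε < Metric.infDist z J → ‖z‖ < R → u z = F z) ∧
      ∀ z, dbar u z ≠ 0 → (Metric.infDist z J ≤ 2 * ε ∨ R ≤ ‖z‖) := by
  classical
  have hJc : Continuous fun z : ℂ => Metric.infDist z J := Metric.continuous_infDist_pt J
  obtain ⟨χ, hχ0, hχ1, -⟩ := exists_contMDiffMap_zero_one_of_isClosed (n := 1) 𝓘(ℝ, ℂ)
    (s := {z : ℂ | Metric.infDist z J ≤ ε}) (t := {z : ℂ | 2 * ε ≤ Metric.infDist z J})
    (isClosed_le hJc continuous_const) (isClosed_le continuous_const hJc)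
    (Set.disjoint_left.2 fun z hz hz' => by
      simp only [mem_ofPred_eq] at hz hz'
      linarith)
  have hχs : ContDiff ℝ 1 (χ : ℂ → ℝ) := χ.contMDiff.contDiff
  let ψ : ContDiffBump (0 : ℂ) := ⟨R, R + 1, hR, by linarith⟩
  -- The cutoff `χ` vanishes near the curve, so extension by zero outside `Ω` is smooth. Since `F`
  -- is holomorphic, `dbar u` lives only where one of the cutoffs is active.
  set u : ℂ → ℂ := Ω.indicator fun z => ((χ z * ψ z : ℝ) : ℂ) * F z with hu
  have hloc : ∀ z ∉ Ω, ∀ᶠ w in 𝓝 z, u w = 0 := by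
    intro z hz
    by_cases hzJ : z ∈ J
    · have hop : {w | Metric.infDist w J < ε} ∈ 𝓝 z :=
        (isOpen_lt hJc continuous_const).mem_nhds (by
          simp only [mem_ofPred_eq, Metric.infDist_zero_of_mem hzJ, hε])
      filter_upwards [hop] with w hw
      have : χ w = 0 := hχ0 (le_of_lt hw)
      rw [hu, indicator_apply, this]
      simp
    · have hzc : z ∉ closure Ω := by
        intro hc
        rw [← hfr, hΩ.frontier_eq] at hzJ
        exact hzJ ⟨hc, hz⟩
      filter_upwards [isClosed_closure.isOpen_compl.mem_nhds hzc] with w hw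
      exact indicator_of_notMem (fun h => hw (subset_closure h)) _
  have hV : IsOpen {z | z ∈ Ω ∧ 2 * ε < Metric.infDist z J ∧ ‖z‖ < R} :=
    hΩ.inter ((isOpen_lt continuous_const hJc).inter (isOpen_lt continuous_norm continuous_const))
  have huF : ∀ z ∈ Ω, 2 * ε < Metric.infDist z J → ‖z‖ < R → u z = F z := by
    intro z hz h1 h2
    have e1 : χ z = 1 := hχ1 (le_of_lt h1)
    have e2 : ψ z = 1 := ψ.one_of_mem_closedBall (by rw [mem_closedBall_zero_iff]; exact h2.le)
    rw [hu, indicator_of_mem hz, e1, e2]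
    simp
  refine ⟨u, ?_, ?_, huF, ?_⟩
  · rw [contDiff_iff_contDiffAt]
    intro z
    by_cases hz : z ∈ Ω
    · have h1 : ContDiffAt ℝ 1 F z :=
        ((hF.analyticAt (hΩ.mem_nhds hz)).contDiffAt (n := 1)).restrict_scalars ℝ
      have h2 : ContDiffAt ℝ 1 (fun z => ((χ z * ψ z : ℝ) : ℂ) * F z) z :=
        (Complex.ofRealCLM.contDiff.contDiffAt.comp z
          (hχs.contDiffAt.mul ψ.contDiffAt)).mul h1
      refine h2.congr_of_eventuallyEq ?_
      filter_upwards [hΩ.mem_nhds hz] with w hw using indicator_of_mem hw _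
    · exact contDiffAt_const (c := (0 : ℂ)).congr_of_eventuallyEq (hloc z hz)
  · refine HasCompactSupport.intro (isCompact_closedBall (0 : ℂ) (R + 1)) fun z hz => ?_
    have : ψ z = 0 := ψ.zero_of_le_dist (by
      rw [Metric.mem_closedBall, not_le] at hz
      exact hz.le)
    rw [hu, indicator_apply, this]
    simp
  · intro z hz
    by_contra hcon
    push Not at hcon
    by_cases hzΩ : z ∈ Ω
    · refine hz (dbar_eq_zero_of_differentiableAt ?_)
      refine (hF.differentiableAt (hΩ.mem_nhds hzΩ)).congr_of_eventuallyEq ?_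
      filter_upwards [hV.mem_nhds (⟨hzΩ, hcon⟩ : z ∈ {z | z ∈ Ω ∧ 2 * ε < Metric.infDist z J ∧ ‖z‖ < R})]
        with w hw using huF w hw.1 hw.2.1 hw.2.2
    · exact hz (dbar_eq_zero_of_eventually_eq_zero (hloc z hzΩ))

lemma norm_log_one_sub_le_of_norm_le {w : ℂ} {q : ℝ} (hq : q < 1) (hw : ‖w‖ ≤ q) :
    ‖Complex.log (1 - w)‖ ≤ (1 - q)⁻¹ / 2 + 1 := by
  have h1 : ‖-w‖ < 1 := by rw [norm_neg]; linarith
  have h2 := Complex.norm_log_one_add_le h1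
  rw [norm_neg, ← sub_eq_add_neg] at h2
  have h3 : (1 - ‖w‖)⁻¹ ≤ (1 - q)⁻¹ := inv_anti₀ (by linarith) (by linarith)
  have h4 : ‖w‖ ^ 2 ≤ 1 := by nlinarith [norm_nonneg w]
  have h5 : 0 ≤ (1 - ‖w‖)⁻¹ := inv_nonneg.2 (by linarith)
  nlinarith [mul_le_mul_of_nonneg_right h4 h5]

/-- Away from the boundary curve and from infinity, a holomorphic function is a derivative up to a
multiple of a simple pole on the curve. -/
lemma exists_primitive_add_pole {Ω : Set ℂ} (hΩ : IsOpen Ω) {γ : ℝ → ℂ} (hγ : ContDiff ℝ 1 γ)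
    (hfr : frontier Ω = γ '' Icc 0 1) {F : ℂ → ℂ} (hF : DifferentiableOn ℂ F Ω) {ε R : ℝ}
    (hε : 0 < ε) (hR : 0 < R) :
    ∃ (G : ℂ → ℂ) (A : ℂ), ∀ z ∈ Ω, 4 * ε < Metric.infDist z (γ '' Icc 0 1) → ‖z‖ < R →
      HasDerivAt G (F z - A / (z - γ 0)) z := by
  set J := γ '' Icc 0 1 with hJdef
  obtain ⟨u, hu1, huc, huF, hm0⟩ := exists_cutoff hΩ hfr hF hε hR
  obtain ⟨t, N, i, ht, hi, hiN, hnear⟩ := exists_measurable_nearby_index hγ.continuous hε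
  choose Λ hΛ using fun n => exists_primitive_inv_sub_inv hγ (ht n)
  set m := dbar u with hmdef
  have hmc : Continuous m := continuous_dbar hu1
  have hmcs : HasCompactSupport m := by
    refine huc.mono' ?_
    intro z hz
    by_contra hzn
    refine hz (dbar_eq_zero_of_eventually_eq_zero ?_)
    exact notMem_tsupport_iff_eventuallyEq.1 hzn
  have hmi : Integrable m := hmc.integrable_of_hasCompactSupport hmcs
  -- A primitive in `z` of the Cauchy kernel `1 / (z - ζ)`, up to a pole at `γ 0`. For `|ζ| ≥ R` the
  -- logarithm of `1 - z/ζ` serves. For `ζ` near the curve, with `c` the chosen curve point, `log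
  -- ((z - ζ)/(z - c))` has derivative `1/(z - ζ) - 1/(z - c)`, and `Λ` moves the remaining pole
  -- from `c` to `γ 0`. The principal branch is legitimate because `|ζ - c| < 3ε < 4ε < |z - c|`;
  -- the index is measurable so that `ζ` can be integrated out.
  set k : ℂ → ℂ → ℂ := fun z ζ => if ‖ζ‖ < R then
    Complex.log (1 - (ζ - γ (t (i ζ))) / (z - γ (t (i ζ)))) + Λ (i ζ) z
    else Complex.log (1 - z / ζ) with hk
  set k' : ℂ → ℂ → ℂ := fun z ζ => 1 / (z - ζ) - if ‖ζ‖ < R then 1 / (z - γ 0) else 0 with hk'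
  have hti : ∀ g : ℕ → ℂ, Measurable fun ζ => g (i ζ) := fun g =>
    (measurable_from_nat (f := g)).comp hi
  have hnormR : MeasurableSet {ζ : ℂ | ‖ζ‖ < R} := measurableSet_lt measurable_norm measurable_const
  have hkm : ∀ z, Measurable (k z) := by
    intro z
    refine Measurable.ite hnormR ?_ ?_
    · refine Measurable.add ?_ (hti fun n => Λ n z)
      refine Complex.measurable_log.comp (measurable_const.sub (Measurable.div ?_ ?_))
      · exact measurable_id.sub (hti fun n => γ (t n))
      · exact measurable_const.sub (hti fun n => γ (t n))
    · exact Complex.measurable_log.comp (measurable_const.sub (measurable_const.div measurable_id))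
  have hk'm : ∀ z, Measurable (k' z) := by
    intro z
    exact (measurable_const.div (measurable_const.sub measurable_id)).sub
      (Measurable.ite hnormR measurable_const measurable_const)
  have hJmem : ∀ n, γ (t n) ∈ J := fun n => ⟨t n, ht n, rfl⟩
  -- The residue `A` is the normalized total mass of `dbar u` inside `|ζ| < R`: every kernel there
  -- leaves one unit pole at `γ 0`.
  refine ⟨fun z => (2 * Real.pi : ℂ)⁻¹ * ∫ ζ, m ζ * k z ζ,
    (2 * Real.pi : ℂ)⁻¹ * ∫ ζ, m ζ * (if ‖ζ‖ < R then 1 else 0), fun z₀ hz₀ hz₁ hz₂ => ?_⟩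
  set V : Set ℂ := {z | z ∈ Ω ∧ 4 * ε < Metric.infDist z J ∧ ‖z‖ < R} with hV
  have hVo : IsOpen V := hΩ.inter ((isOpen_lt continuous_const
    (Metric.continuous_infDist_pt J)).inter (isOpen_lt continuous_norm continuous_const))
  obtain ⟨δ, hδ, hball⟩ := Metric.isOpen_iff.1 hVo z₀ ⟨hz₀, hz₁, hz₂⟩
  have hsub : Metric.ball z₀ (δ / 2) ⊆ V :=
    (Metric.ball_subset_ball (by linarith)).trans hball
  have hz₀' : z₀ ∈ Metric.ball z₀ (δ / 2) := Metric.mem_ball_self (by positivity)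
  have hfar : ∀ z ∈ Metric.ball z₀ (δ / 2), ∀ ζ, m ζ ≠ 0 → δ / 2 ≤ ‖z - ζ‖ := by
    intro z hz ζ hζ
    by_contra hlt
    push Not at hlt
    have h1 : ζ ∈ V := by
      refine hball ?_
      rw [Metric.mem_ball] at hz ⊢
      have := dist_triangle ζ z z₀
      rw [dist_comm ζ z, dist_eq_norm z ζ] at this
      linarith
    rcases hm0 ζ hζ with h2 | h2
    · linarith [h1.2.1]
    · linarith [h1.2.2]
  have hpole : ∀ z ∈ V, ∀ p ∈ J, 4 * ε < ‖z - p‖ := by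
    intro z hz p hp
    rw [← dist_eq_norm]
    exact hz.2.1.trans_le (Metric.infDist_le_dist_of_mem hp)
  have hkd : ∀ ζ, m ζ ≠ 0 → ∀ z ∈ Metric.ball z₀ (δ / 2),
      HasDerivAt (fun z => k z ζ) (k' z ζ) z := by
    intro ζ hζ z hz
    have hzV := hsub hz
    have hzζ : z - ζ ≠ 0 := by
      have := hfar z hz ζ hζ
      intro h0
      rw [h0, norm_zero] at this
      linarith
    by_cases hlt : ‖ζ‖ < R
    · have hinf : Metric.infDist ζ J ≤ 2 * ε := (hm0 ζ hζ).resolve_right (not_le.2 hlt)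
      simp only [hk, hk', hlt, if_true]
      set c := γ (t (i ζ)) with hc
      have hζc : ‖ζ - c‖ < 3 * ε := by rw [← dist_eq_norm]; exact hnear ζ hinf
      have hzc : 4 * ε < ‖z - c‖ := hpole z hzV c (hJmem _)
      have hzc0 : z - c ≠ 0 := norm_pos_iff.1 (by linarith)
      have hslit : 1 - (ζ - c) / (z - c) ∈ Complex.slitPlane := by
        rw [sub_eq_add_neg]
        refine Complex.mem_slitPlane_of_norm_lt_one ?_
        rw [norm_neg, norm_div, div_lt_one (by linarith)]
        linarith
      have h1 := (((hasDerivAt_id z).sub_const c).fun_inv hzc0).const_mul (ζ - c)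
      have h2 := ((hasDerivAt_const z (1 : ℂ)).sub h1).clog hslit
      have hzJ : z ∉ J := fun hzJ => by
        have := hpole z hzV z hzJ
        simp at this
        linarith
      refine (h2.add (hΛ (i ζ) z hzJ)).congr_deriv ?_
      have h3 : 1 - (ζ - c) / (z - c) = (z - ζ) / (z - c) := by field_simp; ring
      have hzγ : z - γ 0 ≠ 0 := norm_pos_iff.1 (by
        have := hpole z hzV (γ 0) ⟨0, by simp, rfl⟩
        linarith)
      change (0 - (ζ - c) * (-1 / (z - c) ^ 2)) / (1 - (ζ - c) / (z - c)) +
        (1 / (z - c) - 1 / (z - γ 0)) = 1 / (z - ζ) - 1 / (z - γ 0)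
      rw [h3]
      field_simp
      ring
    · have hle : R ≤ ‖ζ‖ := not_lt.1 hlt
      simp only [hk, hk', hlt, if_false]
      have hζ0 : ζ ≠ 0 := norm_pos_iff.1 (by linarith)
      have hslit : 1 - z / ζ ∈ Complex.slitPlane := by
        rw [sub_eq_add_neg]
        refine Complex.mem_slitPlane_of_norm_lt_one ?_
        rw [norm_neg, norm_div, div_lt_one (by linarith)]
        exact hzV.2.2.trans_le hle
      have h1 := (hasDerivAt_id z).div_const ζ
      have h2 := ((hasDerivAt_const z (1 : ℂ)).sub h1).clog hslit
      refine h2.congr_deriv ?_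
      have h3 : 1 - z / ζ = (ζ - z) / ζ := by field_simp
      have hζz : ζ - z ≠ 0 := by rw [← neg_sub]; exact neg_ne_zero.2 hzζ
      change (0 - 1 / ζ) / (1 - z / ζ) = 1 / (z - ζ) - 0
      rw [h3]
      field_simp
      ring
  set b1 : ℝ := (1 - (3 : ℝ) / 4)⁻¹ / 2 + 1 + ∑ n ∈ Finset.range (N + 1), ‖Λ n z₀‖ with hb1
  set b2 : ℝ := (1 - ‖z₀‖ / R)⁻¹ / 2 + 1 with hb2
  have hkb : ∀ ζ, m ζ ≠ 0 → ‖k z₀ ζ‖ ≤ max b1 b2 := by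
    intro ζ hζ
    by_cases hlt : ‖ζ‖ < R
    · have hinf : Metric.infDist ζ J ≤ 2 * ε := (hm0 ζ hζ).resolve_right (not_le.2 hlt)
      simp only [hk, hlt, if_true]
      refine le_max_of_le_left ((norm_add_le _ _).trans (add_le_add ?_ ?_))
      · refine norm_log_one_sub_le_of_norm_le (by norm_num) ?_
        have hζc : ‖ζ - γ (t (i ζ))‖ < 3 * ε := by rw [← dist_eq_norm]; exact hnear ζ hinf
        have hzc := hpole z₀ (hsub hz₀') _ (hJmem (i ζ))
        rw [norm_div, div_le_iff₀ (by linarith)]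
        linarith
      · exact Finset.single_le_sum (f := fun n => ‖Λ n z₀‖) (fun _ _ => norm_nonneg _)
          (Finset.mem_range.2 (Nat.lt_succ_of_le (hiN ζ)))
    · have hle : R ≤ ‖ζ‖ := not_lt.1 hlt
      simp only [hk, hlt, if_false]
      refine le_max_of_le_right (norm_log_one_sub_le_of_norm_le ((div_lt_one hR).2 hz₂) ?_)
      rw [norm_div]
      gcongr
  have key := hasDerivAt_integral_of_dominated_loc_of_deriv_le (μ := (volume : Measure ℂ))
    (F := fun z ζ => m ζ * k z ζ) (F' := fun z ζ => m ζ * k' z ζ) (x₀ := z₀)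
    (s := Metric.ball z₀ (δ / 2)) (bound := fun ζ => ‖m ζ‖ * ((δ / 2)⁻¹ + (4 * ε)⁻¹))
    (Metric.ball_mem_nhds _ (by positivity))
    (Eventually.of_forall fun z => (hmc.measurable.mul (hkm z)).aestronglyMeasurable)
    ?_ (hmc.measurable.mul (hk'm z₀)).aestronglyMeasurable ?_ (hmi.norm.mul_const _) ?_
  · have hind : Integrable fun ζ => m ζ * (if ‖ζ‖ < R then (1 : ℂ) else 0) := by
      refine hmi.norm.mono' (hmc.measurable.mul
        (Measurable.ite hnormR measurable_const measurable_const)).aestronglyMeasurable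
        (Eventually.of_forall fun ζ => ?_)
      by_cases hlt : ‖ζ‖ < R <;> simp [hlt]
    have hsplit : ∀ ζ, m ζ / (z₀ - ζ) =
        m ζ * k' z₀ ζ + m ζ * (if ‖ζ‖ < R then 1 else 0) * (1 / (z₀ - γ 0)) := by
      intro ζ
      by_cases hlt : ‖ζ‖ < R <;> simp [hk', hlt] <;> ring
    have hCP := cauchyPompeiu hu1 huc z₀
    rw [huF z₀ hz₀ (by linarith) hz₂] at hCP
    simp only [← hmdef, hsplit] at hCP
    rw [integral_add key.1 (hind.mul_const _), integral_mul_const] at hCP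
    refine (key.2.const_mul _).congr_deriv ?_
    have hpi : (2 * Real.pi : ℂ) ≠ 0 := by
      simp [Real.pi_ne_zero]
    rw [eq_sub_iff_add_eq]
    have : F z₀ = (2 * Real.pi : ℂ)⁻¹ * (2 * Real.pi * F z₀) := by
      rw [← mul_assoc, inv_mul_cancel₀ hpi, one_mul]
    rw [this, ← hCP]
    ring
  · refine (hmi.norm.mul_const (max b1 b2)).mono'
      (hmc.measurable.mul (hkm z₀)).aestronglyMeasurable (Eventually.of_forall fun ζ => ?_)
    by_cases hζ : m ζ = 0
    · simp [hζ]
    · rw [norm_mul]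
      gcongr
      exact hkb ζ hζ
  · refine Eventually.of_forall fun ζ z hz => ?_
    by_cases hζ : m ζ = 0
    · simp [hζ]
    · rw [norm_mul]
      gcongr
      refine (norm_sub_le _ _).trans (add_le_add ?_ ?_)
      · rw [norm_div, norm_one, one_div]
        exact inv_anti₀ (by positivity) (hfar z hz ζ hζ)
      · have := hpole z (hsub hz) (γ 0) ⟨0, by simp, rfl⟩
        split_ifs
        · rw [norm_div, norm_one, one_div]
          exact inv_anti₀ (by positivity) this.le
        · simp; positivity
  · refine Eventually.of_forall fun ζ z hz => ?_
    by_cases hζ : m ζ = 0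
    · simp only [hζ, zero_mul]
      exact hasDerivAt_const _ _
    · exact (hkd ζ hζ z hz).const_mul _

end Primitive

/-! ### Primitives in an exterior domain. -/

section Primitive

/-- In an exterior domain bounded by a curve, a holomorphic function with a primitive near infinity
has a primitive. -/
theorem exists_primitive_exterior {Ω : Set ℂ} (hΩ : IsOpen Ω) (hconn : IsConnected Ω) {γ : ℝ → ℂ}
    (hγ : ContDiff ℝ 1 γ) (hfr : frontier Ω = γ '' Icc 0 1) {F : ℂ → ℂ}
    (hF : DifferentiableOn ℂ F Ω) {R₀ : ℝ} (hR₀ : 0 < R₀) (hout : ∀ z : ℂ, R₀ < ‖z‖ → z ∈ Ω)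
    {P₀ : ℂ → ℂ} (hP₀ : ∀ z : ℂ, R₀ < ‖z‖ → HasDerivAt P₀ (F z) z) :
    ∃ P : ℂ → ℂ, ∀ z ∈ Ω, HasDerivAt P (F z) z := by
  classical
  set J := γ '' Icc 0 1 with hJdef
  have hJ : IsCompact J := isCompact_Icc.image hγ.continuous
  have hJne : J.Nonempty := ⟨γ 0, 0, by simp, rfl⟩
  obtain ⟨M, hM⟩ := hJ.isBounded.subset_closedBall (0 : ℂ)
  -- Points beyond `R₁` are farther than `4` from the curve. As `ε n ≤ 1`, the annulus `R₁ < |z| <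
  -- R₁ + 1` lies in every region of the exhaustion.
  set R₁ : ℝ := max R₀ (M + 5) with hR₁
  have hinf : ∀ z : ℂ, R₁ < ‖z‖ → 4 < Metric.infDist z J := by
    intro z hz
    obtain ⟨j, hj, hjz⟩ := hJ.exists_infDist_eq_dist hJne z
    rw [hjz, dist_eq_norm]
    have h1 := hM hj
    rw [mem_closedBall_zero_iff] at h1
    have h2 := norm_sub_norm_le z j
    have h3 : M + 5 ≤ R₁ := le_max_right _ _
    linarith
  have hR₁0 : R₀ ≤ R₁ := le_max_left _ _
  set ε : ℕ → ℝ := fun n => 1 / ((n : ℝ) + 1) with hε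
  have hε0 : ∀ n, 0 < ε n := fun n => by simp only [hε]; positivity
  have hε1 : ∀ n, ε n ≤ 1 := fun n => by
    simp only [hε]
    rw [div_le_one (by positivity)]
    linarith [(Nat.cast_nonneg n : (0 : ℝ) ≤ n)]
  set R : ℕ → ℝ := fun n => R₁ + 1 + n with hRdef
  have hRpos : ∀ n, 0 < R n := fun n => by
    simp only [hRdef]
    have : (0 : ℝ) ≤ n := Nat.cast_nonneg n
    linarith
  choose G A hG using fun n => exists_primitive_add_pole hΩ hγ hfr hF (hε0 n) (hRpos n)
  set V : ℕ → Set ℂ := fun n => {z | z ∈ Ω ∧ 4 * ε n < Metric.infDist z J ∧ ‖z‖ < R n} with hV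
  have hVo : ∀ n, IsOpen (V n) := fun n => hΩ.inter ((isOpen_lt continuous_const
    (Metric.continuous_infDist_pt J)).inter (isOpen_lt continuous_norm continuous_const))
  have hVmono : ∀ m n, m ≤ n → V m ⊆ V n := by
    rintro m n hmn z ⟨h1, h2, h3⟩
    have hc : (m : ℝ) ≤ n := Nat.cast_le.2 hmn
    refine ⟨h1, lt_of_le_of_lt ?_ h2, h3.trans_le ?_⟩
    · simp only [hε]
      gcongr
    · simp only [hRdef]
      linarith
  have hann : ∀ n, ∀ z : ℂ, R₁ < ‖z‖ → ‖z‖ < R₁ + 1 → z ∈ V n := by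
    intro n z h1 h2
    refine ⟨hout z (by linarith), ?_, ?_⟩
    · have := hinf z h1
      have := hε1 n
      linarith
    · have : (0 : ℝ) ≤ n := Nat.cast_nonneg n
      simp only [hRdef]
      linarith
  set ρ : ℝ := R₁ + 1 / 2 with hρ
  have hρ0 : 0 < ρ := by linarith
  -- On a circle in the common annulus, `A n / (z - γ 0)` is the derivative of `P₀ - G n`, so its
  -- integral `2πi A n` vanishes.
  have hA : ∀ n, A n = 0 := by
    intro n
    have h1 : ∀ z ∈ Metric.sphere (0 : ℂ) ρ,
        HasDerivWithinAt (fun z => P₀ z - G n z) (A n * (z - γ 0)⁻¹) (Metric.sphere 0 ρ) z := by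
      intro z hz
      rw [mem_sphere_zero_iff_norm] at hz
      have hzV := hann n z (by linarith) (by linarith)
      refine (((hP₀ z (by linarith)).sub (hG n z hzV.1 hzV.2.1 hzV.2.2)).congr_deriv ?_).hasDerivWithinAt
      rw [div_eq_mul_inv]; ring
    have h2 := circleIntegral.integral_eq_zero_of_hasDerivWithinAt hρ0.le h1
    rw [circleIntegral.integral_const_mul, circleIntegral.integral_sub_inv_of_mem_ball] at h2
    · simpa [Real.pi_ne_zero] using h2
    · rw [mem_ball_zero_iff]
      have h3 := hM (⟨0, by simp, rfl⟩ : γ 0 ∈ J)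
      rw [mem_closedBall_zero_iff] at h3
      have h4 : M + 5 ≤ R₁ := le_max_right _ _
      linarith
  have hG' : ∀ n, ∀ z ∈ V n, HasDerivAt (G n) (F z) z := by
    intro n z hz
    refine (hG n z hz.1 hz.2.1 hz.2.2).congr_deriv ?_
    rw [hA n]; simp
  set a : ℂ := (ρ : ℂ) with ha
  have hna : ‖a‖ = ρ := by rw [ha, Complex.norm_real, Real.norm_of_nonneg hρ0.le]
  have haV : ∀ n, a ∈ V n := fun n => hann n a (by linarith) (by linarith)
  -- The regions `V n` may be disconnected. On the component of `a`, the primitives normalized to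
  -- vanish at `a` are compatible, and these components exhaust `Ω` because a path from `a` to a
  -- given point is compact.
  set C : ℕ → Set ℂ := fun n => connectedComponentIn (V n) a with hC
  have hCo : ∀ n, IsOpen (C n) := fun n => (hVo n).connectedComponentIn
  have hCV : ∀ n, C n ⊆ V n := fun n => connectedComponentIn_subset _ _
  have hCmono : ∀ m n, m ≤ n → C m ⊆ C n := fun m n hmn => connectedComponentIn_mono a (hVmono m n hmn)
  have haC : ∀ n, a ∈ C n := fun n => mem_connectedComponentIn (haV n)
  have hcompat : ∀ m n, m ≤ n → ∀ z ∈ C m, G m z - G m a = G n z - G n a := by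
    intro m n hmn
    refine IsOpen.eqOn_of_deriv_eq (𝕜 := ℂ) (hCo m) isPreconnected_connectedComponentIn ?_ ?_ ?_
      (haC m) (by simp)
    · exact fun z hz => ((hG' m z (hCV m hz)).sub_const _).differentiableAt.differentiableWithinAt
    · exact fun z hz => ((hG' n z (hVmono m n hmn (hCV m hz))).sub_const _).differentiableAt.differentiableWithinAt
    · intro z hz
      rw [((hG' m z (hCV m hz)).sub_const _).deriv,
        ((hG' n z (hVmono m n hmn (hCV m hz))).sub_const _).deriv]
  have hVU : Ω ⊆ ⋃ n, V n := by
    intro z hz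
    have hzJ : z ∉ J := by
      rw [← hfr, hΩ.frontier_eq]
      exact fun h => h.2 hz
    have hpos : 0 < Metric.infDist z J := (hJ.isClosed.notMem_iff_infDist_pos hJne).1 hzJ
    obtain ⟨n, hn⟩ := exists_nat_gt (max (4 / Metric.infDist z J) ‖z‖)
    have hn1 := (le_max_left _ _).trans_lt hn
    have hn2 := (le_max_right _ _).trans_lt hn
    rw [mem_iUnion]
    refine ⟨n, hz, ?_, ?_⟩
    · simp only [hε]
      rw [div_lt_iff₀ hpos] at hn1
      rw [mul_one_div, div_lt_iff₀ (by positivity)]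
      nlinarith
    · simp only [hRdef]
      linarith
  have hCU : ∀ z ∈ Ω, ∃ n, z ∈ C n := by
    intro z hz
    have hpc := (hΩ.isConnected_iff_isPathConnected).1 hconn
    obtain ⟨p, hp⟩ := hpc.joinedIn a (haV 0).1 z hz
    obtain ⟨n, hn⟩ := (isCompact_range p.continuous).elim_directed_cover V hVo
      (by rintro _ ⟨x, rfl⟩; exact hVU (hp x))
      (directed_of_isDirected_le hVmono)
    refine ⟨n, ?_⟩
    exact (isPreconnected_range p.continuous).subset_connectedComponentIn ⟨0, p.source⟩ hn
      ⟨1, p.target⟩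
  refine ⟨fun z => if h : ∃ n, z ∈ C n then G (Nat.find h) z - G (Nat.find h) a else 0, fun z hz => ?_⟩
  obtain ⟨n, hn⟩ := hCU z hz
  refine ((hG' n z (hCV n hn)).sub_const (G n a)).congr_of_eventuallyEq ?_
  filter_upwards [(hCo n).mem_nhds hn] with w hw
  have hex : ∃ n, w ∈ C n := ⟨n, hw⟩
  rw [dif_pos hex]
  exact hcompat _ n (Nat.find_min' hex hw) w (Nat.find_spec hex)

end Primitive

/-! ### Real potentials, exterior neighbourhoods of infinity, and decay of the gradient. -/

section Infinity

/-- The real differential `v ↦ Re (w v)`. -/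
noncomputable def gradForm (w : ℂ) : ℂ →L[ℝ] ℝ := Complex.reCLM ∘L ContinuousLinearMap.mul ℝ ℂ w

@[simp] lemma gradForm_apply (w v : ℂ) : gradForm w v = (w * v).re := rfl

lemma hasFDerivAt_re {H : ℂ → ℂ} {w z : ℂ} (h : HasDerivAt H w z) :
    HasFDerivAt (fun z => (H z).re) (gradForm w) z := by
  refine (Complex.reCLM.hasFDerivAt.comp z (h.hasFDerivAt.restrictScalars ℝ)).congr_fderiv ?_
  ext v
  simp
  ring

lemma HasFDerivAt.gradForm_comp {N : ℂ → ℝ} {g : ℂ → ℂ} {w g' z : ℂ}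
    (hN : HasFDerivAt N (gradForm w) (g z)) (hg : HasDerivAt g g' z) :
    HasFDerivAt (fun z => N (g z)) (gradForm (w * g')) z := by
  refine (hN.comp z (hg.hasFDerivAt.restrictScalars ℝ)).congr_fderiv ?_
  ext v
  simp
  ring

/-- This identifies a potential, on a connected open set, with the real part of a holomorphic
primitive of its gradient. -/
lemma exists_eq_add_const_of_gradForm {s : Set ℂ} (hs : IsOpen s) (hs' : IsPreconnected s)
    {N M : ℂ → ℝ} {f : ℂ → ℂ} (hN : ∀ z ∈ s, HasFDerivAt N (gradForm (f z)) z)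
    (hM : ∀ z ∈ s, HasFDerivAt M (gradForm (f z)) z) : ∃ C : ℝ, ∀ z ∈ s, N z = M z + C := by
  have hd : ∀ z ∈ s, HasFDerivAt (fun z => N z - M z) (0 : ℂ →L[ℝ] ℝ) z := fun z hz => by
    simpa using (hN z hz).fun_sub (hM z hz)
  obtain ⟨C, hC⟩ := hs.exists_is_const_of_fderiv_eq_zero (𝕜 := ℝ) (f := fun z => N z - M z) hs'
    (fun z hz => (hd z hz).differentiableAt.differentiableWithinAt)
    (fun z hz => (hd z hz).fderiv)
  exact ⟨C, fun z hz => by have := hC z hz; linarith⟩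

lemma isOpen_norm_gt (R : ℝ) : IsOpen {z : ℂ | R < ‖z‖} := isOpen_lt continuous_const continuous_norm

/-- The set is the image of a half-plane under the exponential map. -/
lemma isPreconnected_norm_gt {R : ℝ} (hR : 0 < R) : IsPreconnected {z : ℂ | R < ‖z‖} := by
  have h1 : IsPreconnected {z : ℂ | Real.log R < z.re} := (convex_halfSpace_re_gt _).isPreconnected
  have h2 := h1.image Complex.exp Complex.continuous_exp.continuousOn
  convert h2 using 1
  ext z
  simp only [mem_ofPred_eq, mem_image]
  constructor
  · intro hz
    have hz0 : z ≠ 0 := norm_pos_iff.1 (hR.trans hz)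
    exact ⟨Complex.log z, by rw [Complex.log_re]; exact Real.log_lt_log hR hz, Complex.exp_log hz0⟩
  · rintro ⟨w, hw, rfl⟩
    rw [Complex.norm_exp]
    exact (Real.log_lt_iff_lt_exp hR).1 hw

/-- An unbounded connected open set with bounded frontier contains a neighbourhood of infinity. -/
lemma exists_norm_gt_subset {Ω : Set ℂ} (hΩ : IsOpen Ω)
    (hub : ¬ Bornology.IsBounded Ω) (hfr : Bornology.IsBounded (frontier Ω)) :
    ∃ R : ℝ, 0 < R ∧ ∀ z : ℂ, R < ‖z‖ → z ∈ Ω := by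
  obtain ⟨M, hM⟩ := hfr.subset_closedBall (0 : ℂ)
  set R := |M| + 1 with hR
  have hR0 : 0 < R := by positivity
  refine ⟨R, hR0, ?_⟩
  have hsub : {z : ℂ | R < ‖z‖} ⊆ Ω ∪ (closure Ω)ᶜ := by
    intro z hz
    by_contra hcon
    simp only [mem_union, mem_compl_iff, not_or, not_not] at hcon
    have h1 : z ∈ frontier Ω := by rw [hΩ.frontier_eq]; exact ⟨hcon.2, hcon.1⟩
    have h2 := hM h1
    rw [mem_closedBall_zero_iff] at h2
    have h3 : R < ‖z‖ := hz
    linarith [le_abs_self M]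
  refine fun z hz => (isPreconnected_norm_gt hR0).subset_left_of_subset_union hΩ
    isClosed_closure.isOpen_compl ?_ hsub ?_ hz
  · exact disjoint_compl_right.mono_left subset_closure
  · by_contra hne
    refine hub ((Metric.isBounded_closedBall (x := (0 : ℂ)) (r := R)).subset fun z hz => ?_)
    rw [mem_closedBall_zero_iff]
    by_contra hlt
    exact hne ⟨z, not_le.1 hlt, hz⟩

/-- The gradient of a harmonic function of logarithmic growth tends to zero at infinity. -/
lemma tendsto_gradient_cobounded {N : ℂ → ℝ} {f : ℂ → ℂ} {R : ℝ}
    (hf : ∀ z : ℂ, R < ‖z‖ → DifferentiableAt ℂ f z)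
    (hN : ∀ z : ℂ, R < ‖z‖ → HasFDerivAt N (gradForm (f z)) z)
    (hlim : Tendsto (fun z => N z / Real.log ‖z‖) (Bornology.cobounded ℂ) (𝓝 (-1))) :
    Tendsto f (Bornology.cobounded ℂ) (𝓝 0) := by
  have h1 : ∀ᶠ z : ℂ in Bornology.cobounded ℂ, N z / Real.log ‖z‖ ∈ Ioo (-2 : ℝ) 2 :=
    hlim (Ioo_mem_nhds (by norm_num) (by norm_num))
  obtain ⟨R₁, -, hR₁⟩ := hasBasis_cobounded_norm.eventually_iff.1 h1
  set R₂ := max (max R R₁) 2 with hR₂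
  have hR₂a : R ≤ R₂ := (le_max_left _ _).trans (le_max_left _ _)
  have hR₂b : R₁ ≤ R₂ := (le_max_right _ _).trans (le_max_left _ _)
  have hR₂c : 2 ≤ R₂ := le_max_right _ _
  have hNb : ∀ z : ℂ, R₂ < ‖z‖ → |N z| ≤ 2 * Real.log ‖z‖ := by
    intro z hz
    have h2 := hR₁ (show R₁ ≤ ‖z‖ by linarith)
    have hl : 0 < Real.log ‖z‖ := Real.log_pos (by linarith)
    rw [mem_Ioo, lt_div_iff₀ hl, div_lt_iff₀ hl] at h2
    rw [abs_le]
    constructor <;> linarith [h2.1, h2.2]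
  have hbound : ∀ z : ℂ, 2 * R₂ < ‖z‖ → ‖f z‖ ≤ 32 * (Real.log (2 * ‖z‖) / ‖z‖) := by
    intro z hz
    -- On the disc of radius `|z|/2` about `z`, `N` is the real part of a primitive of `f` up to a
    -- constant, and the growth bound limits that real part. Borel–Carathéodory on the half-radius
    -- circle and Cauchy's estimate then give `f z = O(log |z| / |z|)`; the numerical value is `2M /
    -- (r/2)` with `M = 4 log (2|z|)`.
    set r := ‖z‖ / 2 with hr
    have hr0 : 0 < r := by rw [hr]; linarith
    have hball : ∀ w ∈ Metric.ball z r, R₂ < ‖w‖ ∧ ‖w‖ ≤ 2 * ‖z‖ := by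
      intro w hw
      rw [Metric.mem_ball, dist_eq_norm] at hw
      have e1 := norm_sub_norm_le z w
      have e2 := norm_sub_norm_le w z
      rw [norm_sub_rev] at e1
      constructor <;> linarith
    have hfb : DifferentiableOn ℂ f (Metric.ball z r) := fun w hw =>
      (hf w (by linarith [(hball w hw).1])).differentiableWithinAt
    obtain ⟨H, hH⟩ := hfb.isExactOn_ball
    obtain ⟨C, hC⟩ := exists_eq_add_const_of_gradForm Metric.isOpen_ball
      (convex_ball z r).isPreconnected (fun w hw => hN w (by linarith [(hball w hw).1]))
      (fun w hw => hasFDerivAt_re (hH w hw))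
    have hmem : ∀ w ∈ Metric.ball (0 : ℂ) r, z + w ∈ Metric.ball z r := by
      intro w hw
      rw [Metric.mem_ball, dist_eq_norm] at *
      simpa using hw
    set g : ℂ → ℂ := fun w => H (z + w) - H z with hg
    have hgd : ∀ w ∈ Metric.ball (0 : ℂ) r, HasDerivAt g (f (z + w)) w := by
      intro w hw
      exact (HasDerivAt.comp_const_add z w (hH _ (hmem w hw))).sub_const _
    have hz0 : (0 : ℂ) ∈ Metric.ball (0 : ℂ) r := Metric.mem_ball_self hr0
    set M := 4 * Real.log (2 * ‖z‖) with hM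
    have hM0 : 0 < M := by
      have : 0 < Real.log (2 * ‖z‖) := Real.log_pos (by linarith)
      positivity
    have hlogb : ∀ w ∈ Metric.ball z r, |N w| ≤ 2 * Real.log (2 * ‖z‖) := by
      intro w hw
      have e1 := hball w hw
      refine (hNb w e1.1).trans ?_
      have := Real.log_le_log (by linarith) e1.2
      linarith
    have hgM : MapsTo g (Metric.ball 0 r) {z | z.re ≤ M} := by
      intro w hw
      have e1 := hlogb _ (hmem w hw)
      have e2 := hlogb z (Metric.mem_ball_self hr0)
      have e3 := hC _ (hmem w hw)
      have e4 := hC z (Metric.mem_ball_self hr0)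
      rw [abs_le] at e1 e2
      simp only [mem_ofPred_eq, hg, Complex.sub_re]
      linarith [e1.2, e2.1]
    have hgdiff : DifferentiableOn ℂ g (Metric.ball 0 r) := fun w hw =>
      (hgd w hw).differentiableAt.differentiableWithinAt
    have hder : ‖deriv g 0‖ ≤ 2 * M / (r / 2) := by
      refine Complex.norm_deriv_le_of_forall_mem_sphere_norm_le (by positivity) ?_ ?_
      · refine DifferentiableOn.diffContOnCl (hgdiff.mono ?_)
        rw [closure_ball _ (by positivity : r / 2 ≠ 0)]
        exact Metric.closedBall_subset_ball (by linarith)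
      · intro w hw
        rw [mem_sphere_zero_iff_norm] at hw
        have := Complex.borelCaratheodory_zero hM0 hgdiff hgM hr0
          (z := w) (by rw [mem_ball_zero_iff]; linarith) (by simp [hg])
        rw [hw] at this
        refine this.trans_eq ?_
        field_simp
        ring
    rw [(hgd 0 hz0).deriv, add_zero] at hder
    refine hder.trans_eq ?_
    rw [hM, hr]
    have : ‖z‖ ≠ 0 := by linarith
    field_simp
    ring
  have hlog : Tendsto (fun x : ℝ => 32 * (Real.log (2 * x) / x)) atTop (𝓝 0) := by
    have h2 : Tendsto (fun x : ℝ => Real.log x / x) atTop (𝓝 0) := by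
      simpa using Real.tendsto_pow_log_div_mul_add_atTop 1 0 1 one_ne_zero
    have h3 : Tendsto (fun x : ℝ => 2 * x) atTop atTop :=
      tendsto_id.const_mul_atTop (by norm_num)
    have h4 := (h2.comp h3).const_mul 64
    rw [mul_zero] at h4
    refine h4.congr fun x => ?_
    simp only [Function.comp]
    rcases eq_or_ne x 0 with rfl | hx
    · simp
    · field_simp; ring
  refine squeeze_zero_norm' ?_ (hlog.comp tendsto_norm_cobounded_atTop)
  refine hasBasis_cobounded_norm.eventually_iff.2 ⟨2 * R₂ + 1, trivial, fun {z} hz => ?_⟩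
  have hz' : 2 * R₂ + 1 ≤ ‖z‖ := hz
  exact hbound z (by linarith)

end Infinity

/-! ### Laurent expansion of the gradient at infinity. -/

section Infinity

/-- The expansion at infinity of the gradient of a harmonic function asymptotic to `-log |z|`. -/
theorem exists_expansion_at_infinity {N : ℂ → ℝ} {f : ℂ → ℂ} {R : ℝ} (hR : 0 < R)
    (hf : ∀ z : ℂ, R < ‖z‖ → DifferentiableAt ℂ f z)
    (hN : ∀ z : ℂ, R < ‖z‖ → HasFDerivAt N (gradForm (f z)) z)
    (hlim : Tendsto (fun z => N z / Real.log ‖z‖) (Bornology.cobounded ℂ) (𝓝 (-1))) :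
    ∃ S S' : ℂ → ℂ, (∀ ξ : ℂ, ‖ξ‖ < R⁻¹ → HasDerivAt S (S' ξ) ξ) ∧
      ∀ z : ℂ, R < ‖z‖ → f z = -1 / z + S' z⁻¹ / z ^ 2 := by
  have h0 := tendsto_gradient_cobounded hf hN hlim
  have hRi : 0 < R⁻¹ := inv_pos.2 hR
  have hB : Metric.ball (0 : ℂ) R⁻¹ ∈ 𝓝 (0 : ℂ) := Metric.ball_mem_nhds _ hRi
  -- The decay of `f` makes the singularity of `f (1/ξ)` at `0` removable with value `0`. Dividing
  -- twice by `ξ` separates the residue coefficient `c` from a remainder `S'` holomorphic near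
  -- infinity.
  set q : ℂ → ℂ := Function.update (fun ξ => f ξ⁻¹) 0 0 with hq
  have hq0 : q 0 = 0 := by simp [hq]
  have hqne : ∀ ξ, ξ ≠ 0 → q ξ = f ξ⁻¹ := fun ξ hξ => by simp [hq, hξ]
  have hinv : ∀ ξ : ℂ, ξ ≠ 0 → ‖ξ‖ < R⁻¹ → R < ‖ξ⁻¹‖ := by
    intro ξ hξ h
    rw [norm_inv]
    exact (lt_inv_comm₀ (norm_pos_iff.2 hξ) hR).1 h
  have hqd : DifferentiableOn ℂ q (Metric.ball 0 R⁻¹) := by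
    rw [← Complex.differentiableOn_compl_singleton_and_continuousAt_iff hB]
    constructor
    · rintro ξ ⟨hξ, hξ0⟩
      rw [mem_ball_zero_iff] at hξ
      have h1 : DifferentiableAt ℂ (fun ξ => f ξ⁻¹) ξ :=
        (hf _ (hinv ξ hξ0 hξ)).comp ξ (differentiableAt_inv hξ0)
      refine (h1.congr_of_eventuallyEq ?_).differentiableWithinAt
      filter_upwards [isOpen_ne.mem_nhds (show ξ ≠ 0 from hξ0)] with w hw using hqne w hw
    · rw [continuousAt_iff_punctured_nhds, hq0]
      have h2 : Tendsto (fun ξ : ℂ => f ξ⁻¹) (𝓝[≠] 0) (𝓝 0) := h0.comp tendsto_inv₀_nhdsNE_zero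
      refine h2.congr' ?_
      filter_upwards [self_mem_nhdsWithin] with ξ hξ using (hqne ξ hξ).symm
  set q₁ := dslope q 0 with hq₁
  have hq₁d : DifferentiableOn ℂ q₁ (Metric.ball 0 R⁻¹) := (Complex.differentiableOn_dslope hB).2 hqd
  set S' := dslope q₁ 0 with hS'
  have hS'd : DifferentiableOn ℂ S' (Metric.ball 0 R⁻¹) := (Complex.differentiableOn_dslope hB).2 hq₁d
  set c := q₁ 0 with hc
  have hqexp : ∀ ξ, q ξ = ξ * (c + ξ * S' ξ) := by
    intro ξ
    have e1 := sub_smul_dslope q 0 ξ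
    have e2 := sub_smul_dslope q₁ 0 ξ
    simp only [sub_zero, smul_eq_mul, hq0] at e1 e2
    rw [← e1, ← hq₁, hS', e2]
    ring
  obtain ⟨S, hS⟩ := hS'd.isExactOn_ball
  have hS2 : ∀ ξ : ℂ, ‖ξ‖ < R⁻¹ → HasDerivAt S (S' ξ) ξ := fun ξ hξ =>
    hS ξ (mem_ball_zero_iff.2 hξ)
  have hfexp : ∀ z : ℂ, R < ‖z‖ → f z = c / z + S' z⁻¹ / z ^ 2 := by
    intro z hz
    have hz0 : z ≠ 0 := norm_pos_iff.1 (hR.trans hz)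
    have e1 := hqne z⁻¹ (inv_ne_zero hz0)
    rw [inv_inv, hqexp] at e1
    rw [← e1]
    field_simp
  suffices hc1 : c = -1 by
    refine ⟨S, S', hS2, fun z hz => ?_⟩
    rw [hfexp z hz, hc1]
  -- In the coordinate `ζ = log z`, `N` becomes `Re (c ζ - S (exp (-ζ)))` plus a constant. Its
  -- `2πi`-periodicity forces `Im c = 0`; its growth along the real axis forces `Re c = -1`.
  set W : Set ℂ := {ζ : ℂ | Real.log R < ζ.re} with hW
  have hWo : IsOpen W := isOpen_lt continuous_const Complex.continuous_re
  have hWc : Convex ℝ W := convex_halfSpace_re_gt _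
  have hWe : ∀ ζ ∈ W, R < ‖Complex.exp ζ‖ := by
    intro ζ hζ
    rw [Complex.norm_exp]
    exact (Real.log_lt_iff_lt_exp hR).1 hζ
  have hWi : ∀ ζ ∈ W, ‖Complex.exp (-ζ)‖ < R⁻¹ := by
    intro ζ hζ
    rw [Complex.exp_neg, norm_inv]
    exact inv_strictAnti₀ hR (hWe ζ hζ)
  obtain ⟨K, hK⟩ := exists_eq_add_const_of_gradForm (N := fun ζ => N (Complex.exp ζ))
    (M := fun ζ => (c * ζ - S (Complex.exp (-ζ))).re) (f := fun ζ => f (Complex.exp ζ) * Complex.exp ζ)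
    hWo hWc.isPreconnected
    (fun ζ hζ => (hN _ (hWe ζ hζ)).gradForm_comp (Complex.hasDerivAt_exp ζ)) (by
      intro ζ hζ
      have e1 : HasDerivAt (fun ζ => Complex.exp (-ζ)) (Complex.exp (-ζ) * -1) ζ :=
        (hasDerivAt_neg ζ).cexp
      have e2 := (hS2 _ (hWi ζ hζ)).comp ζ e1
      have e3 := hasFDerivAt_re (((hasDerivAt_id ζ).const_mul c).sub e2)
      refine e3.congr_fderiv ?_
      congr 1
      rw [hfexp _ (hWe ζ hζ), Complex.exp_neg]
      have := Complex.exp_ne_zero ζ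
      field_simp
      ring)
  set x₀ : ℝ := Real.log R + 1 with hx₀
  have him : c.im = 0 := by
    have m1 : (x₀ : ℂ) ∈ W := by simp [hW, hx₀]
    have m2 : (x₀ : ℂ) + 2 * Real.pi * Complex.I ∈ W := by simp [hW, hx₀]
    have e1 := hK _ m1
    have e2 := hK _ m2
    have e3 : Complex.exp ((x₀ : ℂ) + 2 * Real.pi * Complex.I) = Complex.exp x₀ :=
      Complex.exp_periodic _
    have e4 : Complex.exp (-((x₀ : ℂ) + 2 * Real.pi * Complex.I)) = Complex.exp (-(x₀ : ℂ)) := by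
      rw [Complex.exp_neg, Complex.exp_neg, e3]
    simp only [e3, e4] at e2
    rw [e1] at e2
    simp [Complex.sub_re, Complex.mul_re] at e2
    have e5 : c.im * Real.pi = 0 := by linarith
    exact (mul_eq_zero.1 e5).resolve_right Real.pi_ne_zero
  have hre : c.re = -1 := by
    have t1 : Tendsto (fun x : ℝ => Complex.exp (-(x : ℂ))) atTop (𝓝 0) := by
      rw [tendsto_zero_iff_norm_tendsto_zero]
      simp only [Complex.norm_exp, Complex.neg_re, Complex.ofReal_re]
      exact Real.tendsto_exp_neg_atTop_nhds_zero
    have t2 : Tendsto (fun x : ℝ => (S (Complex.exp (-(x : ℂ)))).re) atTop (𝓝 (S 0).re) :=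
      (Complex.continuous_re.tendsto _).comp
        (((hS2 0 (by simpa using hR)).continuousAt.tendsto).comp t1)
    have t3 : Tendsto (fun x : ℝ => Complex.exp (x : ℂ)) atTop (Bornology.cobounded ℂ) := by
      rw [← tendsto_norm_atTop_iff_cobounded]
      simp only [Complex.norm_exp, Complex.ofReal_re]
      exact Real.tendsto_exp_atTop
    have t4 : Tendsto (fun x : ℝ => N (Complex.exp (x : ℂ)) / x) atTop (𝓝 (-1)) := by
      refine (hlim.comp t3).congr fun x => ?_
      simp [Complex.norm_exp]
    have t5 : Tendsto (fun x : ℝ => c.re + (K - (S (Complex.exp (-(x : ℂ)))).re) / x) atTop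
        (𝓝 (c.re + 0)) :=
      tendsto_const_nhds.add ((tendsto_const_nhds.sub t2).div_atTop tendsto_id)
    rw [add_zero] at t5
    refine tendsto_nhds_unique t5 (t4.congr' ?_)
    filter_upwards [eventually_gt_atTop (max x₀ 0)] with x hx
    have hx1 : x₀ < x := (le_max_left _ _).trans_lt hx
    have hx2 : 0 < x := (le_max_right _ _).trans_lt hx
    have m1 : (x : ℂ) ∈ W := by
      simp only [hW, mem_ofPred_eq, Complex.ofReal_re]
      linarith
    rw [hK _ m1]
    simp only [Complex.sub_re, Complex.mul_re, Complex.ofReal_re, Complex.ofReal_im, mul_zero, sub_zero]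
    field_simp
    ring
  exact Complex.ext (by simpa using hre) (by simpa using him)

end Infinity

/-! ### The single-valued holomorphic function with modulus `exp N`. -/

section Infinity

/-- The holomorphic function with modulus `exp N`. -/
theorem exists_holomorphic_of_potential {Ω : Set ℂ} (hΩ : IsOpen Ω) (hconn : IsConnected Ω)
    {γ : ℝ → ℂ} (hγ : ContDiff ℝ 1 γ) (hfr : frontier Ω = γ '' Icc 0 1) {R : ℝ} (hR : 0 < R)
    (hout : ∀ z : ℂ, R < ‖z‖ → z ∈ Ω) {N : ℂ → ℝ} {f : ℂ → ℂ} (hf : DifferentiableOn ℂ f Ω)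
    (hN : ∀ z ∈ Ω, HasFDerivAt N (gradForm (f z)) z)
    (hlim : Tendsto (fun z => N z / Real.log ‖z‖) (Bornology.cobounded ℂ) (𝓝 (-1))) :
    ∃ (h : ℂ → ℂ) (a : ℂ), a ≠ 0 ∧ (∀ z ∈ Ω, HasDerivAt h (f z * h z) z) ∧
      (∀ z ∈ Ω, ‖h z‖ = Real.exp (N z)) ∧
      Tendsto (fun z => z * h z) (Bornology.cobounded ℂ) (𝓝 a) := by
  obtain ⟨S, S', hS, hfS⟩ := exists_expansion_at_infinity hR
    (fun z hz => hf.differentiableAt (hΩ.mem_nhds (hout z hz))) (fun z hz => hN z (hout z hz)) hlim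
  set p := γ 0 with hp
  have hpΩ : p ∉ Ω := by
    have : p ∈ frontier Ω := by rw [hfr]; exact ⟨0, by simp, rfl⟩
    rw [hΩ.frontier_eq] at this
    exact this.2
  have hpne : ∀ z ∈ Ω, z - p ≠ 0 := fun z hz h0 => hpΩ (by rw [← sub_eq_zero.1 h0]; exact hz)
  have hpR : ‖p‖ ≤ R := by
    by_contra h
    exact hpΩ (hout p (not_le.1 h))
  -- Adding `1 / (z - p)`, with `p` on the boundary, cancels the residue `-1` at infinity. The sum
  -- has the primitive `P₀` near infinity, hence a primitive in all of `Ω`; dividing its exponential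
  -- by `z - p` restores the logarithmic derivative `f`.
  have hF : DifferentiableOn ℂ (fun z => f z + (z - p)⁻¹) Ω := fun z hz =>
    (hf z hz).add (((differentiableAt_id.sub_const p).inv (hpne z hz)).differentiableWithinAt)
  set P₀ : ℂ → ℂ := fun z => Complex.log (1 - p / z) - S z⁻¹ with hP₀
  have hP₀d : ∀ z : ℂ, R < ‖z‖ → HasDerivAt P₀ (f z + (z - p)⁻¹) z := by
    intro z hz
    have hz0 : z ≠ 0 := norm_pos_iff.1 (hR.trans hz)
    have hzp := hpne z (hout z hz)
    have hslit : 1 - p / z ∈ Complex.slitPlane := by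
      rw [sub_eq_add_neg]
      refine Complex.mem_slitPlane_of_norm_lt_one ?_
      rw [norm_neg, norm_div, div_lt_one (hR.trans hz)]
      exact hpR.trans_lt hz
    have e1 := (((hasDerivAt_const z (1 : ℂ)).sub
      ((hasDerivAt_inv hz0).const_mul p))).clog (f := fun z => 1 - p * z⁻¹) (by
        rw [← div_eq_mul_inv]; exact hslit)
    have e2 := (hS z⁻¹ (by rw [norm_inv]; exact inv_strictAnti₀ hR hz)).comp z (hasDerivAt_inv hz0)
    have e3 := e1.sub e2
    have e4 : P₀ = (fun z => Complex.log (1 - p * z⁻¹)) - S ∘ Inv.inv := by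
      funext w; simp [hP₀, div_eq_mul_inv]
    rw [e4]
    refine e3.congr_deriv ?_
    rw [hfS z hz]
    have e5 : 1 - p * z⁻¹ = (z - p) / z := by field_simp
    rw [e5]
    field_simp
    ring
  obtain ⟨P, hP⟩ := exists_primitive_exterior hΩ hconn hγ hfr hF hR hout hP₀d
  set Q : ℂ → ℂ := fun z => Complex.exp (P z) * (z - p)⁻¹ with hQ
  have hQd : ∀ z ∈ Ω, HasDerivAt Q (f z * Q z) z := by
    intro z hz
    have e1 := (hP z hz).cexp.mul (((hasDerivAt_id z).sub_const p).fun_inv (hpne z hz))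
    refine e1.congr_deriv ?_
    have := hpne z hz
    simp only [hQ, id]
    field_simp
    ring
  have hQ0 : ∀ z ∈ Ω, Q z ≠ 0 := fun z hz =>
    mul_ne_zero (Complex.exp_ne_zero _) (inv_ne_zero (hpne z hz))
  -- `Q` has logarithmic derivative `f`, so `log |Q|` and `N` have the same gradient; their
  -- difference is a constant to be normalized away.
  have hd : ∀ z ∈ Ω, HasFDerivAt (fun z => ‖Q z‖ ^ 2 * Real.exp (-(2 * N z))) (0 : ℂ →L[ℝ] ℝ) z := by
    intro z hz
    have e1 := ((hQd z hz).hasFDerivAt.restrictScalars ℝ).norm_sq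
    have e2 := (((hN z hz).const_mul 2).fun_neg).exp
    refine (e1.mul e2).congr_fderiv ?_
    ext v
    simp only [add_apply, smul_apply,
      ContinuousLinearMap.comp_apply, ContinuousLinearMap.coe_restrictScalars',
      zero_apply, neg_apply, gradForm_apply, smul_eq_mul,
      innerSL_apply_apply, ContinuousLinearMap.toSpanSingleton_apply, Complex.inner, nsmul_eq_mul]
    rw [← Complex.normSq_eq_norm_sq, Complex.normSq_apply]
    simp only [Complex.mul_re, Complex.mul_im, Complex.conj_re, Complex.conj_im]
    push_cast
    ring
  obtain ⟨C, hC⟩ := hΩ.exists_is_const_of_fderiv_eq_zero (𝕜 := ℝ) hconn.isPreconnected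
    (fun z hz => (hd z hz).differentiableAt.differentiableWithinAt) (fun z hz => (hd z hz).fderiv)
  have hCpos : 0 < C := by
    obtain ⟨z, hz⟩ := hconn.nonempty
    rw [← hC z hz]
    have := norm_pos_iff.2 (hQ0 z hz)
    positivity
  have hnormQ : ∀ z ∈ Ω, ‖Q z‖ = Real.sqrt C * Real.exp (N z) := by
    intro z hz
    have e1 := hC z hz
    rw [← Real.sqrt_sq (norm_nonneg (Q z)), ← Real.sqrt_sq (Real.exp_pos (N z)).le, ← Real.sqrt_mul hCpos.le,
      ← e1, mul_assoc, ← Real.exp_nat_mul, ← Real.exp_add]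
    simp
  have hsC : (Real.sqrt C : ℂ) ≠ 0 := by
    simpa using (Real.sqrt_pos.2 hCpos).ne'
  obtain ⟨K, hK⟩ := (isOpen_norm_gt R).exists_is_const_of_fderiv_eq_zero (𝕜 := ℂ)
    (f := fun z => P z - P₀ z) (isPreconnected_norm_gt hR)
    (fun z hz => ((hP z (hout z hz)).sub (hP₀d z hz)).differentiableAt.differentiableWithinAt)
    (fun z hz => by
      have e1 := ((hP z (hout z hz)).sub (hP₀d z hz)).hasFDerivAt.fderiv
      rw [sub_self] at e1
      refine Eq.trans e1 ?_
      ext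
      simp)
  refine ⟨fun z => (Real.sqrt C : ℂ)⁻¹ * Q z, (Real.sqrt C : ℂ)⁻¹ * Complex.exp (K - S 0), ?_, ?_, ?_, ?_⟩
  · exact mul_ne_zero (inv_ne_zero hsC) (Complex.exp_ne_zero _)
  · intro z hz
    refine ((hQd z hz).const_mul _).congr_deriv ?_
    ring
  · intro z hz
    rw [norm_mul, norm_inv, Complex.norm_real, Real.norm_of_nonneg (Real.sqrt_nonneg C), hnormQ z hz,
      ← mul_assoc, inv_mul_cancel₀ (Real.sqrt_pos.2 hCpos).ne', one_mul]
  · have t1 : Tendsto (fun z : ℂ => z⁻¹) (Bornology.cobounded ℂ) (𝓝 0) := tendsto_inv₀_cobounded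
    have t2 : Tendsto (fun z : ℂ => S z⁻¹) (Bornology.cobounded ℂ) (𝓝 (S 0)) :=
      ((hS 0 (by simpa using hR)).continuousAt.tendsto).comp t1
    have t3 : Tendsto (fun z : ℂ => Complex.exp (K - S z⁻¹)) (Bornology.cobounded ℂ)
        (𝓝 (Complex.exp (K - S 0))) :=
      (Complex.continuous_exp.tendsto _).comp (tendsto_const_nhds.sub t2)
    refine (t3.const_mul ((Real.sqrt C : ℂ)⁻¹)).congr' ?_
    refine hasBasis_cobounded_norm.eventually_iff.2 ⟨R + 1, trivial, fun {z} hz => ?_⟩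
    have hz' : R < ‖z‖ := by
      have : R + 1 ≤ ‖z‖ := hz
      linarith
    have hz0 : z ≠ 0 := norm_pos_iff.1 (hR.trans hz')
    have hzp := hpne z (hout z hz')
    have e1 : P z = K + P₀ z := by rw [← hK z hz']; ring
    have e2 : 1 - p / z = (z - p) / z := by field_simp
    simp only [hQ, e1, hP₀]
    rw [show K + (Complex.log (1 - p / z) - S z⁻¹) = (K - S z⁻¹) + Complex.log (1 - p / z) by ring,
      Complex.exp_add (K - S z⁻¹), Complex.exp_log (by rw [e2]; exact div_ne_zero hzp hz0), e2]
    field_simp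

end Infinity

/-! ### The exterior map is a conformal bijection onto the punctured disc. -/

section Bijectivity

/-- Near a critical point a nonconstant holomorphic function takes every nearby value twice. -/
lemma eventually_two_preimages {h : ℂ → ℂ} {z : ℂ} (hh : AnalyticAt ℂ h z)
    (hnc : ¬ ∀ᶠ x in 𝓝 z, h x = h z) (hd : deriv h z = 0) {U : Set ℂ} (hU : U ∈ 𝓝 z) :
    ∀ᶠ w in 𝓝 (h z), w ≠ h z → ∃ x₁ ∈ U, ∃ x₂ ∈ U, x₁ ≠ x₂ ∧ h x₁ = w ∧ h x₂ = w := by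
  have hs : AnalyticAt ℂ (fun x => h x - h z) z := hh.sub analyticAt_const
  obtain ⟨k, g, hg, hgz, hk⟩ := hs.exists_eventuallyEq_pow_smul_nonzero_iff.2
    (by simpa [sub_eq_zero] using hnc)
  have hk0 : k ≠ 0 := by
    rintro rfl
    have := hk.self_of_nhds
    simp at this
    exact hgz this.symm
  have hk1 : k ≠ 1 := by
    rintro rfl
    have e1 : HasDerivAt (fun x => (x - z) ^ 1 • g x) (g z) z := by
      have := ((hasDerivAt_id z).sub_const z).mul hg.differentiableAt.hasDerivAt
      simpa using! this
    have e2 : HasDerivAt (fun x => h x - h z) (g z) z := e1.congr_of_eventuallyEq hk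
    have e3 : HasDerivAt (fun x => h x - h z) 0 z := by
      have := hh.differentiableAt.hasDerivAt.sub_const (h z)
      rwa [hd] at this
    exact hgz (e2.unique e3)
  have hk2 : 1 < k := by omega
  obtain ⟨β, hβ⟩ := IsAlgClosed.exists_pow_nat_eq (g z) (Nat.pos_of_ne_zero hk0)
  have hβ0 : β ≠ 0 := by
    rintro rfl
    rw [zero_pow hk0] at hβ
    exact hgz hβ.symm
  -- Since `g z ≠ 0`, `g` has a holomorphic `k`-th root near `z`, with value `β` at `z`. Hence `h -
  -- h z = ψ ^ k` with `ψ` locally open and `k ≥ 2`; a value near `h z` is reached through the two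
  -- distinct roots `ρ` and `η ρ`.
  set G : ℂ → ℂ := fun x => β * Complex.exp (Complex.log (g x / g z) / k) with hG
  have hGa : AnalyticAt ℂ G z := by
    have e1 : AnalyticAt ℂ (fun x => g x / g z) z := hg.div analyticAt_const hgz
    have e2 : AnalyticAt ℂ (fun x => Complex.log (g x / g z)) z :=
      e1.clog (by rw [div_self hgz]; exact Complex.one_mem_slitPlane)
    exact analyticAt_const.mul ((e2.div analyticAt_const (by exact_mod_cast hk0)).cexp)
  have hGz : G z = β := by simp [hG, div_self hgz]
  set ψ : ℂ → ℂ := fun x => (x - z) * G x with hψ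
  have hψd : HasStrictDerivAt ψ β z := by
    have e0 : HasStrictDerivAt (fun x => x - z) 1 z := (hasStrictDerivAt_id z).sub_const z
    have e1 := e0.fun_mul hGa.hasStrictDerivAt
    refine e1.congr_deriv ?_
    simp [hGz]
  have hψz : ψ z = 0 := by simp [hψ]
  have hgne : ∀ᶠ x in 𝓝 z, g x ≠ 0 := hg.continuousAt.eventually_ne hgz
  have hpow : ∀ᶠ x in 𝓝 z, h x = h z + ψ x ^ k := by
    filter_upwards [hk, hgne] with x hx hgx
    rw [← sub_eq_iff_eq_add', hx, hψ]
    simp only [smul_eq_mul, hG, mul_pow, hβ]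
    rw [← Complex.exp_nat_mul, mul_div_cancel₀ _ (by exact_mod_cast hk0),
      Complex.exp_log (div_ne_zero hgx hgz), mul_div_cancel₀ _ hgz]
  have hW : ψ '' (U ∩ {x | h x = h z + ψ x ^ k}) ∈ 𝓝 (0 : ℂ) := by
    rw [← hψz, ← hψd.map_nhds_eq hβ0]
    exact image_mem_map (inter_mem hU hpow)
  obtain ⟨r, hr, hball⟩ := Metric.mem_nhds_iff.1 hW
  filter_upwards [Metric.ball_mem_nhds (h z) (pow_pos hr k)] with w hw hwne
  obtain ⟨ρ, hρ⟩ := IsAlgClosed.exists_pow_nat_eq (w - h z) (Nat.pos_of_ne_zero hk0)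
  have hρ0 : ρ ≠ 0 := by
    rintro rfl
    rw [zero_pow hk0] at hρ
    exact hwne (sub_eq_zero.1 hρ.symm)
  have hρr : ‖ρ‖ < r := by
    rw [Metric.mem_ball, dist_eq_norm, ← hρ, norm_pow] at hw
    exact lt_of_pow_lt_pow_left₀ k hr.le hw
  have hζ := Complex.isPrimitiveRoot_exp k hk0
  set η := Complex.exp (2 * Real.pi * Complex.I / k)
  have hη1 : η ≠ 1 := hζ.ne_one hk2
  have hηk : η ^ k = 1 := hζ.pow_eq_one
  have hηn : ‖η‖ = 1 := hζ.norm'_eq_one hk0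
  obtain ⟨x₁, ⟨hx₁U, hx₁⟩, hx₁ρ⟩ := hball (mem_ball_zero_iff.2 hρr)
  obtain ⟨x₂, ⟨hx₂U, hx₂⟩, hx₂ρ⟩ := hball (mem_ball_zero_iff.2
    (by rw [norm_mul, hηn, one_mul]; exact hρr) : η * ρ ∈ Metric.ball 0 r)
  refine ⟨x₁, hx₁U, x₂, hx₂U, ?_, ?_, ?_⟩
  · rintro rfl
    rw [hx₁ρ] at hx₂ρ
    exact hη1 (mul_right_cancel₀ hρ0 (by rw [one_mul]; exact hx₂ρ.symm))
  · rw [show h x₁ = h z + ψ x₁ ^ k from hx₁, hx₁ρ, hρ]; ring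
  · rw [show h x₂ = h z + ψ x₂ ^ k from hx₂, hx₂ρ, mul_pow, hηk, one_mul, hρ]; ring

/-- The left inverse supplied by the inverse function theorem makes the map injective near the
point. -/
lemma HasStrictDerivAt.exists_injOn {h : ℂ → ℂ} {d z : ℂ} (hh : HasStrictDerivAt h d z)
    (hd : d ≠ 0) : ∃ U ∈ 𝓝 z, InjOn h U := by
  refine ⟨_, hh.eventually_left_inverse hd, fun x hx y hy hxy => ?_⟩
  have h1 : hh.localInverse h d z hd (h x) = x := hx
  have h2 : hh.localInverse h d z hd (h y) = y := hy
  rw [← h1, ← h2, hxy]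

/-- The unit disc without its centre. -/
def puncturedDisc : Set ℂ := {w | w ≠ 0 ∧ ‖w‖ < 1}

lemma isOpen_puncturedDisc : IsOpen puncturedDisc :=
  isOpen_ne.inter (isOpen_lt continuous_norm continuous_const)

lemma isPreconnected_puncturedDisc : IsPreconnected puncturedDisc := by
  have h1 : IsPreconnected {z : ℂ | z.re < 0} := (convex_halfSpace_re_lt _).isPreconnected
  convert h1.image Complex.exp Complex.continuous_exp.continuousOn using 1
  ext z
  simp only [puncturedDisc, mem_ofPred_eq, mem_image]
  constructor
  · rintro ⟨hz0, hz⟩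
    exact ⟨Complex.log z, by rw [Complex.log_re]; exact Real.log_neg (norm_pos_iff.2 hz0) hz,
      Complex.exp_log hz0⟩
  · rintro ⟨w, hw, rfl⟩
    refine ⟨Complex.exp_ne_zero _, ?_⟩
    rw [Complex.norm_exp]
    exact Real.exp_lt_one_iff.2 hw

/-- The hypotheses on a holomorphic function `h` on an exterior domain with modulus `exp N`, where
`N` vanishes on the boundary and `h ~ a / z` at infinity; `f` is its logarithmic derivative. -/
structure IsExteriorMap (Ω : Set ℂ) (N : ℂ → ℝ) (f h : ℂ → ℂ) (a : ℂ) : Prop where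
  isOpen : IsOpen Ω
  isConnected : IsConnected Ω
  outside : ∃ R : ℝ, 0 < R ∧ ∀ z : ℂ, R < ‖z‖ → z ∈ Ω
  continuousOn : ContinuousOn N (closure Ω)
  boundary : ∀ z ∈ frontier Ω, N z = 0
  deriv : ∀ z ∈ Ω, HasDerivAt h (f z * h z) z
  norm : ∀ z ∈ Ω, ‖h z‖ = Real.exp (N z)
  ne_zero : a ≠ 0
  infinity : Tendsto (fun z => z * h z) (Bornology.cobounded ℂ) (𝓝 a)

namespace IsExteriorMap

variable {Ω : Set ℂ} {N : ℂ → ℝ} {f h : ℂ → ℂ} {a : ℂ}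

lemma tendsto_zero (H : IsExteriorMap Ω N f h a) : Tendsto h (Bornology.cobounded ℂ) (𝓝 0) := by
  have h1 := (tendsto_inv₀_cobounded (α := ℂ)).mul H.infinity
  rw [zero_mul] at h1
  refine h1.congr' ?_
  refine hasBasis_cobounded_norm.eventually_iff.2 ⟨1, trivial, fun {z} hz => ?_⟩
  have hz0 : z ≠ 0 := norm_pos_iff.1 (lt_of_lt_of_le one_pos hz)
  change z⁻¹ * (z * h z) = h z
  rw [← mul_assoc, inv_mul_cancel₀ hz0, one_mul]

lemma map_ne_zero (H : IsExteriorMap Ω N f h a) {z : ℂ} (hz : z ∈ Ω) : h z ≠ 0 := by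
  rw [← norm_pos_iff, H.norm z hz]
  exact Real.exp_pos _

lemma differentiableOn (H : IsExteriorMap Ω N f h a) : DifferentiableOn ℂ h Ω := fun z hz =>
  (H.deriv z hz).differentiableAt.differentiableWithinAt

lemma analyticAt (H : IsExteriorMap Ω N f h a) {z : ℂ} (hz : z ∈ Ω) : AnalyticAt ℂ h z :=
  H.differentiableOn.analyticAt (H.isOpen.mem_nhds hz)

lemma not_const (H : IsExteriorMap Ω N f h a) (c : ℂ) : ¬ EqOn h (fun _ => c) Ω := by
  intro hc
  obtain ⟨R, hR, hout⟩ := H.outside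
  have h1 : Tendsto h (Bornology.cobounded ℂ) (𝓝 c) := by
    refine tendsto_const_nhds.congr' ?_
    refine hasBasis_cobounded_norm.eventually_iff.2 ⟨R + 1, trivial, fun {z} hz => ?_⟩
    have hz' : R + 1 ≤ ‖z‖ := hz
    exact (hc (hout z (by linarith))).symm
  have h2 := tendsto_nhds_unique h1 H.tendsto_zero
  obtain ⟨z, hz⟩ := H.isConnected.nonempty
  exact H.map_ne_zero hz (by rw [hc hz, h2])

lemma not_eventually_const (H : IsExteriorMap Ω N f h a) {z : ℂ} (hz : z ∈ Ω) (c : ℂ) :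
    ¬ ∀ᶠ x in 𝓝 z, h x = c := fun hc =>
  H.not_const c (AnalyticOnNhd.eqOn_of_preconnected_of_eventuallyEq (fun _ hx => H.analyticAt hx)
    (fun _ _ => analyticAt_const) H.isConnected.isPreconnected hz hc)

lemma nhds_le_map (H : IsExteriorMap Ω N f h a) {z : ℂ} (hz : z ∈ Ω) : 𝓝 (h z) ≤ map h (𝓝 z) :=
  (H.analyticAt hz).eventually_constant_or_nhds_le_map_nhds.resolve_left
    (H.not_eventually_const hz _)

lemma eventually_norm_lt (H : IsExteriorMap Ω N f h a) {δ : ℝ} (hδ : 0 < δ) :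
    ∃ ρ : ℝ, 0 < ρ ∧ ∀ z : ℂ, ρ ≤ ‖z‖ → z ∈ Ω ∧ ‖h z‖ < δ := by
  have h1 : ∀ᶠ z in Bornology.cobounded ℂ, ‖h z‖ < δ := by
    exact (H.tendsto_zero.eventually (Metric.ball_mem_nhds 0 hδ)).mono fun z hz => by simpa using hz
  obtain ⟨ρ, -, hρ⟩ := hasBasis_cobounded_norm.eventually_iff.1 h1
  obtain ⟨R, hR, hout⟩ := H.outside
  refine ⟨max (R + 1) ρ, by positivity, fun z hz => ⟨hout z ?_, hρ ?_⟩⟩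
  · linarith [(le_max_left _ _).trans hz]
  · exact (le_max_right _ _).trans hz

lemma isCompact_inter (Ω : Set ℂ) (ρ : ℝ) : IsCompact (closure Ω ∩ Metric.closedBall 0 ρ) :=
  (isCompact_closedBall (0 : ℂ) ρ).inter_left isClosed_closure

lemma mem_of_neg (H : IsExteriorMap Ω N f h a) {z : ℂ} (hz : z ∈ closure Ω) (hN : N z ≠ 0) :
    z ∈ Ω := by
  by_contra hn
  exact hN (H.boundary z (by rw [H.isOpen.frontier_eq]; exact ⟨hz, hn⟩))

/-- The maximum principle. As `h → 0` at infinity, a nonnegative value of `N` would produce a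
maximum over the closure that is attained in `Ω` itself: a nonzero maximum is attained off the
boundary, and a zero maximum at `z`. Then `h` would be constant. -/
lemma neg (H : IsExteriorMap Ω N f h a) {z : ℂ} (hz : z ∈ Ω) : N z < 0 := by
  by_contra hz0
  push Not at hz0
  obtain ⟨ρ, hρ, hsmall⟩ := H.eventually_norm_lt one_pos
  have hNsmall : ∀ w : ℂ, ρ ≤ ‖w‖ → N w < 0 := by
    intro w hw
    have h1 := (hsmall w hw).2
    rwa [H.norm w (hsmall w hw).1, Real.exp_lt_one_iff] at h1
  have hzρ : ‖z‖ ≤ ρ := by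
    by_contra hlt
    exact absurd (hNsmall z (not_le.1 hlt).le) (not_lt.2 hz0)
  have hzK : z ∈ closure Ω ∩ Metric.closedBall 0 ρ :=
    ⟨subset_closure hz, mem_closedBall_zero_iff.2 hzρ⟩
  obtain ⟨y, hy, hmax⟩ := (isCompact_inter Ω ρ).exists_isMaxOn ⟨z, hzK⟩
    (H.continuousOn.mono inter_subset_left)
  have hglob : ∀ x ∈ closure Ω, N x ≤ N y := by
    intro x hx
    rcases le_or_gt ρ ‖x‖ with hle | hlt
    · exact ((hNsmall x hle).le.trans hz0).trans (hmax hzK)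
    · exact hmax ⟨hx, mem_closedBall_zero_iff.2 hlt.le⟩
  obtain ⟨c, hc, hcmax⟩ : ∃ c ∈ Ω, ∀ x ∈ closure Ω, N x ≤ N c := by
    by_cases h0 : N y = 0
    · refine ⟨z, hz, fun x hx => (hglob x hx).trans (by rw [h0]; exact hz0)⟩
    · exact ⟨y, H.mem_of_neg hy.1 h0, hglob⟩
  refine H.not_const (h c) (Complex.eqOn_of_isPreconnected_of_isMaxOn_norm
    H.isConnected.isPreconnected H.isOpen H.differentiableOn hc ?_)
  intro x hx
  simp only [mem_ofPred_eq, Function.comp, H.norm x hx, H.norm c hc]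
  exact Real.exp_le_exp.2 (hcmax x (subset_closure hx))

lemma mapsTo (H : IsExteriorMap Ω N f h a) : MapsTo h Ω puncturedDisc := fun z hz =>
  ⟨H.map_ne_zero hz, by rw [H.norm z hz, Real.exp_lt_one_iff]; exact H.neg hz⟩

/-- The preimages of a compact subset of the open punctured disc do not escape. -/
lemma tendsto_subseq (H : IsExteriorMap Ω N f h a) {w : ℂ} (hw : w ∈ puncturedDisc) {x : ℕ → ℂ}
    (hx : ∀ n, x n ∈ Ω) (hlim : Tendsto (fun n => h (x n)) atTop (𝓝 w)) :
    ∃ z ∈ Ω, h z = w ∧ ∃ φ : ℕ → ℕ, StrictMono φ ∧ Tendsto (x ∘ φ) atTop (𝓝 z) := by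
  have hw0 : 0 < ‖w‖ := norm_pos_iff.2 hw.1
  obtain ⟨ρ, hρ, hsmall⟩ := H.eventually_norm_lt (half_pos hw0)
  have h1 : ∀ᶠ n in atTop, x n ∈ closure Ω ∩ Metric.closedBall 0 ρ := by
    have h2 : ∀ᶠ n in atTop, ‖w‖ / 2 < ‖h (x n)‖ := hlim.norm.eventually_const_lt (by linarith)
    filter_upwards [h2] with n hn
    refine ⟨subset_closure (hx n), mem_closedBall_zero_iff.2 ?_⟩
    by_contra hlt
    linarith [(hsmall (x n) (not_le.1 hlt).le).2]
  obtain ⟨z, hz, φ, hφ, hlimφ⟩ := (isCompact_inter Ω ρ).tendsto_subseq' h1.frequently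
  have h3 : Tendsto (fun n => N (x (φ n))) atTop (𝓝 (N z)) :=
    (H.continuousOn z hz.1).tendsto.comp (tendsto_nhdsWithin_iff.2
      ⟨hlimφ, Eventually.of_forall fun n => subset_closure (hx _)⟩)
  have h4 : Tendsto (fun n => N (x (φ n))) atTop (𝓝 (Real.log ‖w‖)) := by
    have h5 := (hlim.comp hφ.tendsto_atTop).norm.log hw0.ne'
    refine h5.congr fun n => ?_
    simp only [Function.comp]
    rw [H.norm _ (hx _), Real.log_exp]
  have h6 := tendsto_nhds_unique h3 h4
  have hzΩ : z ∈ Ω := H.mem_of_neg hz.1 (by rw [h6]; exact (Real.log_neg hw0 hw.2).ne)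
  refine ⟨z, hzΩ, ?_, φ, hφ, hlimφ⟩
  exact tendsto_nhds_unique ((H.deriv z hzΩ).continuousAt.tendsto.comp hlimφ)
    (hlim.comp hφ.tendsto_atTop)

/-- Properness of `h`: otherwise there are values tending to `w` with preimages outside `U`, and a
limit point of these would be a preimage of `w` outside `U`. -/
lemma eventually_fiber_subset (H : IsExteriorMap Ω N f h a) {w : ℂ} (hw : w ∈ puncturedDisc)
    {U : Set ℂ} (hU : IsOpen U) (hfib : ∀ z ∈ Ω, h z = w → z ∈ U) :
    ∀ᶠ w' in 𝓝 w, ∀ z ∈ Ω, h z = w' → z ∈ U := by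
  by_contra hcon
  rw [not_eventually] at hcon
  obtain ⟨v, hv, hv'⟩ := exists_seq_forall_of_frequently hcon
  push Not at hv'
  choose x hx hxv hxU using hv'
  obtain ⟨z, hz, hzw, φ, -, hlim⟩ := H.tendsto_subseq hw hx (by simpa only [hxv] using hv)
  exact hU.isClosed_compl.mem_of_tendsto hlim (Eventually.of_forall fun n => hxU (φ n)) (hfib z hz hzw)

lemma deriv_eq (H : IsExteriorMap Ω N f h a) {z : ℂ} (hz : z ∈ Ω) : _root_.deriv h z = f z * h z :=
  (H.deriv z hz).deriv

lemma hasStrictDerivAt (H : IsExteriorMap Ω N f h a) {z : ℂ} (hz : z ∈ Ω) :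
    HasStrictDerivAt h (f z * h z) z := by
  rw [← H.deriv_eq hz]
  exact (H.analyticAt hz).hasStrictDerivAt

/-- Small values are taken exactly once, at a regular point. -/
lemma exists_simple_value (H : IsExteriorMap Ω N f h a) :
    ∃ z ∈ Ω, f z ≠ 0 ∧ ∀ z' ∈ Ω, h z' = h z → z' = z := by
  obtain ⟨R, hR, hout⟩ := H.outside
  set q : ℂ → ℂ := Function.update (fun ξ => h ξ⁻¹) 0 0 with hq
  have hq0 : q 0 = 0 := by simp [hq]
  have hqne : ∀ ξ, ξ ≠ 0 → q ξ = h ξ⁻¹ := fun ξ hξ => by simp [hq, hξ]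
  have hRi : 0 < R⁻¹ := inv_pos.2 hR
  have hinv : ∀ ξ : ℂ, ξ ≠ 0 → ‖ξ‖ < R⁻¹ → ξ⁻¹ ∈ Ω := by
    intro ξ hξ h
    refine hout _ ?_
    rw [norm_inv]
    exact (lt_inv_comm₀ (norm_pos_iff.2 hξ) hR).1 h
  have hder : HasDerivAt q a 0 := by
    rw [hasDerivAt_iff_tendsto_slope]
    have h1 : Tendsto (fun ξ : ℂ => ξ⁻¹ * h ξ⁻¹) (𝓝[≠] 0) (𝓝 a) :=
      H.infinity.comp tendsto_inv₀_nhdsNE_zero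
    refine h1.congr' ?_
    filter_upwards [self_mem_nhdsWithin] with ξ hξ
    rw [slope_def_field, hq0, hqne ξ hξ]
    field_simp
    simp
  have hqd : DifferentiableOn ℂ q (Metric.ball 0 R⁻¹) := by
    intro ξ hξ
    rw [mem_ball_zero_iff] at hξ
    by_cases h0 : ξ = 0
    · rw [h0]; exact hder.differentiableAt.differentiableWithinAt
    have h1 : DifferentiableAt ℂ (fun ξ => h ξ⁻¹) ξ :=
      (H.deriv _ (hinv ξ h0 hξ)).differentiableAt.comp ξ (differentiableAt_inv h0)
    refine (h1.congr_of_eventuallyEq ?_).differentiableWithinAt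
    filter_upwards [isOpen_ne.mem_nhds h0] with w hw using hqne w hw
  have hqa : AnalyticAt ℂ q 0 := hqd.analyticAt (Metric.ball_mem_nhds _ hRi)
  have hstrict : HasStrictDerivAt q a 0 := by
    have := hqa.hasStrictDerivAt
    rwa [hder.deriv] at this
  obtain ⟨U, hU, hinj⟩ := hstrict.exists_injOn H.ne_zero
  have hdne : ∀ᶠ ξ in 𝓝 (0 : ℂ), _root_.deriv q ξ ≠ 0 :=
    hqa.deriv.continuousAt.eventually_ne (by rw [hder.deriv]; exact H.ne_zero)
  obtain ⟨r, hr, hball⟩ := Metric.mem_nhds_iff.1 (inter_mem (inter_mem hU hdne)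
    (Metric.ball_mem_nhds (0 : ℂ) hRi))
  -- On bounded parts of the closure `|h| = exp N` is bounded below. Small values thus occur only
  -- near infinity, where `h` is injective in the coordinate `1/z` because `a ≠ 0`.
  obtain ⟨δ, hδ, hlarge⟩ : ∃ δ > 0, ∀ z ∈ Ω, ‖h z‖ < δ → r⁻¹ < ‖z‖ := by
    obtain ⟨m, hm⟩ := (isCompact_inter Ω r⁻¹).exists_bound_of_continuousOn
      (H.continuousOn.mono inter_subset_left)
    refine ⟨Real.exp (-m), Real.exp_pos _, fun z hz hlt => ?_⟩
    by_contra hle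
    have h1 := hm z ⟨subset_closure hz, mem_closedBall_zero_iff.2 (not_lt.1 hle)⟩
    rw [H.norm z hz, Real.exp_lt_exp] at hlt
    rw [Real.norm_eq_abs, abs_le] at h1
    linarith [h1.1]
  obtain ⟨ρ, hρ, hsmall⟩ := H.eventually_norm_lt hδ
  have hnρ : ‖(ρ : ℂ)‖ = ρ := by rw [Complex.norm_real, Real.norm_of_nonneg hρ.le]
  obtain ⟨hzΩ, hzδ⟩ := hsmall ρ hnρ.ge
  set z : ℂ := (ρ : ℂ) with hz
  have hxi : ∀ x ∈ Ω, ‖h x‖ < δ → x ≠ 0 ∧ x⁻¹ ∈ Metric.ball (0 : ℂ) r ∧ q x⁻¹ = h x := by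
    intro x hx hxδ
    have h1 := hlarge x hx hxδ
    have hx0 : x ≠ 0 := norm_pos_iff.1 ((inv_pos.2 hr).trans h1)
    refine ⟨hx0, ?_, ?_⟩
    · rw [mem_ball_zero_iff, norm_inv]
      exact inv_lt_of_inv_lt₀ hr h1
    · rw [hqne _ (inv_ne_zero hx0), inv_inv]
  obtain ⟨hz0, hzb, hzq⟩ := hxi z hzΩ hzδ
  refine ⟨z, hzΩ, ?_, ?_⟩
  · intro hf
    refine (hball hzb).1.2 ?_
    have h1 : HasDerivAt (fun ξ => h ξ⁻¹) 0 z⁻¹ := by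
      have h2 := H.deriv z hzΩ
      rw [hf, zero_mul] at h2
      have h3 : HasDerivAt h 0 (z⁻¹)⁻¹ := by rwa [inv_inv]
      have h4 := h3.comp z⁻¹ (hasDerivAt_inv (inv_ne_zero hz0))
      rw [zero_mul] at h4
      exact h4
    refine (h1.congr_of_eventuallyEq ?_).deriv
    filter_upwards [isOpen_ne.mem_nhds (inv_ne_zero hz0)] with w hw using hqne w hw
  · intro x hx hxz
    obtain ⟨hx0, hxb, hxq⟩ := hxi x hx (by rw [hxz]; exact hzδ)
    exact inv_injective (hinj (hball hxb).1.1 (hball hzb).1.1 (by rw [hxq, hzq, hxz]))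

/-- `h` maps the exterior domain conformally onto the punctured disc. -/
theorem existsUnique_preimage (H : IsExteriorMap Ω N f h a) {w : ℂ} (hw : w ∈ puncturedDisc) :
    ∃ z ∈ Ω, h z = w ∧ f z ≠ 0 ∧ ∀ z' ∈ Ω, h z' = w → z' = z := by
  -- A connectedness argument in the punctured disc. Values taken twice or critically form an open
  -- set, by the open mapping theorem and the local form at critical points; omitted values form an
  -- open set by properness; values taken exactly once, at a regular point, also form an open set,
  -- which is nonempty.
  set A₁ : Set ℂ := {w | w ∈ puncturedDisc ∧ ∃ z₁ ∈ Ω, ∃ z₂ ∈ Ω, z₁ ≠ z₂ ∧ h z₁ = w ∧ h z₂ = w} with hA₁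
  set A₂ : Set ℂ := {w | w ∈ puncturedDisc ∧ ∃ z ∈ Ω, h z = w ∧ f z = 0} with hA₂
  set E : Set ℂ := {w | w ∈ puncturedDisc ∧ ∀ z ∈ Ω, h z ≠ w} with hE
  set B : Set ℂ := {w | w ∈ puncturedDisc ∧ ∃ z ∈ Ω, h z = w ∧ f z ≠ 0 ∧ ∀ z' ∈ Ω, h z' = w → z' = z}
    with hB
  have hA : IsOpen (A₁ ∪ A₂) := by
    rw [isOpen_iff_mem_nhds]
    rintro w (⟨hwD, z₁, hz₁, z₂, hz₂, hne, h₁, h₂⟩ | ⟨hwD, z, hz, hzw, hfz⟩)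
    · obtain ⟨U₁, U₂, hU₁, hU₂, hm₁, hm₂, hdis⟩ := t2_separation hne
      have e₁ : h '' (U₁ ∩ Ω) ∈ 𝓝 w := by
        rw [← h₁]
        exact H.nhds_le_map hz₁ (image_mem_map ((hU₁.inter H.isOpen).mem_nhds ⟨hm₁, hz₁⟩))
      have e₂ : h '' (U₂ ∩ Ω) ∈ 𝓝 w := by
        rw [← h₂]
        exact H.nhds_le_map hz₂ (image_mem_map ((hU₂.inter H.isOpen).mem_nhds ⟨hm₂, hz₂⟩))
      filter_upwards [e₁, e₂, isOpen_puncturedDisc.mem_nhds hwD]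
      rintro v ⟨x₁, ⟨hx₁, hx₁Ω⟩, rfl⟩ ⟨x₂, ⟨hx₂, hx₂Ω⟩, hxx⟩ hvD
      refine Or.inl ⟨hvD, x₁, hx₁Ω, x₂, hx₂Ω, ?_, rfl, hxx⟩
      rintro rfl
      exact Set.disjoint_left.1 hdis hx₁ hx₂
    · have e₁ := eventually_two_preimages (H.analyticAt hz) (H.not_eventually_const hz _)
        (by rw [H.deriv_eq hz, hfz, zero_mul]) (H.isOpen.mem_nhds hz)
      rw [hzw] at e₁
      filter_upwards [e₁, isOpen_puncturedDisc.mem_nhds hwD] with v hv hvD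
      by_cases hvw : v = w
      · exact Or.inr ⟨hvD, z, hz, hzw.trans hvw.symm, hfz⟩
      · exact Or.inl ⟨hvD, hv hvw⟩
  have hEo : IsOpen E := by
    rw [isOpen_iff_mem_nhds]
    rintro w ⟨hwD, hwE⟩
    have := H.eventually_fiber_subset hwD isOpen_empty fun z hz hzw => hwE z hz hzw
    filter_upwards [this, isOpen_puncturedDisc.mem_nhds hwD] with v hv hvD
    exact ⟨hvD, fun z hz hzv => hv z hz hzv⟩
  have hBo : IsOpen B := by
    rw [isOpen_iff_mem_nhds]
    rintro w ⟨hwD, z, hz, hzw, hfz, huniq⟩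
    have hd0 : f z * h z ≠ 0 := mul_ne_zero hfz (H.map_ne_zero hz)
    obtain ⟨U, hU, hinj⟩ := (H.hasStrictDerivAt hz).exists_injOn hd0
    have hder : ∀ᶠ x in 𝓝 z, _root_.deriv h x ≠ 0 :=
      (H.analyticAt hz).deriv.continuousAt.eventually_ne (by rw [H.deriv_eq hz]; exact hd0)
    obtain ⟨V, hVs, hVo, hzV⟩ := mem_nhds_iff.1 (inter_mem (inter_mem hU hder) (H.isOpen.mem_nhds hz))
    have e₁ : h '' V ∈ 𝓝 w := by
      rw [← hzw]
      exact H.nhds_le_map hz (image_mem_map (hVo.mem_nhds hzV))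
    have e₂ := H.eventually_fiber_subset hwD hVo fun x hx hxw => by rw [huniq x hx hxw]; exact hzV
    filter_upwards [e₁, e₂, isOpen_puncturedDisc.mem_nhds hwD]
    rintro v ⟨x, hx, rfl⟩ hv hvD
    have hxΩ := (hVs hx).2
    refine ⟨hvD, x, hxΩ, rfl, ?_, fun y hy hyx => hinj (hVs (hv y hy hyx)).1.1 (hVs hx).1.1 hyx⟩
    intro hf0
    refine (hVs hx).1.2 ?_
    rw [H.deriv_eq hxΩ, hf0, zero_mul]
  have hdis : Disjoint B (A₁ ∪ A₂ ∪ E) := by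
    rw [Set.disjoint_left]
    rintro w ⟨-, z, hz, hzw, hfz, hu⟩ ((⟨-, z₁, hz₁, z₂, hz₂, hne, h₁, h₂⟩ | ⟨-, y, hy, hyw, hfy⟩) | ⟨-, hwE⟩)
    · exact hne ((hu z₁ hz₁ h₁).trans (hu z₂ hz₂ h₂).symm)
    · rw [hu y hy hyw] at hfy
      exact hfz hfy
    · exact hwE z hz hzw
  have hcov : puncturedDisc ⊆ B ∪ (A₁ ∪ A₂ ∪ E) := by
    intro w hw
    by_cases hwE : ∃ z ∈ Ω, h z = w
    · obtain ⟨z, hz, hzw⟩ := hwE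
      by_cases hfz : f z = 0
      · exact Or.inr (Or.inl (Or.inr ⟨hw, z, hz, hzw, hfz⟩))
      by_cases hu : ∀ z' ∈ Ω, h z' = w → z' = z
      · exact Or.inl ⟨hw, z, hz, hzw, hfz, hu⟩
      · push Not at hu
        obtain ⟨y, hy, hyw, hyz⟩ := hu
        exact Or.inr (Or.inl (Or.inl ⟨hw, y, hy, z, hz, hyz, hyw, hzw⟩))
    · push Not at hwE
      exact Or.inr (Or.inr ⟨hw, hwE⟩)
  obtain ⟨z, hz, hfz, hu⟩ := H.exists_simple_value
  exact (isPreconnected_puncturedDisc.subset_left_of_subset_union hBo (hA.union hEo) hdis hcov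
    ⟨h z, H.mapsTo hz, H.mapsTo hz, z, hz, rfl, hfz, hu⟩ hw).2

end IsExteriorMap

end Bijectivity

/-! ### Boundary charts adapted to the curve. -/

section Charts

lemma IsPreconnected.subset_of_disjoint_frontier {S Ω : Set ℂ} (hS : IsPreconnected S)
    (hΩ : IsOpen Ω) (hd : ∀ z ∈ S, z ∉ frontier Ω) (hne : (S ∩ Ω).Nonempty) : S ⊆ Ω := by
  refine hS.subset_left_of_subset_union hΩ isClosed_closure.isOpen_compl
    (disjoint_compl_right.mono_left subset_closure) (fun z hz => ?_) hne
  by_contra hn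
  rw [mem_union, not_or, notMem_compl_iff] at hn
  exact hd z hz (by rw [hΩ.frontier_eq]; exact ⟨hn.2, hn.1⟩)

lemma IsPreconnected.subset_or_disjoint_closure {S Ω : Set ℂ} (hS : IsPreconnected S)
    (hΩ : IsOpen Ω) (hd : ∀ z ∈ S, z ∉ frontier Ω) : S ⊆ Ω ∨ ∀ z ∈ S, z ∉ closure Ω := by
  by_cases hne : (S ∩ Ω).Nonempty
  · exact Or.inl (hS.subset_of_disjoint_frontier hΩ hd hne)
  · refine Or.inr fun z hz hc => hd z hz ?_
    rw [hΩ.frontier_eq]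
    exact ⟨hc, fun hzΩ => hne ⟨z, hz, hzΩ⟩⟩

/-- A regular periodic parametrization of the closed curve `J`, injective on a period. -/
structure IsCurveParam (J : Set ℂ) (γ : ℝ → ℂ) : Prop where
  contDiff : ContDiff ℝ 2 γ
  periodic : Function.Periodic γ 1
  deriv_ne : ∀ t, deriv γ t ≠ 0
  injOn : InjOn γ (Ico 0 1)
  range_eq : range γ = J

namespace IsCurveParam

variable {J : Set ℂ} {γ : ℝ → ℂ}

/-- Injectivity on one period, applied to the fractional parts. -/
lemma exists_int (P : IsCurveParam J γ) {s t : ℝ} (h : γ s = γ t) : ∃ n : ℤ, s = t + n := by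
  have h1 : γ (Int.fract s) = γ (Int.fract t) := by
    rw [Int.fract, Int.fract, ← mul_one (⌊s⌋ : ℝ), ← mul_one (⌊t⌋ : ℝ), P.periodic.sub_int_mul_eq,
      P.periodic.sub_int_mul_eq, h]
  have h2 := P.injOn ⟨Int.fract_nonneg s, Int.fract_lt_one s⟩
    ⟨Int.fract_nonneg t, Int.fract_lt_one t⟩ h1
  refine ⟨⌊s⌋ - ⌊t⌋, ?_⟩
  have h3 := Int.floor_add_fract s
  have h4 := Int.floor_add_fract t
  push_cast
  linarith

lemma image_Icc (P : IsCurveParam J γ) (a : ℝ) : γ '' Icc a (a + 1) = J := by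
  rw [← P.range_eq]
  refine (image_subset_range _ _).antisymm ?_
  rintro _ ⟨t, rfl⟩
  obtain ⟨y, hy, hty⟩ := P.periodic.exists_mem_Ico one_pos t a
  exact ⟨y, Ico_subset_Icc_self hy, hty.symm⟩

lemma isCompact (P : IsCurveParam J γ) : IsCompact J := by
  rw [← P.image_Icc 0]
  exact isCompact_Icc.image P.contDiff.continuous

/-- Points of the curve near `γ t₀` have parameters near `t₀`. -/
lemma eventually_param_near (P : IsCurveParam J γ) (t₀ : ℝ) {ε : ℝ} (hε : 0 < ε) :
    ∀ᶠ z in 𝓝 (γ t₀), z ∈ J → ∃ t, |t - t₀| < ε ∧ γ t = z := by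
  set K : Set ℝ := Icc (t₀ - 1 / 2) (t₀ - 1 / 2 + 1) ∩ {t | ε ≤ |t - t₀|} with hK
  have hKc : IsCompact K := isCompact_Icc.inter_right
    (isClosed_le continuous_const (continuous_id.sub continuous_const).abs)
  have hp : γ t₀ ∉ γ '' K := by
    rintro ⟨t, ⟨⟨h1, h2⟩, h3⟩, h4⟩
    obtain ⟨n, hn⟩ := P.exists_int h4
    have hn1 : (n : ℝ) < 1 := by linarith
    have hn2 : (-1 : ℝ) < n := by linarith
    have hn3 : n < 1 := by exact_mod_cast hn1
    have hn4 : -1 < n := by exact_mod_cast hn2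
    have hn0 : n = 0 := by omega
    rw [hn0] at hn
    rw [mem_ofPred_eq, hn] at h3
    simp at h3
    linarith
  filter_upwards [(hKc.image P.contDiff.continuous).isClosed.isOpen_compl.mem_nhds hp] with z hz hzJ
  rw [← P.image_Icc (t₀ - 1 / 2)] at hzJ
  obtain ⟨t, ht, rfl⟩ := hzJ
  refine ⟨t, ?_, rfl⟩
  by_contra hlt
  exact hz ⟨t, ⟨ht, not_lt.1 hlt⟩, rfl⟩

end IsCurveParam

/-- Real multiples of `x` along the curve, imaginary ones along the normal at `t₀`. -/
noncomputable def curveChart (γ : ℝ → ℂ) (t₀ σ : ℝ) (x : ℂ) : ℂ :=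
  γ (t₀ + σ * x.re) + ((σ * x.im : ℝ) : ℂ) * (Complex.I * deriv γ t₀)

lemma curveChart_real (γ : ℝ → ℂ) (t₀ σ : ℝ) {x : ℂ} (hx : x.im = 0) :
    curveChart γ t₀ σ x = γ (t₀ + σ * x.re) := by
  simp [curveChart, hx]

lemma curveChart_zero (γ : ℝ → ℂ) (t₀ σ : ℝ) : curveChart γ t₀ σ 0 = γ t₀ := by
  simp [curveChart]

lemma contDiff_curveChart {γ : ℝ → ℂ} (hγ : ContDiff ℝ 2 γ) (t₀ σ : ℝ) :
    ContDiff ℝ 2 (curveChart γ t₀ σ) := by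
  have h1 : ContDiff ℝ 2 (fun x : ℂ => x.re) := Complex.reCLM.contDiff
  have h2 : ContDiff ℝ 2 (fun x : ℂ => x.im) := Complex.imCLM.contDiff
  have h3 : ContDiff ℝ 2 (fun x : ℝ => (x : ℂ)) := Complex.ofRealCLM.contDiff
  exact (hγ.comp (contDiff_const.add (contDiff_const.mul h1))).add
    ((h3.comp (contDiff_const.mul h2)).mul contDiff_const)

lemma hasFDerivAt_curveChart_zero {γ : ℝ → ℂ} (hγ : ContDiff ℝ 2 γ) (t₀ σ : ℝ) :
    HasFDerivAt (curveChart γ t₀ σ) (ContinuousLinearMap.mul ℝ ℂ (σ * deriv γ t₀)) 0 := by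
  have h0 : HasFDerivAt (fun x : ℂ => t₀ + σ * x.re) (σ • Complex.reCLM) 0 :=
    (Complex.reCLM.hasFDerivAt.const_smul σ).const_add t₀
  have h1 : HasDerivAt γ (deriv γ t₀) (t₀ + σ * (0 : ℂ).re) := by
    simpa using (hγ.differentiable (by norm_num) t₀).hasDerivAt
  have h2 : HasFDerivAt (fun x : ℂ => ((σ * x.im : ℝ) : ℂ)) (Complex.ofRealCLM ∘L (σ • Complex.imCLM)) 0 :=
    (Complex.ofRealCLM ∘L (σ • Complex.imCLM)).hasFDerivAt
  have h3 := (h1.hasFDerivAt.comp (0 : ℂ) h0).add (h2.mul_const (Complex.I * deriv γ t₀))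
  refine h3.congr_fderiv ?_
  ext x
  simp only [ContinuousLinearMap.mul_apply', Complex.reCLM_apply, Complex.imCLM_apply, add_apply,
    ContinuousLinearMap.comp_apply, smul_apply, smul_eq_mul, Complex.ofRealCLM_apply,
    ContinuousLinearMap.toSpanSingleton_apply, Complex.real_smul]
  conv_rhs => rw [← Complex.re_add_im x]
  push_cast
  ring

/-- A `C²` map of the plane whose derivative is multiplication by a nonzero number has a `C¹` local
inverse. -/
lemma exists_local_inverse {e : ℂ → ℂ} (he : ContDiff ℝ 2 e) {v : ℂ} (hv : v ≠ 0)
    (hd : HasFDerivAt e (ContinuousLinearMap.mul ℝ ℂ v) 0) :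
    ∃ g : ℂ → ℂ, ContDiffAt ℝ 1 g (e 0) ∧ g (e 0) = 0 ∧ (∀ᶠ x in 𝓝 0, g (e x) = x) ∧
      ∀ᶠ z in 𝓝 (e 0), e (g z) = z := by
  set A : ℂ ≃L[ℝ] ℂ := ContinuousLinearEquiv.equivOfInverse (ContinuousLinearMap.mul ℝ ℂ v)
    (ContinuousLinearMap.mul ℝ ℂ v⁻¹) (fun x => by simp [hv]) (fun x => by simp [hv]) with hA
  have hd' : HasFDerivAt e (A : ℂ →L[ℝ] ℂ) 0 := hd
  have hc : ContDiffAt ℝ 1 e 0 := (he.of_le (by norm_num)).contDiffAt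
  have hs := hc.hasStrictFDerivAt' hd' (by norm_num)
  exact ⟨hs.localInverse e A 0, hc.to_localInverse hd' (by norm_num), hs.localInverse_apply_image,
    hs.eventually_left_inverse, hs.eventually_right_inverse⟩

/-- A chart around the boundary point `γ t₀` which maps the upper half of a disc into `Ω`. -/
structure IsBoundaryChart (Ω : Set ℂ) (γ : ℝ → ℂ) (t₀ σ δ : ℝ) (g : ℂ → ℂ) : Prop where
  sign : σ = 1 ∨ σ = -1
  pos : 0 < δ
  contDiffAt : ContDiffAt ℝ 1 g (γ t₀)
  apply_base : g (γ t₀) = 0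
  left_inv : ∀ x ∈ Metric.ball (0 : ℂ) δ, g (curveChart γ t₀ σ x) = x
  right_inv : ∀ᶠ z in 𝓝 (γ t₀), curveChart γ t₀ σ (g z) = z
  im_eq_zero : ∀ x ∈ Metric.ball (0 : ℂ) δ, curveChart γ t₀ σ x ∈ frontier Ω → x.im = 0
  upper : ∀ x ∈ Metric.ball (0 : ℂ) δ, 0 < x.im → curveChart γ t₀ σ x ∈ Ω
  lower : (∀ x ∈ Metric.ball (0 : ℂ) δ, x.im < 0 → curveChart γ t₀ σ x ∉ closure Ω) ∨
    ∀ x ∈ Metric.ball (0 : ℂ) δ, x.im < 0 → curveChart γ t₀ σ x ∈ Ω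

lemma curveChart_neg (γ : ℝ → ℂ) (t₀ : ℝ) (x : ℂ) :
    curveChart γ t₀ (-1) x = curveChart γ t₀ 1 (-x) := by
  simp [curveChart]

/-- Near `γ t₀` the frontier corresponds to real chart coordinates only. The images of the two open
half-discs are connected and miss the frontier, so each lies in `Ω` or off its closure. They cannot
both lie off it, since `γ t₀` is a limit of points of `Ω`; the chart is reversed if only the lower
half lies in `Ω`. That `Ω` occupies just one side is not yet known here. -/
theorem exists_boundaryChart {Ω : Set ℂ} (hΩ : IsOpen Ω) {γ : ℝ → ℂ}
    (P : IsCurveParam (frontier Ω) γ) (t₀ : ℝ) : ∃ σ δ g, IsBoundaryChart Ω γ t₀ σ δ g := by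
  set e := curveChart γ t₀ 1 with he
  have hec : ContDiff ℝ 2 e := contDiff_curveChart P.contDiff t₀ 1
  have he0 : e 0 = γ t₀ := curveChart_zero γ t₀ 1
  obtain ⟨g, hg, hg0, hl, hr⟩ := exists_local_inverse hec
    (v := ((1 : ℝ) : ℂ) * deriv γ t₀) (by simpa using P.deriv_ne t₀)
    (hasFDerivAt_curveChart_zero P.contDiff t₀ 1)
  rw [he0] at hg hg0 hr
  obtain ⟨ε, hε, hlε⟩ := Metric.eventually_nhds_iff_ball.1 hl
  have hnear : ∀ᶠ x in 𝓝 (0 : ℂ), e x ∈ frontier Ω → ∃ t, |t - t₀| < ε ∧ γ t = e x := by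
    have h1 := P.eventually_param_near t₀ hε
    rw [← he0] at h1
    exact hec.continuous.continuousAt.eventually h1
  obtain ⟨δ, hδ, hball⟩ := Metric.eventually_nhds_iff_ball.1
    (hnear.and (Metric.ball_mem_nhds (0 : ℂ) hε))
  have him : ∀ x ∈ Metric.ball (0 : ℂ) δ, e x ∈ frontier Ω → x.im = 0 := by
    intro x hx hxJ
    obtain ⟨t, ht, htx⟩ := (hball x hx).1 hxJ
    have h1 : e ((t - t₀ : ℝ) : ℂ) = γ t := by
      rw [he, curveChart_real _ _ _ (Complex.ofReal_im _)]
      simp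
    have h2 : ((t - t₀ : ℝ) : ℂ) = x := by
      rw [← hlε x (hball x hx).2, ← htx, ← h1, hlε]
      rw [mem_ball_zero_iff, Complex.norm_real]
      exact ht
    rw [← h2, Complex.ofReal_im]
  have hup : IsPreconnected (e '' (Metric.ball 0 δ ∩ {x | 0 < x.im})) :=
    (((convex_ball _ _).inter (convex_halfSpace_im_gt 0)).isPreconnected).image _ hec.continuous.continuousOn
  have hlo : IsPreconnected (e '' (Metric.ball 0 δ ∩ {x | x.im < 0})) :=
    (((convex_ball _ _).inter (convex_halfSpace_im_lt 0)).isPreconnected).image _ hec.continuous.continuousOn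
  have dup := hup.subset_or_disjoint_closure hΩ (by
    rintro _ ⟨x, ⟨hx, hx'⟩, rfl⟩ hJ
    exact (ne_of_gt hx') (him x hx hJ))
  have dlo := hlo.subset_or_disjoint_closure hΩ (by
    rintro _ ⟨x, ⟨hx, hx'⟩, rfl⟩ hJ
    exact (ne_of_lt hx') (him x hx hJ))
  have hnot : ¬ ((∀ z ∈ e '' (Metric.ball 0 δ ∩ {x | 0 < x.im}), z ∉ closure Ω) ∧
      ∀ z ∈ e '' (Metric.ball 0 δ ∩ {x | x.im < 0}), z ∉ closure Ω) := by
    rintro ⟨h1, h2⟩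
    have hp : γ t₀ ∈ closure Ω := frontier_subset_closure (by rw [← P.range_eq]; exact ⟨t₀, rfl⟩)
    have hgδ : ∀ᶠ z in 𝓝 (γ t₀), g z ∈ Metric.ball (0 : ℂ) δ := by
      refine hg.continuousAt.eventually ?_
      rw [hg0]
      exact Metric.ball_mem_nhds _ hδ
    obtain ⟨z, ⟨hzg, hze⟩, hzΩ⟩ := (mem_closure_iff_nhds.1 hp) _ (hgδ.and hr)
    rcases lt_trichotomy (g z).im 0 with hlt | heq | hgt
    · exact h2 z ⟨g z, ⟨hzg, hlt⟩, hze⟩ (subset_closure hzΩ)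
    · have h3 : z ∈ frontier Ω := by
        rw [← hze, he, curveChart_real _ _ _ heq, ← P.range_eq]
        exact ⟨_, rfl⟩
      rw [hΩ.frontier_eq] at h3
      exact h3.2 hzΩ
    · exact h1 z ⟨g z, ⟨hzg, hgt⟩, hze⟩ (subset_closure hzΩ)
  have key1 : (∀ x ∈ Metric.ball (0 : ℂ) δ, 0 < x.im → e x ∈ Ω) →
      ∃ σ δ g, IsBoundaryChart Ω γ t₀ σ δ g := fun hu =>
    ⟨1, δ, g, Or.inl rfl, hδ, hg, hg0, fun x hx => hlε x (hball x hx).2, hr, him, hu,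
      dlo.symm.imp (fun h x hx hx' => h _ ⟨x, ⟨hx, hx'⟩, rfl⟩)
        fun h x hx hx' => h ⟨x, ⟨hx, hx'⟩, rfl⟩⟩
  have hneg : ∀ x : ℂ, x ∈ Metric.ball (0 : ℂ) δ → -x ∈ Metric.ball (0 : ℂ) δ := by
    intro x hx
    simpa using hx
  rcases dup with hu | hu
  · exact key1 fun x hx hx' => hu ⟨x, ⟨hx, hx'⟩, rfl⟩
  · have hlΩ := dlo.resolve_right fun h => hnot ⟨hu, h⟩
    refine ⟨-1, δ, fun z => -g z, Or.inr rfl, hδ, hg.neg, by simp [hg0], fun x hx => ?_, ?_,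
      fun x hx hxJ => ?_, fun x hx hx' => ?_, Or.inl fun x hx hx' => ?_⟩
    · rw [curveChart_neg]
      exact neg_eq_iff_eq_neg.2 (hlε _ (hball _ (hneg x hx)).2)
    · filter_upwards [hr] with z hz
      rw [curveChart_neg, neg_neg]
      exact hz
    · rw [curveChart_neg] at hxJ
      simpa using him _ (hneg x hx) hxJ
    · rw [curveChart_neg]
      exact hlΩ ⟨-x, ⟨hneg x hx, by simpa using hx'⟩, rfl⟩
    · rw [curveChart_neg]
      exact hu _ ⟨-x, ⟨hneg x hx, by simpa using hx'⟩, rfl⟩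

/-- Boundary points of a domain with smooth boundary are points of unique differentiability. -/
lemma IsBoundaryChart.uniqueDiffWithinAt {Ω : Set ℂ} {γ : ℝ → ℂ} {t₀ σ δ : ℝ} {g : ℂ → ℂ}
    (C : IsBoundaryChart Ω γ t₀ σ δ g) (P : IsCurveParam (frontier Ω) γ) :
    UniqueDiffWithinAt ℝ (closure Ω) (γ t₀) := by
  have hv : (σ : ℂ) * deriv γ t₀ ≠ 0 := by
    refine mul_ne_zero ?_ (P.deriv_ne t₀)
    rcases C.sign with h | h <;> simp [h]
  set S : Set ℂ := Metric.ball 0 δ ∩ {x | 0 < x.im} with hS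
  have hconv : Convex ℝ S := (convex_ball _ _).inter (convex_halfSpace_im_gt 0)
  have hopen : IsOpen S := Metric.isOpen_ball.inter (isOpen_lt continuous_const Complex.continuous_im)
  have hlim : Tendsto (fun s : ℝ => (s : ℂ) * Complex.I) (𝓝[>] 0) (𝓝 0) := by
    have : Continuous (fun s : ℝ => (s : ℂ) * Complex.I) := by fun_prop
    simpa using (this.tendsto 0).mono_left nhdsWithin_le_nhds
  have hmem : ∀ᶠ s : ℝ in 𝓝[>] 0, (s : ℂ) * Complex.I ∈ S := by
    filter_upwards [hlim.eventually (Metric.ball_mem_nhds 0 C.pos), self_mem_nhdsWithin] with s h1 h2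
    exact ⟨h1, by simpa using h2⟩
  have hcl : (0 : ℂ) ∈ closure S := mem_closure_of_tendsto hlim hmem
  have hne : (interior S).Nonempty := by
    rw [hopen.interior_eq]
    obtain ⟨s, hs⟩ := hmem.exists
    exact ⟨_, hs⟩
  have h1 := ((hasFDerivAt_curveChart_zero P.contDiff t₀ σ).hasFDerivWithinAt (s := S)).uniqueDiffWithinAt
    (uniqueDiffWithinAt_convex hconv hne hcl)
    (Function.Surjective.denseRange fun y => ⟨y / (σ * deriv γ t₀), by
      exact mul_div_cancel₀ y hv⟩)
  rw [curveChart_zero] at h1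
  refine h1.mono ?_
  rintro _ ⟨x, hx, rfl⟩
  exact subset_closure (C.upper x hx.1 hx.2)

lemma uniqueDiffOn_closure {Ω : Set ℂ} (hΩ : IsOpen Ω) {γ : ℝ → ℂ}
    (P : IsCurveParam (frontier Ω) γ) : UniqueDiffOn ℝ (closure Ω) := by
  intro z hz
  by_cases hzΩ : z ∈ Ω
  · exact (hΩ.uniqueDiffWithinAt hzΩ).mono subset_closure
  · have hzJ : z ∈ frontier Ω := by rw [hΩ.frontier_eq]; exact ⟨hz, hzΩ⟩
    rw [← P.range_eq] at hzJ
    obtain ⟨t, rfl⟩ := hzJ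
    obtain ⟨σ, δ, g, C⟩ := exists_boundaryChart hΩ P t
    exact C.uniqueDiffWithinAt P

end Charts

/-! ### Hopf's boundary point lemma and one-sidedness of the domain. -/

section Hopf

/-- A quantitative form of the Schwarz–Pick lemma. -/
lemma one_sub_norm_sq_ge_of_mapsTo_ball {h : ℂ → ℂ} {c : ℂ} {r : ℝ} (hr : 0 < r)
    (hd : DifferentiableOn ℂ h (Metric.ball c r)) (hm : ∀ z ∈ Metric.ball c r, ‖h z‖ < 1) {z : ℂ}
    (hz : z ∈ Metric.ball c r) :
    (1 - (dist z c / r) ^ 2) * ((1 - ‖h c‖) / (1 + ‖h c‖)) ≤ 1 - ‖h z‖ ^ 2 := by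
  have hc := hm c (Metric.mem_ball_self hr)
  have hz1 := hm z hz
  have hid : ∀ u w : ℂ, ‖1 - (starRingEnd ℂ) u * w‖ ^ 2 - ‖w - u‖ ^ 2 =
      (1 - ‖u‖ ^ 2) * (1 - ‖w‖ ^ 2) := by
    intro u w
    simp only [Complex.sq_norm, Complex.normSq_apply, Complex.sub_re, Complex.sub_im, Complex.one_re,
      Complex.one_im, Complex.mul_re, Complex.mul_im, Complex.conj_re, Complex.conj_im]
    ring
  have hden : ∀ w ∈ Metric.ball c r, 1 - ‖h c‖ ≤ ‖1 - (starRingEnd ℂ) (h c) * h w‖ := by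
    intro w hw
    have h1 := norm_sub_norm_le (1 : ℂ) ((starRingEnd ℂ) (h c) * h w)
    rw [norm_one, norm_mul, RCLike.norm_conj] at h1
    have := mul_le_mul_of_nonneg_left (hm w hw).le (norm_nonneg (h c))
    linarith
  have hdpos : ∀ w ∈ Metric.ball c r, 0 < ‖1 - (starRingEnd ℂ) (h c) * h w‖ := fun w hw =>
    (sub_pos.2 hc).trans_le (hden w hw)
  -- A disc automorphism moves `h c` to `0`, and the Schwarz lemma bounds the result by `dist z c /
  -- r`. The identity `hid` converts this into a bound for `1 - |h z|²`.
  set k : ℂ → ℂ := fun w => (h w - h c) / (1 - (starRingEnd ℂ) (h c) * h w) with hk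
  have hkd : DifferentiableOn ℂ k (Metric.ball c r) :=
    (hd.sub_const _).div ((differentiableOn_const _).sub (hd.const_mul _))
      fun w hw => norm_pos_iff.1 (hdpos w hw)
  have hkc : k c = 0 := by simp [hk]
  have hkm : MapsTo k (Metric.ball c r) (Metric.closedBall (k c) 1) := by
    intro w hw
    rw [hkc, mem_closedBall_zero_iff, norm_div, div_le_one (hdpos w hw)]
    refine (sq_le_sq₀ (norm_nonneg _) (norm_nonneg _)).1 ?_
    have h1 := hid (h c) (h w)
    have h2 : 0 ≤ (1 - ‖h c‖ ^ 2) * (1 - ‖h w‖ ^ 2) :=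
      mul_nonneg (by nlinarith [norm_nonneg (h c)]) (by nlinarith [norm_nonneg (h w), hm w hw])
    linarith
  have h1 := Complex.dist_le_div_mul_dist_of_mapsTo_ball hkd hkm hz
  rw [hkc, dist_zero_right, norm_div, div_le_iff₀ (hdpos z hz)] at h1
  set τ := dist z c / r with hτ
  have h1' : ‖h z - h c‖ ≤ τ * ‖1 - (starRingEnd ℂ) (h c) * h z‖ := by
    refine h1.trans (le_of_eq ?_)
    rw [hτ]; ring
  have hτ0 : 0 ≤ τ := by positivity
  have hτ1 : τ < 1 := by
    rw [hτ, div_lt_one hr]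
    exact hz
  have h2 : ‖h z - h c‖ ^ 2 ≤ τ ^ 2 * ‖1 - (starRingEnd ℂ) (h c) * h z‖ ^ 2 := by
    rw [← mul_pow]
    exact pow_le_pow_left₀ (norm_nonneg _) h1' 2
  have h3 := hid (h c) (h z)
  have h4 : (1 - ‖h c‖) ^ 2 ≤ ‖1 - (starRingEnd ℂ) (h c) * h z‖ ^ 2 :=
    pow_le_pow_left₀ (by linarith) (hden z hz) 2
  have h5 : (1 - τ ^ 2) * (1 - ‖h c‖) ^ 2 ≤ (1 - ‖h c‖ ^ 2) * (1 - ‖h z‖ ^ 2) := by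
    have : 0 ≤ 1 - τ ^ 2 := by nlinarith
    nlinarith [mul_le_mul_of_nonneg_left h4 this]
  have h6 : (1 - τ ^ 2) * (1 - ‖h c‖) ≤ (1 + ‖h c‖) * (1 - ‖h z‖ ^ 2) := by
    refine le_of_mul_le_mul_left ?_ (sub_pos.2 hc)
    nlinarith
  rw [← mul_div_assoc, div_le_iff₀ (by positivity)]
  linarith

/-- The curve leaves its tangent line only to second order. This is what allows a disc to be fitted
inside `Ω` at each boundary point. -/
lemma exists_taylor_bound {γ : ℝ → ℂ} (hγ : ContDiff ℝ 2 γ) (t₀ : ℝ) :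
    ∃ C > 0, ∀ u : ℝ, |u| ≤ 1 → ‖γ (t₀ + u) - γ t₀ - u * deriv γ t₀‖ ≤ C * u ^ 2 := by
  have hd : ContDiff ℝ 1 (deriv γ) := ((contDiff_succ_iff_deriv (n := 1)).1 hγ).2.2
  have hdd : Continuous (deriv (deriv γ)) := hd.continuous_deriv le_rfl
  obtain ⟨C, hC⟩ := isCompact_Icc.exists_bound_of_continuousOn (s := Icc (t₀ - 1) (t₀ + 1))
    hdd.continuousOn
  have hC0 : 0 ≤ C := (norm_nonneg _).trans (hC t₀ ⟨by linarith, by linarith⟩)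
  refine ⟨C + 1, by linarith, fun u hu => ?_⟩
  obtain ⟨hu1, hu2⟩ := abs_le.1 hu
  have hlip : ∀ s ∈ uIcc t₀ (t₀ + u), ‖deriv γ s - deriv γ t₀‖ ≤ C * |u| := by
    intro s hs
    have hsub : uIcc t₀ (t₀ + u) ⊆ Icc (t₀ - 1) (t₀ + 1) :=
      uIcc_subset_Icc ⟨by linarith, by linarith⟩ ⟨by linarith, by linarith⟩
    have h1 := (convex_Icc (t₀ - 1) (t₀ + 1)).norm_image_sub_le_of_norm_deriv_le
      (fun x _ => hd.differentiable one_ne_zero x) hC (left_mem_uIcc.elim fun a b => hsub ⟨a, b⟩) (hsub hs)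
    refine h1.trans ?_
    have h2 := abs_sub_left_of_mem_uIcc hs
    rw [add_sub_cancel_left] at h2
    rw [Real.norm_eq_abs]
    exact mul_le_mul_of_nonneg_left h2 hC0
  have h1 := (convex_uIcc t₀ (t₀ + u)).norm_image_sub_le_of_norm_hasDerivWithin_le
    (f := fun s => γ s - (s - t₀) * deriv γ t₀) (f' := fun s => deriv γ s - deriv γ t₀)
    (C := C * |u|) (x := t₀) (y := t₀ + u) (fun s _ => by
      have e1 := (hγ.differentiable (by norm_num) s).hasDerivAt
      have e2 : HasDerivAt (fun s : ℝ => ((s : ℂ) - t₀) * deriv γ t₀) (deriv γ t₀) s := by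
        have := ((Complex.ofRealCLM.hasDerivAt (x := s)).sub_const (t₀ : ℂ)).mul_const (deriv γ t₀)
        simpa using this
      exact (e1.fun_sub e2).hasDerivWithinAt) hlip left_mem_uIcc right_mem_uIcc
  have h2 : C * |u| * ‖t₀ + u - t₀‖ = C * u ^ 2 := by
    rw [add_sub_cancel_left, Real.norm_eq_abs, mul_assoc, abs_mul_abs_self, sq]
  rw [h2] at h1
  have h3 : γ (t₀ + u) - γ t₀ - u * deriv γ t₀ =
      γ (t₀ + u) - (((t₀ + u : ℝ) : ℂ) - t₀) * deriv γ t₀ - (γ t₀ - ((t₀ : ℂ) - t₀) * deriv γ t₀) := by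
    push_cast; ring
  rw [h3]
  refine h1.trans ?_
  nlinarith [sq_nonneg u]

namespace IsBoundaryChart

variable {Ω : Set ℂ} {γ : ℝ → ℂ} {t₀ σ δ : ℝ} {g : ℂ → ℂ}

/-- The unit normal at the base point, towards the upper half of the chart. -/
noncomputable def normal (γ : ℝ → ℂ) (t₀ σ : ℝ) : ℂ :=
  σ * (Complex.I * deriv γ t₀) / ‖deriv γ t₀‖

lemma norm_sign (C : IsBoundaryChart Ω γ t₀ σ δ g) : ‖(σ : ℂ)‖ = 1 := by
  rcases C.sign with h | h <;> simp [h]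

lemma norm_normal (C : IsBoundaryChart Ω γ t₀ σ δ g) (P : IsCurveParam (frontier Ω) γ) :
    ‖normal γ t₀ σ‖ = 1 := by
  have := norm_pos_iff.2 (P.deriv_ne t₀)
  rw [normal, norm_div, norm_mul, C.norm_sign, norm_mul, Complex.norm_I]
  simp [this.ne']

/-- The domain satisfies an interior ball condition at the boundary. -/
lemma exists_tangent_ball (C : IsBoundaryChart Ω γ t₀ σ δ g) (hΩ : IsOpen Ω)
    (P : IsCurveParam (frontier Ω) γ) :
    ∃ r : ℝ, 0 < r ∧ Metric.ball (γ t₀ + r * normal γ t₀ σ) r ⊆ Ω := by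
  set v := deriv γ t₀ with hv
  set n := normal γ t₀ σ with hn
  have hv0 : 0 < ‖v‖ := norm_pos_iff.2 (P.deriv_ne t₀)
  have hn1 : ‖n‖ = 1 := C.norm_normal P
  have hvn : (v * (starRingEnd ℂ) n).re = 0 := by
    have e1 : v * (starRingEnd ℂ) n = ((σ * ‖v‖ : ℝ) : ℂ) * (-Complex.I) := by
      have h1 : v * (starRingEnd ℂ) v = (‖v‖ : ℂ) ^ 2 := Complex.mul_conj' v
      have h2 : (‖v‖ : ℂ) ≠ 0 := by exact_mod_cast hv0.ne'
      rw [hn, normal]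
      simp only [map_div₀, map_mul, Complex.conj_ofReal, Complex.conj_I, ← hv]
      field_simp
      push_cast
      linear_combination (-(σ : ℂ)) * h1
    rw [e1, Complex.re_ofReal_mul]
    simp
  obtain ⟨K, hK, hT⟩ := exists_taylor_bound P.contDiff t₀
  have hgc : ContinuousAt g (γ t₀) := C.contDiffAt.continuousAt
  have hη : 0 < min δ (min 1 (‖v‖ / (2 * K))) :=
    lt_min C.pos (lt_min one_pos (by positivity))
  have h1 : ∀ᶠ z in 𝓝 (γ t₀), g z ∈ Metric.ball (0 : ℂ) (min δ (min 1 (‖v‖ / (2 * K)))) := by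
    refine hgc.eventually ?_
    rw [C.apply_base]
    exact Metric.ball_mem_nhds _ hη
  obtain ⟨ε, hε, hball⟩ := Metric.eventually_nhds_iff_ball.1 (h1.and C.right_inv)
  -- The bound `ε / 4` keeps the disc inside the coordinate neighbourhood. The other bound excludes
  -- frontier points: such a point `γ t₀ + y`, with parameter offset `u`, would satisfy `|y|² < 2r
  -- Re (y n̄) ≤ 2rK u² ≤ u²|v|²/8`, whereas `|y| ≥ |u||v|/2`.
  set r := min (ε / 4) (‖v‖ ^ 2 / (16 * K)) with hr
  have hr0 : 0 < r := lt_min (by positivity) (by positivity)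
  have hrε : r ≤ ε / 4 := min_le_left _ _
  have hrK : r ≤ ‖v‖ ^ 2 / (16 * K) := min_le_right _ _
  have hnear : ∀ z ∈ Metric.ball (γ t₀ + r * n) r, z ∈ Metric.ball (γ t₀) ε := by
    intro z hz
    rw [Metric.mem_ball] at hz ⊢
    have e1 : dist (γ t₀ + r * n) (γ t₀) = r := by
      rw [dist_eq_norm, add_sub_cancel_left, norm_mul, hn1, mul_one, Complex.norm_real,
        Real.norm_of_nonneg hr0.le]
    linarith [dist_triangle z (γ t₀ + r * n) (γ t₀)]
  refine ⟨r, hr0, (convex_ball _ _).isPreconnected.subset_of_disjoint_frontier hΩ ?_ ?_⟩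
  · intro z hz hzJ
    obtain ⟨hgz, hzg⟩ := hball z (hnear z hz)
    rw [mem_ball_zero_iff, lt_min_iff, lt_min_iff] at hgz
    have him := C.im_eq_zero (g z) (mem_ball_zero_iff.2 hgz.1) (by rw [hzg]; exact hzJ)
    rw [curveChart_real _ _ _ him] at hzg
    set u := σ * (g z).re with hu
    have hu_abs : |u| ≤ ‖g z‖ := by
      rw [hu, abs_mul, ← Real.norm_eq_abs σ, ← Complex.norm_real, C.norm_sign, one_mul]
      exact Complex.abs_re_le_norm _
    have hTu := hT u (hu_abs.trans hgz.2.1.le)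
    rw [hzg] at hTu
    set y := z - γ t₀ with hy
    have hyr : ‖y - r * n‖ < r := by
      rw [Metric.mem_ball, dist_eq_norm] at hz
      rwa [hy, sub_sub]
    have hsq : ‖y - r * n‖ ^ 2 = ‖y‖ ^ 2 - 2 * r * (y * (starRingEnd ℂ) n).re + r ^ 2 := by
      have e2 : ‖n‖ ^ 2 = 1 := by rw [hn1, one_pow]
      rw [Complex.sq_norm, Complex.normSq_apply] at e2
      simp only [Complex.sq_norm, Complex.normSq_apply, Complex.sub_re, Complex.sub_im, Complex.mul_re,
        Complex.mul_im, Complex.conj_re, Complex.conj_im, Complex.ofReal_re, Complex.ofReal_im]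
      linear_combination r ^ 2 * e2
    have hlt : ‖y‖ ^ 2 < 2 * r * (y * (starRingEnd ℂ) n).re := by
      have : ‖y - r * n‖ ^ 2 < r ^ 2 := pow_lt_pow_left₀ hyr (norm_nonneg _) two_ne_zero
      linarith
    have hre : (y * (starRingEnd ℂ) n).re ≤ K * u ^ 2 := by
      have e3 : (y * (starRingEnd ℂ) n).re = ((y - u * v) * (starRingEnd ℂ) n).re := by
        rw [sub_mul y (u * v), Complex.sub_re, mul_assoc, Complex.re_ofReal_mul, hvn, mul_zero, sub_zero]
      rw [e3]
      refine (Complex.re_le_norm _).trans ?_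
      rw [norm_mul, RCLike.norm_conj, hn1, mul_one]
      exact hTu
    have hylow : |u| * ‖v‖ / 2 ≤ ‖y‖ := by
      have e4 := norm_sub_norm_le (u * v) (u * v - y)
      rw [sub_sub_cancel, norm_sub_rev, norm_mul, Complex.norm_real, Real.norm_eq_abs] at e4
      have e5 : K * u ^ 2 ≤ |u| * ‖v‖ / 2 := by
        have e6 : |u| ≤ ‖v‖ / (2 * K) := hu_abs.trans hgz.2.2.le
        rw [le_div_iff₀ (by positivity)] at e6
        rw [← sq_abs]
        nlinarith [abs_nonneg u]
      linarith
    have hy2 : u ^ 2 * ‖v‖ ^ 2 / 4 ≤ ‖y‖ ^ 2 := by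
      have := pow_le_pow_left₀ (by positivity) hylow 2
      rw [div_pow, mul_pow, sq_abs] at this
      linarith
    have hrK' : r * (16 * K) ≤ ‖v‖ ^ 2 := (le_div_iff₀ (by positivity)).1 hrK
    have hfin : 2 * r * (y * (starRingEnd ℂ) n).re ≤ u ^ 2 * ‖v‖ ^ 2 / 8 := by
      have := mul_le_mul_of_nonneg_left hre (by positivity : 0 ≤ 2 * r)
      nlinarith [sq_nonneg u]
    nlinarith [mul_nonneg (sq_nonneg u) (sq_nonneg ‖v‖)]
  -- A short way up the normal lies on the imaginary axis of the chart, hence in `Ω`; so the disc,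
  -- which misses the frontier, is contained in `Ω`.
  · set s := min (r / 2) (δ * ‖v‖ / 2) with hs
    have hs0 : 0 < s := lt_min (by positivity) (by have := C.pos; positivity)
    refine ⟨γ t₀ + s * n, ?_, ?_⟩
    · have hsr : s ≤ r / 2 := min_le_left _ _
      rw [Metric.mem_ball, dist_eq_norm, add_sub_add_left_eq_sub, ← sub_mul, norm_mul, hn1, mul_one,
        ← Complex.ofReal_sub, Complex.norm_real, Real.norm_eq_abs, abs_of_nonpos (by linarith)]
      linarith
    · have e1 := C.upper (((s / ‖v‖ : ℝ) : ℂ) * Complex.I) (by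
        have hsd : s ≤ δ * ‖v‖ / 2 := min_le_right _ _
        rw [mem_ball_zero_iff, norm_mul, Complex.norm_I, mul_one, Complex.norm_real,
          Real.norm_of_nonneg (by positivity), div_lt_iff₀ hv0]
        have := mul_pos C.pos hv0
        linarith) (by
        rw [Complex.im_ofReal_mul, Complex.I_im, mul_one]
        positivity)
      convert e1 using 1
      simp [curveChart, hn, normal]
      ring

/-- **Hopf's boundary point lemma**: the normal derivative of the potential does not vanish. -/
theorem gradient_ne_zero (C : IsBoundaryChart Ω γ t₀ σ δ g) (P : IsCurveParam (frontier Ω) γ)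
    {N : ℂ → ℝ} {f h : ℂ → ℂ} {a : ℂ} (H : IsExteriorMap Ω N f h a) {w : ℂ}
    (hw : HasFDerivWithinAt N (gradForm w) (closure Ω) (γ t₀)) : w ≠ 0 := by
  rintro rfl
  obtain ⟨r, hr, hball⟩ := C.exists_tangent_ball H.isOpen P
  set n := normal γ t₀ σ with hn
  have hn1 : ‖n‖ = 1 := C.norm_normal P
  set c := γ t₀ + r * n with hc
  have hsc : ∀ s : ℝ, s ≤ r → dist (γ t₀ + s * n) c = r - s := by
    intro s hs
    rw [dist_eq_norm, hc, add_sub_add_left_eq_sub, ← sub_mul, norm_mul, hn1, mul_one,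
      ← Complex.ofReal_sub, Complex.norm_real, Real.norm_eq_abs, abs_of_nonpos (by linarith)]
    linarith
  have hlt : ∀ z ∈ Metric.ball c r, ‖h z‖ < 1 := fun z hz => (H.mapsTo (hball hz)).2
  set κ := (1 - ‖h c‖) / (1 + ‖h c‖) with hκ
  have hκ0 : 0 < κ := div_pos (sub_pos.2 (hlt c (Metric.mem_ball_self hr))) (by positivity)
  -- Schwarz–Pick in the tangent disc gives `1 - exp (2N) ≥ κ s / r` along the normal, and `exp x ≥
  -- 1 + x` turns this into linear decay of `N`.
  have key : ∀ s : ℝ, 0 < s → s < r → κ / r * s ≤ -2 * N (γ t₀ + s * n) ∧ γ t₀ + s * n ∈ Ω := by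
    intro s hs hsr
    have hmem : γ t₀ + s * n ∈ Metric.ball c r := by
      rw [Metric.mem_ball, hsc s hsr.le]
      linarith
    have h1 := one_sub_norm_sq_ge_of_mapsTo_ball hr (H.differentiableOn.mono hball) hlt hmem
    rw [hsc s hsr.le, H.norm _ (hball hmem), ← Real.exp_nat_mul, ← hκ] at h1
    have h2 := Real.add_one_le_exp (((2 : ℕ) : ℝ) * N (γ t₀ + s * n))
    have h3 : s / r ≤ 1 - ((r - s) / r) ^ 2 := by
      have h4 : (r - s) / r = 1 - s / r := by field_simp
      have h5 : s / r < 1 := (div_lt_one hr).2 hsr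
      have h6 : 0 < s / r := by positivity
      rw [h4]
      nlinarith
    have h7 := mul_le_mul_of_nonneg_right h3 hκ0.le
    push_cast at h1 h2
    refine ⟨?_, hball hmem⟩
    have h8 : κ / r * s = s / r * κ := by ring
    linarith
  have hp0 : N (γ t₀) = 0 := H.boundary _ (by rw [← P.range_eq]; exact ⟨t₀, rfl⟩)
  have h0 : HasFDerivWithinAt N (0 : ℂ →L[ℝ] ℝ) (closure Ω) (γ t₀) := by
    refine hw.congr_fderiv ?_
    ext v
    simp
  -- With the factor `1/4`, a vanishing differential gives `-2N ≤ κ s / (2r)`, which contradicts the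
  -- linear decay.
  have hlo := h0.isLittleO.def (show 0 < κ / r / 4 by positivity)
  have hlim : Tendsto (fun s : ℝ => γ t₀ + s * n) (𝓝[>] 0) (𝓝[closure Ω] (γ t₀)) := by
    refine tendsto_nhdsWithin_iff.2 ⟨?_, ?_⟩
    · have : Continuous (fun s : ℝ => γ t₀ + s * n) := by fun_prop
      simpa using (this.tendsto 0).mono_left nhdsWithin_le_nhds
    · filter_upwards [Ioo_mem_nhdsGT hr] with s hs
      exact subset_closure (key s hs.1 hs.2).2
  obtain ⟨s, hs1, hs2⟩ := ((hlim.eventually hlo).and (Ioo_mem_nhdsGT hr)).exists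
  have h9 := (key s hs2.1 hs2.2).1
  simp only [hp0, sub_zero, zero_apply, add_sub_cancel_left, norm_mul, hn1, mul_one,
    Complex.norm_real, Real.norm_eq_abs, abs_of_pos hs2.1] at hs1
  have h10 := (abs_le.1 hs1).1
  have : 0 < κ / r * s := by have := hs2.1; positivity
  linarith

/-- The domain lies on one side of its boundary. -/
theorem lower_notMem (C : IsBoundaryChart Ω γ t₀ σ δ g) (P : IsCurveParam (frontier Ω) γ)
    {N : ℂ → ℝ} {f h : ℂ → ℂ} {a : ℂ} (H : IsExteriorMap Ω N f h a) {w : ℂ}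
    (hw : HasFDerivWithinAt N (gradForm w) (closure Ω) (γ t₀)) :
    ∀ x ∈ Metric.ball (0 : ℂ) δ, x.im < 0 → curveChart γ t₀ σ x ∉ closure Ω := by
  refine C.lower.resolve_right fun hlow => ?_
  -- If both half-discs lay in `Ω`, then `γ t₀` would be interior to the closure and a local maximum
  -- of `N`; its gradient would vanish there, against Hopf's lemma.
  have hcl : closure Ω ∈ 𝓝 (γ t₀) := by
    have h1 : ∀ᶠ z in 𝓝 (γ t₀), g z ∈ Metric.ball (0 : ℂ) δ := by
      refine C.contDiffAt.continuousAt.eventually ?_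
      rw [C.apply_base]
      exact Metric.ball_mem_nhds _ C.pos
    filter_upwards [h1, C.right_inv] with z hz hzg
    rw [← hzg]
    rcases lt_trichotomy (g z).im 0 with hlt | heq | hgt
    · exact subset_closure (hlow _ hz hlt)
    · refine frontier_subset_closure ?_
      rw [curveChart_real _ _ _ heq, ← P.range_eq]
      exact ⟨_, rfl⟩
    · exact subset_closure (C.upper _ hz hgt)
  have hp0 : N (γ t₀) = 0 := H.boundary _ (by rw [← P.range_eq]; exact ⟨t₀, rfl⟩)
  have hmax : IsLocalMax N (γ t₀) := by
    filter_upwards [hcl] with z hz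
    rw [hp0]
    by_cases hz0 : N z = 0
    · exact hz0.le
    · exact (H.neg (H.mem_of_neg hz hz0)).le
  have h2 := hmax.hasFDerivAt_eq_zero (hw.hasFDerivAt hcl)
  refine C.gradient_ne_zero P H hw ?_
  have h3 := congrArg (fun L => L ((starRingEnd ℂ) w)) h2
  simp only [gradForm_apply, Complex.mul_conj, Complex.ofReal_re, zero_apply] at h3
  exact Complex.normSq_eq_zero.1 h3

end IsBoundaryChart

end Hopf

/-! ### Extension of the exterior map and its inverse to the closures. -/

section Extension

/-- An exterior map whose potential is continuously differentiable up to the boundary, which is a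
regular `C²` curve. -/
structure IsRegularExterior (Ω : Set ℂ) (γ : ℝ → ℂ) (N : ℂ → ℝ) (f h : ℂ → ℂ) (a : ℂ) : Prop
    extends IsExteriorMap Ω N f h a where
  param : IsCurveParam (frontier Ω) γ
  hasFDerivWithinAt : ∀ z ∈ closure Ω, HasFDerivWithinAt N (gradForm (f z)) (closure Ω) z
  continuousOn_gradient : ContinuousOn f (closure Ω)

/-- The closed unit disc without its centre. -/
def puncturedClosedDisc : Set ℂ := {w | w ≠ 0 ∧ ‖w‖ ≤ 1}

lemma puncturedDisc_subset : puncturedDisc ⊆ puncturedClosedDisc := fun _ h => ⟨h.1, h.2.le⟩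

lemma puncturedClosedDisc_subset_closure : puncturedClosedDisc ⊆ closure puncturedDisc := by
  intro w hw
  have hlim : Tendsto (fun s : ℝ => (s : ℂ) * w) (𝓝[<] 1) (𝓝 w) := by
    have : Continuous (fun s : ℝ => (s : ℂ) * w) := by fun_prop
    simpa using (this.tendsto 1).mono_left nhdsWithin_le_nhds
  refine mem_closure_of_tendsto hlim ?_
  filter_upwards [Ioo_mem_nhdsLT (show (0 : ℝ) < 1 by norm_num)] with s hs
  refine ⟨mul_ne_zero (by exact_mod_cast hs.1.ne') hw.1, ?_⟩
  rw [norm_mul, Complex.norm_real, Real.norm_of_nonneg hs.1.le]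
  nlinarith [hs.1, hs.2, hw.2, norm_nonneg w]

namespace IsRegularExterior

variable {Ω : Set ℂ} {γ : ℝ → ℂ} {N : ℂ → ℝ} {f h : ℂ → ℂ} {a : ℂ}

lemma mem_frontier_of_notMem (E : IsRegularExterior Ω γ N f h a) {z : ℂ} (hz : z ∈ closure Ω)
    (hn : z ∉ Ω) : z ∈ frontier Ω := by
  rw [E.isOpen.frontier_eq]
  exact ⟨hz, hn⟩

/-- In `Ω` this is the absence of critical points of the bijection `h`; on the boundary it is Hopf's
lemma. -/
lemma gradient_ne_zero (E : IsRegularExterior Ω γ N f h a) {z : ℂ} (hz : z ∈ closure Ω) :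
    f z ≠ 0 := by
  by_cases hzΩ : z ∈ Ω
  · obtain ⟨y, hy, hyz, hfy, huniq⟩ := E.existsUnique_preimage (E.mapsTo hzΩ)
    rwa [huniq z hzΩ rfl]
  · have hzJ := E.mem_frontier_of_notMem hz hzΩ
    rw [← E.param.range_eq] at hzJ
    obtain ⟨t, rfl⟩ := hzJ
    obtain ⟨σ, δ, g, C⟩ := exists_boundaryChart E.isOpen E.param t
    exact C.gradient_ne_zero E.param E.toIsExteriorMap (E.hasFDerivWithinAt _ hz)

/-- The derivative `f h` is bounded near the boundary point, so in the chart `h` is Lipschitz on a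
half-disc, which is convex, and therefore extends continuously. One-sidedness ensures that all
nearby points of `Ω` come from that half-disc. -/
lemma tendsto_map_frontier (E : IsRegularExterior Ω γ N f h a) (t : ℝ) :
    ∃ l, Tendsto h (𝓝[Ω] (γ t)) (𝓝 l) := by
  have hpJ : γ t ∈ frontier Ω := by rw [← E.param.range_eq]; exact ⟨t, rfl⟩
  have hp : γ t ∈ closure Ω := frontier_subset_closure hpJ
  obtain ⟨σ, δ, g, C⟩ := exists_boundaryChart E.isOpen E.param t
  have hlow := C.lower_notMem E.param E.toIsExteriorMap (E.hasFDerivWithinAt _ hp)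
  set e := curveChart γ t σ with he
  have hec : ContDiff ℝ 2 e := contDiff_curveChart E.param.contDiff t σ
  have he0 : e 0 = γ t := curveChart_zero γ t σ
  set M := ‖f (γ t)‖ + 1 with hM
  set M' := ‖fderiv ℝ e 0‖ + 1 with hM'
  have hfb : ∀ᶠ x in 𝓝 (0 : ℂ), e x ∈ closure Ω → ‖f (e x)‖ < M := by
    have h1 : ∀ᶠ z in 𝓝[closure Ω] (γ t), ‖f z‖ < M :=
      (E.continuousOn_gradient _ hp).norm.eventually_lt_const (lt_add_one _)
    rw [eventually_nhdsWithin_iff, ← he0] at h1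
    exact hec.continuous.continuousAt.eventually h1
  have hdb : ∀ᶠ x in 𝓝 (0 : ℂ), ‖fderiv ℝ e x‖ < M' :=
    (hec.continuous_fderiv two_ne_zero).norm.continuousAt.eventually_lt_const (lt_add_one _)
  obtain ⟨η, hη, hball⟩ := Metric.eventually_nhds_iff_ball.1
    ((hfb.and hdb).and (Metric.ball_mem_nhds (0 : ℂ) C.pos))
  set S : Set ℂ := Metric.ball 0 η ∩ {x | 0 < x.im} with hS
  have hconv : Convex ℝ S := (convex_ball _ _).inter (convex_halfSpace_im_gt 0)
  have hlip : LipschitzOnWith (M * M').toNNReal (h ∘ e) S := by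
    refine hconv.lipschitzOnWith_of_nnnorm_hasFDerivWithin_le (𝕜 := ℝ)
      (f' := fun x => (ContinuousLinearMap.mul ℝ ℂ (f (e x) * h (e x))) ∘L fderiv ℝ e x) ?_ ?_
    · intro x hx
      have hxΩ : e x ∈ Ω := C.upper x (hball x hx.1).2 hx.2
      have h1 : HasFDerivAt h (ContinuousLinearMap.mul ℝ ℂ (f (e x) * h (e x))) (e x) := by
        refine ((E.deriv _ hxΩ).hasFDerivAt.restrictScalars ℝ).congr_fderiv ?_
        ext v
        simp [mul_comm]
      exact (h1.comp x (hec.differentiable two_ne_zero x).hasFDerivAt).hasFDerivWithinAt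
    · intro x hx
      have hxΩ : e x ∈ Ω := C.upper x (hball x hx.1).2 hx.2
      rw [← NNReal.coe_le_coe, coe_nnnorm, Real.coe_toNNReal _ (by positivity)]
      refine (ContinuousLinearMap.opNorm_comp_le _ _).trans ?_
      refine mul_le_mul ?_ (hball x hx.1).1.2.le (norm_nonneg _) (by positivity)
      refine (ContinuousLinearMap.opNorm_mul_apply_le _ _ _).trans ?_
      rw [norm_mul]
      have h1 := (hball x hx.1).1.1 (subset_closure hxΩ)
      have h2 := (E.mapsTo hxΩ).2
      nlinarith [norm_nonneg (f (e x)), norm_nonneg (h (e x))]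
  obtain ⟨k, hk, hkS⟩ := hlip.extend_finite_dimension
  refine ⟨k 0, ?_⟩
  have hgc : ContinuousAt g (γ t) := C.contDiffAt.continuousAt
  have hg0 : Tendsto g (𝓝 (γ t)) (𝓝 0) := by
    have := hgc.tendsto
    rwa [C.apply_base] at this
  have h1 : Tendsto (fun z => k (g z)) (𝓝[Ω] (γ t)) (𝓝 (k 0)) :=
    (hk.continuous.tendsto 0).comp (hg0.mono_left nhdsWithin_le_nhds)
  refine h1.congr' ?_
  have h2 : ∀ᶠ z in 𝓝[Ω] (γ t), g z ∈ Metric.ball (0 : ℂ) η ∧ e (g z) = z :=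
    nhdsWithin_le_nhds ((hg0.eventually (Metric.ball_mem_nhds 0 hη)).and C.right_inv)
  filter_upwards [h2, self_mem_nhdsWithin] with z hz hzΩ
  have him : 0 < (g z).im := by
    rcases lt_trichotomy (g z).im 0 with hlt | heq | hgt
    · exact absurd (by rw [hz.2]; exact subset_closure hzΩ) (hlow _ (hball _ hz.1).2 hlt)
    · have h3 : z ∈ frontier Ω := by
        rw [← hz.2, he, curveChart_real _ _ _ heq, ← E.param.range_eq]
        exact ⟨_, rfl⟩
      rw [E.isOpen.frontier_eq] at h3
      exact absurd hzΩ h3.2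
    · exact hgt
  rw [← hkS ⟨hz.1, him⟩, Function.comp, hz.2]

lemma tendsto_map (E : IsRegularExterior Ω γ N f h a) {z : ℂ} (hz : z ∈ closure Ω) :
    ∃ l, Tendsto h (𝓝[Ω] z) (𝓝 l) := by
  by_cases hzΩ : z ∈ Ω
  · exact ⟨h z, (E.deriv z hzΩ).continuousAt.tendsto.mono_left nhdsWithin_le_nhds⟩
  · have hzJ := E.mem_frontier_of_notMem hz hzΩ
    rw [← E.param.range_eq] at hzJ
    obtain ⟨t, rfl⟩ := hzJ
    exact E.tendsto_map_frontier t

/-- The inverse of the exterior map. -/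
lemma exists_inverse (E : IsRegularExterior Ω γ N f h a) : ∃ G : ℂ → ℂ,
    (∀ ξ ∈ puncturedDisc, G ξ ∈ Ω ∧ h (G ξ) = ξ ∧ HasDerivAt G (f (G ξ) * ξ)⁻¹ ξ) ∧
      ∀ z ∈ Ω, G (h z) = z := by
  have hex : ∀ ξ : ℂ, ∃ z, ξ ∈ puncturedDisc →
      (z ∈ Ω ∧ h z = ξ ∧ ∀ z' ∈ Ω, h z' = ξ → z' = z) := by
    intro ξ
    by_cases hξ : ξ ∈ puncturedDisc
    · obtain ⟨z, hz, hzξ, -, hu⟩ := E.existsUnique_preimage hξ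
      exact ⟨z, fun _ => ⟨hz, hzξ, hu⟩⟩
    · exact ⟨0, fun h => absurd h hξ⟩
  choose G hG using hex
  refine ⟨G, fun ξ hξ => ⟨(hG ξ hξ).1, (hG ξ hξ).2.1, ?_⟩, fun z hz =>
    ((hG _ (E.mapsTo hz)).2.2 z hz rfl).symm⟩
  have hcont : ContinuousAt G ξ := by
    intro V hV
    obtain ⟨W, hWV, hWo, hW⟩ := mem_nhds_iff.1 hV
    have h1 := E.eventually_fiber_subset hξ hWo fun z hz hzξ => by
      rw [(hG ξ hξ).2.2 z hz hzξ]; exact hW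
    rw [mem_map]
    filter_upwards [h1, isOpen_puncturedDisc.mem_nhds hξ] with w hw hwD
    exact hWV (hw (G w) (hG w hwD).1 (hG w hwD).2.1)
  have h2 := E.deriv (G ξ) (hG ξ hξ).1
  rw [(hG ξ hξ).2.1] at h2
  refine HasDerivAt.of_local_left_inverse hcont h2
    (mul_ne_zero (E.gradient_ne_zero (subset_closure (hG ξ hξ).1)) hξ.1) ?_
  filter_upwards [isOpen_puncturedDisc.mem_nhds hξ] with w hw using (hG w hw).2.1

lemma exists_gradient_lower_bound (E : IsRegularExterior Ω γ N f h a) (ρ : ℝ) :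
    ∃ m > 0, ∀ z ∈ closure Ω, ‖z‖ ≤ ρ → m ≤ ‖f z‖ := by
  rcases (closure Ω ∩ Metric.closedBall 0 ρ).eq_empty_or_nonempty with he | hne
  · refine ⟨1, one_pos, fun z hz hzρ => ?_⟩
    have : z ∈ closure Ω ∩ Metric.closedBall 0 ρ := ⟨hz, mem_closedBall_zero_iff.2 hzρ⟩
    rw [he] at this
    exact absurd this (notMem_empty z)
  · obtain ⟨y, hy, hmin⟩ := (IsExteriorMap.isCompact_inter Ω ρ).exists_isMinOn hne
      (E.continuousOn_gradient.norm.mono inter_subset_left)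
    exact ⟨‖f y‖, norm_pos_iff.2 (E.gradient_ne_zero hy.1), fun z hz hzρ =>
      hmin ⟨hz, mem_closedBall_zero_iff.2 hzρ⟩⟩

/-- The derivative of `G` is `1 / (f (G ξ) ξ)`. Away from `ξ = 0` the values of `G` stay bounded, so
`f` is bounded below along them. Hence `G` is Lipschitz on the convex intersection of the unit disc
with a small disc about `ξ`. -/
lemma tendsto_inverse (E : IsRegularExterior Ω γ N f h a) {G : ℂ → ℂ}
    (hG : ∀ ξ ∈ puncturedDisc, G ξ ∈ Ω ∧ h (G ξ) = ξ ∧ HasDerivAt G (f (G ξ) * ξ)⁻¹ ξ) {ξ : ℂ}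
    (hξ : ξ ∈ puncturedClosedDisc) : ∃ p, Tendsto G (𝓝[puncturedDisc] ξ) (𝓝 p) := by
  have hξ0 : 0 < ‖ξ‖ := norm_pos_iff.2 hξ.1
  obtain ⟨ρ, hρ, hsmall⟩ := E.eventually_norm_lt (half_pos hξ0)
  obtain ⟨m, hm, hfm⟩ := E.exists_gradient_lower_bound ρ
  set S : Set ℂ := Metric.ball ξ (‖ξ‖ / 2) ∩ Metric.ball 0 1 with hS
  have hconv : Convex ℝ S := (convex_ball _ _).inter (convex_ball _ _)
  have hSD : ∀ w ∈ S, w ∈ puncturedDisc ∧ ‖ξ‖ / 2 < ‖w‖ := by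
    rintro w ⟨hw1, hw2⟩
    rw [Metric.mem_ball, dist_eq_norm] at hw1
    rw [mem_ball_zero_iff] at hw2
    have h1 : ‖ξ‖ / 2 < ‖w‖ := by
      have := norm_sub_norm_le ξ w
      rw [norm_sub_rev] at this
      linarith
    exact ⟨⟨norm_pos_iff.1 (by linarith), hw2⟩, h1⟩
  have hlip : LipschitzOnWith (m * (‖ξ‖ / 2))⁻¹.toNNReal G S := by
    refine hconv.lipschitzOnWith_of_nnnorm_hasDerivWithin_le
      (fun w hw => (hG w (hSD w hw).1).2.2.hasDerivWithinAt) fun w hw => ?_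
    obtain ⟨hwD, hwξ⟩ := hSD w hw
    rw [← NNReal.coe_le_coe, coe_nnnorm, Real.coe_toNNReal _ (by positivity), norm_inv, norm_mul]
    have h1 : ‖G w‖ ≤ ρ := by
      by_contra hlt
      have := (hsmall (G w) (not_le.1 hlt).le).2
      rw [(hG w hwD).2.1] at this
      linarith
    have h2 := hfm (G w) (subset_closure (hG w hwD).1) h1
    exact inv_anti₀ (by positivity) (mul_le_mul h2 hwξ.le (by positivity) (norm_nonneg _))
  obtain ⟨k, hk, hkS⟩ := hlip.extend_finite_dimension
  refine ⟨k ξ, ((hk.continuous.tendsto ξ).mono_left nhdsWithin_le_nhds).congr' ?_⟩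
  filter_upwards [nhdsWithin_le_nhds (Metric.ball_mem_nhds ξ (half_pos hξ0)), self_mem_nhdsWithin]
    with w hw hwD
  exact (hkS ⟨hw, mem_ball_zero_iff.2 hwD.2⟩).symm

/-- The exterior map and its inverse extend to homeomorphisms of the closures. -/
theorem exists_homeomorph (E : IsRegularExterior Ω γ N f h a) : ∃ G H : ℂ → ℂ,
    ContinuousOn G puncturedClosedDisc ∧ MapsTo G puncturedClosedDisc (closure Ω) ∧
    (∀ ξ ∈ puncturedDisc, G ξ ∈ Ω ∧ HasDerivAt G (f (G ξ) * ξ)⁻¹ ξ) ∧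
    (∀ z ∈ Ω, H z = h z) ∧ (∀ z ∈ closure Ω, ‖H z‖ = Real.exp (N z)) ∧
    (∀ ξ ∈ puncturedClosedDisc, H (G ξ) = ξ) ∧
    ∀ z ∈ closure Ω, H z ∈ puncturedClosedDisc ∧ G (H z) = z := by
  obtain ⟨G₀, hG₀, hG₀h⟩ := E.exists_inverse
  set G := extendFrom puncturedDisc G₀ with hG
  set H := extendFrom Ω h with hH
  have hcG : ContinuousOn G puncturedClosedDisc :=
    continuousOn_extendFrom puncturedClosedDisc_subset_closure fun ξ hξ => E.tendsto_inverse hG₀ hξ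
  have hcH : ContinuousOn H (closure Ω) :=
    continuousOn_extendFrom Subset.rfl fun z hz => E.tendsto_map hz
  have hGe : ∀ ξ ∈ puncturedDisc, G ξ = G₀ ξ := fun ξ hξ =>
    extendFrom_eq (subset_closure hξ)
      ((hG₀ ξ hξ).2.2.continuousAt.tendsto.mono_left nhdsWithin_le_nhds)
  have hHe : ∀ z ∈ Ω, H z = h z := fun z hz =>
    extendFrom_eq (subset_closure hz) ((E.deriv z hz).continuousAt.tendsto.mono_left nhdsWithin_le_nhds)
  have hmapG : MapsTo G puncturedClosedDisc (closure Ω) := by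
    intro ξ hξ
    have h1 := tendsto_extendFrom (E.tendsto_inverse hG₀ hξ)
    have : (𝓝[puncturedDisc] ξ).NeBot :=
      mem_closure_iff_nhdsWithin_neBot.1 (puncturedClosedDisc_subset_closure hξ)
    refine mem_closure_of_tendsto h1 ?_
    filter_upwards [self_mem_nhdsWithin] with w hw using (hG₀ w hw).1
  have hnorm : ∀ z ∈ closure Ω, ‖H z‖ = Real.exp (N z) := by
    intro z hz
    have : (𝓝[Ω] z).NeBot := mem_closure_iff_nhdsWithin_neBot.1 hz
    have h1 := (tendsto_extendFrom (E.tendsto_map hz)).norm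
    have h2 : Tendsto (fun w => Real.exp (N w)) (𝓝[Ω] z) (𝓝 (Real.exp (N z))) :=
      (Real.continuous_exp.tendsto _).comp
        ((E.continuousOn z hz).tendsto.mono_left (nhdsWithin_mono z subset_closure))
    refine tendsto_nhds_unique h1 (h2.congr' ?_)
    filter_upwards [self_mem_nhdsWithin] with w hw using (E.norm w hw).symm
  have hmapH : MapsTo H (closure Ω) puncturedClosedDisc := by
    intro z hz
    refine ⟨norm_pos_iff.1 (by rw [hnorm z hz]; exact Real.exp_pos _), ?_⟩
    rw [hnorm z hz, Real.exp_le_one_iff]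
    by_cases h0 : N z = 0
    · exact h0.le
    · exact (E.neg (E.mem_of_neg hz h0)).le
  refine ⟨G, H, hcG, hmapG, fun ξ hξ => ?_, hHe, hnorm, fun ξ hξ => ?_, fun z hz => ⟨hmapH hz, ?_⟩⟩
  · rw [hGe ξ hξ]
    refine ⟨(hG₀ ξ hξ).1, (hG₀ ξ hξ).2.2.congr_of_eventuallyEq ?_⟩
    filter_upwards [isOpen_puncturedDisc.mem_nhds hξ] with w hw using hGe w hw
  · have : (𝓝[puncturedDisc] ξ).NeBot :=
      mem_closure_iff_nhdsWithin_neBot.1 (puncturedClosedDisc_subset_closure hξ)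
    have h1 : Tendsto (fun w => H (G w)) (𝓝[puncturedDisc] ξ) (𝓝 (H (G ξ))) :=
      ((hcH.comp hcG hmapG) ξ hξ).tendsto.mono_left (nhdsWithin_mono ξ puncturedDisc_subset)
    refine tendsto_nhds_unique h1 ((tendsto_id.mono_left nhdsWithin_le_nhds).congr' ?_)
    filter_upwards [self_mem_nhdsWithin] with w hw
    rw [hGe w hw, hHe _ (hG₀ w hw).1, (hG₀ w hw).2.1, id]
  · have : (𝓝[Ω] z).NeBot := mem_closure_iff_nhdsWithin_neBot.1 hz
    have h1 : Tendsto (fun w => G (H w)) (𝓝[Ω] z) (𝓝 (G (H z))) :=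
      ((hcG.comp hcH hmapH) z hz).tendsto.mono_left (nhdsWithin_mono z subset_closure)
    refine tendsto_nhds_unique h1 ((tendsto_id.mono_left nhdsWithin_le_nhds).congr' ?_)
    filter_upwards [self_mem_nhdsWithin] with w hw
    rw [hHe w hw, hGe _ (E.mapsTo hw), hG₀h w hw, id]

end IsRegularExterior

end Extension

/-! ### The density on the disc and the parametrization of level curves. -/

section DiscParametrization

/-- Composition with the radial retraction onto the closed disc. The extension takes no new values,
so a zero-free function stays zero-free. -/
lemma exists_continuous_eqOn_closedBall {D : ℂ → ℂ}
    (hD : ContinuousOn D (Metric.closedBall 0 1)) : ∃ D' : ℂ → ℂ, Continuous D' ∧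
      EqOn D' D (Metric.closedBall 0 1) ∧ ∀ z, ∃ w ∈ Metric.closedBall (0 : ℂ) 1, D' z = D w := by
  set r : ℂ → ℂ := fun z => ((max 1 ‖z‖ : ℝ) : ℂ)⁻¹ * z with hr
  have hpos : ∀ z : ℂ, 0 < max 1 ‖z‖ := fun z => lt_of_lt_of_le one_pos (le_max_left _ _)
  have hrc : Continuous r := by
    refine Continuous.mul (Continuous.inv₀ (by fun_prop) fun z => ?_) continuous_id
    exact_mod_cast (hpos z).ne'
  have hrm : ∀ z, r z ∈ Metric.closedBall (0 : ℂ) 1 := by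
    intro z
    rw [mem_closedBall_zero_iff, hr, norm_mul, norm_inv, Complex.norm_real,
      Real.norm_of_nonneg (hpos z).le, inv_mul_le_one₀ (hpos z)]
    exact le_max_right _ _
  refine ⟨D ∘ r, hD.comp_continuous hrc hrm, fun z hz => ?_, fun z => ⟨r z, hrm z, rfl⟩⟩
  rw [mem_closedBall_zero_iff] at hz
  simp [hr, max_eq_left hz]

/-- A conformal parametrization `G` of the exterior domain by the punctured disc, with its inverse
`H`, both extended to the closures, and the density `D ξ = -ξ² G' ξ`. -/
structure IsDiscParam (Ω : Set ℂ) (N : ℂ → ℝ) (f G H D : ℂ → ℂ) : Prop where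
  continuousOn : ContinuousOn G puncturedClosedDisc
  mapsTo : MapsTo G puncturedClosedDisc (closure Ω)
  hasDerivAt : ∀ ξ ∈ puncturedDisc, HasDerivAt G (f (G ξ) * ξ)⁻¹ ξ
  norm_map : ∀ z ∈ closure Ω, ‖H z‖ = Real.exp (N z)
  left_inv : ∀ ξ ∈ puncturedClosedDisc, H (G ξ) = ξ
  right_inv : ∀ z ∈ closure Ω, H z ∈ puncturedClosedDisc ∧ G (H z) = z
  density_continuousOn : ContinuousOn D (Metric.closedBall 0 1)
  density_differentiableOn : DifferentiableOn ℂ D (Metric.ball 0 1)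
  density_ne_zero : ∀ ξ ∈ Metric.closedBall (0 : ℂ) 1, D ξ ≠ 0
  density_mul : ∀ ξ ∈ puncturedClosedDisc, D ξ * f (G ξ) = -ξ

/-- The point at issue is the origin. There `k ξ = ξ G ξ` has a removable singularity with value
`a`, and `-ξ² G' = k - ξ k'`; so the density is holomorphic at `0` with value `a ≠ 0`. On the
circle, continuity and nonvanishing come from those of `f`. -/
theorem IsRegularExterior.exists_discParam {Ω : Set ℂ} {γ : ℝ → ℂ} {N : ℂ → ℝ} {f h : ℂ → ℂ} {a : ℂ}
    (E : IsRegularExterior Ω γ N f h a) : ∃ G H D, IsDiscParam Ω N f G H D := by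
  obtain ⟨G, H, hG, hmap, hder, hHh, hnorm, hHG, hGH⟩ := E.exists_homeomorph
  have hhG : ∀ ξ ∈ puncturedDisc, h (G ξ) = ξ := fun ξ hξ => by
    rw [← hHh _ (hder ξ hξ).1, hHG ξ (puncturedDisc_subset hξ)]
  have hpd : puncturedDisc ∈ 𝓝[≠] (0 : ℂ) := by
    filter_upwards [self_mem_nhdsWithin, nhdsWithin_le_nhds (Metric.ball_mem_nhds (0 : ℂ) one_pos)]
      with ξ h1 h2
    exact ⟨h1, mem_ball_zero_iff.1 h2⟩
  have hinf : Tendsto G (𝓝[≠] 0) (Bornology.cobounded ℂ) := by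
    rw [← tendsto_norm_atTop_iff_cobounded, tendsto_atTop]
    intro R
    obtain ⟨m, hm⟩ := (IsExteriorMap.isCompact_inter Ω R).exists_bound_of_continuousOn
      (E.continuousOn.mono inter_subset_left)
    filter_upwards [hpd, nhdsWithin_le_nhds (Metric.ball_mem_nhds (0 : ℂ) (Real.exp_pos (-m)))]
      with ξ hξ hξm
    by_contra hlt
    have hGΩ := (hder ξ hξ).1
    have h1 := hm (G ξ) ⟨subset_closure hGΩ, mem_closedBall_zero_iff.2 (not_le.1 hlt).le⟩
    rw [mem_ball_zero_iff, ← hhG ξ hξ, E.norm _ hGΩ, Real.exp_lt_exp] at hξm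
    rw [Real.norm_eq_abs] at h1
    linarith [(abs_le.1 h1).1]
  set k : ℂ → ℂ := Function.update (fun ξ => ξ * G ξ) 0 a with hk
  have hk0 : k 0 = a := by simp [hk]
  have hkne : ∀ ξ, ξ ≠ 0 → k ξ = ξ * G ξ := fun ξ hξ => by simp [hk, hξ]
  have hkc : ContinuousAt k 0 := by
    rw [continuousAt_iff_punctured_nhds, hk0]
    refine (E.infinity.comp hinf).congr' ?_
    filter_upwards [hpd] with ξ hξ
    rw [hkne ξ hξ.1, Function.comp, hhG ξ hξ, mul_comm]
  have hkd' : ∀ ξ ∈ puncturedDisc, HasDerivAt k (G ξ + ξ * (f (G ξ) * ξ)⁻¹) ξ := by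
    intro ξ hξ
    have h1 := (hasDerivAt_id ξ).fun_mul (hder ξ hξ).2
    simp only [id, one_mul] at h1
    refine h1.congr_of_eventuallyEq ?_
    filter_upwards [isOpen_ne.mem_nhds hξ.1] with w hw using hkne w hw
  have hkd : DifferentiableOn ℂ k (Metric.ball 0 1) := by
    refine (Complex.differentiableOn_compl_singleton_and_continuousAt_iff
      (Metric.ball_mem_nhds (0 : ℂ) one_pos)).1 ⟨fun ξ hξ => ?_, hkc⟩
    exact (hkd' ξ ⟨hξ.2, mem_ball_zero_iff.1 hξ.1⟩).differentiableAt.differentiableWithinAt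
  have hk'd : DifferentiableOn ℂ (deriv k) (Metric.ball 0 1) := hkd.deriv Metric.isOpen_ball
  set D : ℂ → ℂ := Function.update (fun ξ => -ξ / f (G ξ)) 0 a with hD
  have hD0 : D 0 = a := by simp [hD]
  have hDne : ∀ ξ, ξ ≠ 0 → D ξ = -ξ / f (G ξ) := fun ξ hξ => by simp [hD, hξ]
  have hfne : ∀ ξ ∈ puncturedClosedDisc, f (G ξ) ≠ 0 := fun ξ hξ => E.gradient_ne_zero (hmap hξ)
  have hDk : EqOn D (fun ξ => k ξ - ξ * deriv k ξ) (Metric.ball 0 1) := by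
    intro ξ hξ
    by_cases h0 : ξ = 0
    · simp [h0, hD0, hk0]
    have hξ' : ξ ∈ puncturedDisc := ⟨h0, mem_ball_zero_iff.1 hξ⟩
    have h2 := hfne ξ (puncturedDisc_subset hξ')
    simp only [(hkd' ξ hξ').deriv, hkne ξ h0, hDne ξ h0]
    field_simp
    ring
  have hDd : DifferentiableOn ℂ D (Metric.ball 0 1) :=
    (hkd.sub (differentiableOn_id.mul hk'd)).congr hDk
  have hfG : ContinuousOn (fun ξ => f (G ξ)) puncturedClosedDisc := E.continuousOn_gradient.comp hG hmap
  have hDc : ContinuousOn D (Metric.closedBall 0 1) := by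
    intro ξ hξ
    by_cases h0 : ξ = 0
    · rw [h0]
      exact (hDd.differentiableAt (Metric.ball_mem_nhds 0 one_pos)).continuousAt.continuousWithinAt
    have hξ' : ξ ∈ puncturedClosedDisc := ⟨h0, mem_closedBall_zero_iff.1 hξ⟩
    have h1 : ContinuousWithinAt (fun ξ => -ξ / f (G ξ)) puncturedClosedDisc ξ :=
      continuousWithinAt_id.neg.div (hfG ξ hξ') (hfne ξ hξ')
    have h2 : ContinuousWithinAt D puncturedClosedDisc ξ :=
      h1.congr (fun w hw => hDne w hw.1) (hDne ξ h0)
    refine h2.mono_of_mem_nhdsWithin ?_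
    filter_upwards [self_mem_nhdsWithin, nhdsWithin_le_nhds (isOpen_ne.mem_nhds h0)] with w h3 h4
    exact ⟨h4, mem_closedBall_zero_iff.1 h3⟩
  refine ⟨G, H, D, hG, hmap, fun ξ hξ => (hder ξ hξ).2, hnorm, hHG, hGH, hDc, hDd, fun ξ hξ => ?_,
    fun ξ hξ => ?_⟩
  · by_cases h0 : ξ = 0
    · rw [h0, hD0]
      exact E.ne_zero
    · rw [hDne ξ h0]
      exact div_ne_zero (neg_ne_zero.2 h0) (hfne ξ ⟨h0, mem_closedBall_zero_iff.1 hξ⟩)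
  · rw [hDne ξ hξ.1, div_mul_cancel₀ _ (hfne ξ hξ)]

namespace IsDiscParam

variable {Ω : Set ℂ} {N : ℂ → ℝ} {f G H D : ℂ → ℂ}

lemma circleMap_mem {ρ : ℝ} (h0 : 0 < ρ) (h1 : ρ ≤ 1) (θ : ℝ) :
    circleMap 0 ρ θ ∈ puncturedClosedDisc :=
  ⟨circleMap_ne_center h0.ne', by rw [norm_circleMap_zero, abs_of_pos h0]; exact h1⟩

/-- The parametrization of the level curve `N = log ρ`. -/
noncomputable def levelCurve (G : ℂ → ℂ) (ρ θ : ℝ) : ℂ := G (circleMap 0 ρ θ)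

lemma injOn_levelCurve (X : IsDiscParam Ω N f G H D) {ρ : ℝ} (h0 : 0 < ρ) (h1 : ρ ≤ 1) :
    InjOn (levelCurve G ρ) (Ico 0 (2 * Real.pi)) := by
  intro s hs t ht hst
  have h2 := congrArg H hst
  rw [levelCurve, levelCurve, X.left_inv _ (circleMap_mem h0 h1 s),
    X.left_inv _ (circleMap_mem h0 h1 t)] at h2
  refine eq_of_circleMap_eq h0.ne' ?_ h2
  rw [abs_lt]
  constructor <;> linarith [hs.1, hs.2, ht.1, ht.2]

lemma apply_eq (X : IsDiscParam Ω N f G H D) {ξ : ℂ} (hξ : ξ ∈ puncturedClosedDisc) :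
    N (G ξ) = Real.log ‖ξ‖ := by
  have h1 := X.norm_map _ (X.mapsTo hξ)
  rw [X.left_inv ξ hξ] at h1
  rw [h1, Real.log_exp]

lemma image_levelCurve (X : IsDiscParam Ω N f G H D) {ρ : ℝ} (h0 : 0 < ρ) (h1 : ρ ≤ 1) :
    levelCurve G ρ '' Ico 0 (2 * Real.pi) = {z ∈ closure Ω | N z = Real.log ρ} := by
  ext z
  constructor
  · rintro ⟨θ, -, rfl⟩
    have h2 := circleMap_mem h0 h1 θ
    refine ⟨X.mapsTo h2, ?_⟩
    rw [levelCurve, X.apply_eq h2, norm_circleMap_zero, abs_of_pos h0]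
  · rintro ⟨hz, hzN⟩
    have h2 : H z ∈ range (circleMap 0 ρ) := by
      rw [range_circleMap, mem_sphere_zero_iff_norm, X.norm_map z hz, hzN, Real.exp_log h0,
        abs_of_pos h0]
    obtain ⟨θ, hθ⟩ := h2
    obtain ⟨y, hy, hyθ⟩ := (periodic_circleMap 0 ρ).exists_mem_Ico₀ Real.two_pi_pos θ
    refine ⟨y, hy, ?_⟩
    rw [levelCurve, ← hyθ, hθ, (X.right_inv z hz).2]

lemma hasDerivAt_levelCurve_of_lt (X : IsDiscParam Ω N f G H D) {ρ : ℝ} (h0 : 0 < ρ) (h1 : ρ < 1)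
    (θ : ℝ) : HasDerivAt (levelCurve G ρ)
      (-Complex.I * D (circleMap 0 ρ θ) / circleMap 0 ρ θ) θ := by
  have hmem := circleMap_mem h0 h1.le θ
  have hξ : circleMap 0 ρ θ ∈ puncturedDisc :=
    ⟨hmem.1, by rw [norm_circleMap_zero, abs_of_pos h0]; exact h1⟩
  have h2 := (X.hasDerivAt _ hξ).comp θ (hasDerivAt_circleMap 0 ρ θ)
  refine h2.congr_deriv ?_
  have h3 := X.density_mul _ hmem
  have h4 : f (G (circleMap 0 ρ θ)) ≠ 0 := by
    intro h
    rw [h, mul_zero] at h3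
    exact hmem.1 (neg_eq_zero.1 h3.symm)
  have h5 := hmem.1
  field_simp
  linear_combination h3

-- Only `ρ = 1` needs work, since `G` has no given derivative on the circle. The formula for `ρ <
-- 1`, integrated along an arc, passes to the limit `ρ → 1`, and the fundamental theorem of calculus
-- recovers the derivative.
set_option maxHeartbeats 1000000 in
theorem hasDerivAt_levelCurve (X : IsDiscParam Ω N f G H D) {ρ : ℝ} (h0 : 0 < ρ) (h1 : ρ ≤ 1)
    (θ : ℝ) : HasDerivAt (levelCurve G ρ)
      (-Complex.I * D (circleMap 0 ρ θ) / circleMap 0 ρ θ) θ := by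
  rcases h1.lt_or_eq with hlt | rfl
  · exact X.hasDerivAt_levelCurve_of_lt h0 hlt θ
  obtain ⟨D', hD', hDD', -⟩ := exists_continuous_eqOn_closedBall X.density_continuousOn
  have hcm : Continuous fun p : ℝ × ℝ => circleMap 0 p.1 p.2 := by
    unfold circleMap
    fun_prop
  -- Multiplication by `ρ` puts the unit circle in the denominator; with the globally continuous
  -- `D'` this makes `F` jointly continuous for all real `ρ`.
  set F : ℝ → ℝ → ℂ := fun ρ t => -Complex.I * D' (circleMap 0 ρ t) / circleMap 0 1 t with hF
  have hF2 : Continuous (Function.uncurry F) := by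
    refine Continuous.div ((continuous_const).mul (hD'.comp hcm))
      ((continuous_circleMap 0 1).comp continuous_snd) fun p => circleMap_ne_center one_ne_zero
  have hF1 : ∀ ρ, Continuous (F ρ) := fun ρ => hF2.comp (by fun_prop : Continuous fun t => (ρ, t))
  have hmem : ∀ ρ : ℝ, 0 < ρ → ρ ≤ 1 → ∀ t, circleMap 0 ρ t ∈ Metric.closedBall (0 : ℂ) 1 :=
    fun ρ h0 h1 t => mem_closedBall_zero_iff.2 (circleMap_mem h0 h1 t).2
  have key : ∀ ρ : ℝ, 0 < ρ → ρ < 1 → ∀ s : ℝ,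
      (ρ : ℂ) * (levelCurve G ρ s - levelCurve G ρ 0) = ∫ t in (0 : ℝ)..s, F ρ t := by
    intro ρ hρ hρ1 s
    have h2 : ∀ t ∈ uIcc 0 s, HasDerivAt (fun t => (ρ : ℂ) * levelCurve G ρ t) (F ρ t) t := by
      intro t _
      refine ((X.hasDerivAt_levelCurve_of_lt hρ hρ1 t).const_mul (ρ : ℂ)).congr_deriv ?_
      have h3 : circleMap 0 ρ t = ρ * circleMap 0 1 t := by simp [circleMap]
      have h4 : circleMap 0 1 t ≠ 0 := circleMap_ne_center one_ne_zero
      have h5 : (ρ : ℂ) ≠ 0 := by exact_mod_cast hρ.ne'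
      simp only [hF]
      rw [hDD' (hmem ρ hρ hρ1.le t)]
      conv_lhs => rw [mul_div_assoc']; arg 2; rw [h3]
      field_simp
    rw [intervalIntegral.integral_eq_sub_of_hasDerivAt h2 ((hF1 ρ).intervalIntegrable _ _)]
    ring
  have key1 : ∀ s : ℝ, levelCurve G 1 s = levelCurve G 1 0 + ∫ t in (0 : ℝ)..s, F 1 t := by
    intro s
    have hlim : ∀ t : ℝ, Tendsto (fun ρ => levelCurve G ρ t) (𝓝[<] 1) (𝓝 (levelCurve G 1 t)) := by
      intro t
      refine (X.continuousOn _ (circleMap_mem one_pos le_rfl t)).tendsto.comp ?_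
      refine tendsto_nhdsWithin_iff.2 ⟨?_, ?_⟩
      · exact ((hcm.comp (by fun_prop : Continuous fun ρ : ℝ => (ρ, t))).tendsto 1).mono_left
          nhdsWithin_le_nhds
      · filter_upwards [Ioo_mem_nhdsLT (show (0 : ℝ) < 1 by norm_num)] with ρ hρ
        exact circleMap_mem hρ.1 hρ.2.le t
    have hl1 : Tendsto (fun ρ : ℝ => (ρ : ℂ) * (levelCurve G ρ s - levelCurve G ρ 0)) (𝓝[<] 1)
        (𝓝 (((1 : ℝ) : ℂ) * (levelCurve G 1 s - levelCurve G 1 0))) :=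
      ((Complex.continuous_ofReal.tendsto 1).mono_left nhdsWithin_le_nhds).mul
        ((hlim s).sub (hlim 0))
    have hl2 : Tendsto (fun ρ : ℝ => ∫ t in (0 : ℝ)..s, F ρ t) (𝓝[<] 1)
        (𝓝 (∫ t in (0 : ℝ)..s, F 1 t)) :=
      ((intervalIntegral.continuous_parametric_intervalIntegral_of_continuous' hF2 0 s).tendsto
        1).mono_left nhdsWithin_le_nhds
    have h2 := tendsto_nhds_unique hl1 (hl2.congr' (by
      filter_upwards [Ioo_mem_nhdsLT (show (0 : ℝ) < 1 by norm_num)] with ρ hρ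
      exact (key ρ hρ.1 hρ.2 s).symm))
    rw [← h2]
    push_cast
    ring
  have h2 : HasDerivAt (fun s => levelCurve G 1 0 + ∫ t in (0 : ℝ)..s, F 1 t) (F 1 θ) θ :=
    (intervalIntegral.integral_hasDerivAt_right ((hF1 1).intervalIntegrable _ _)
      ((hF1 1).stronglyMeasurableAtFilter _ _) (hF1 1).continuousAt).const_add _
  refine (h2.congr_of_eventuallyEq (Eventually.of_forall key1)).congr_deriv ?_
  simp only [hF]
  rw [hDD' (hmem 1 one_pos le_rfl θ)]

lemma contDiff_levelCurve (X : IsDiscParam Ω N f G H D) {ρ : ℝ} (h0 : 0 < ρ) (h1 : ρ ≤ 1) :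
    ContDiff ℝ 1 (levelCurve G ρ) := by
  rw [contDiff_one_iff_deriv]
  refine ⟨fun θ => (X.hasDerivAt_levelCurve h0 h1 θ).differentiableAt, ?_⟩
  rw [show deriv (levelCurve G ρ) = fun θ => -Complex.I * D (circleMap 0 ρ θ) / circleMap 0 ρ θ from
    funext fun θ => (X.hasDerivAt_levelCurve h0 h1 θ).deriv]
  refine Continuous.div (continuous_const.mul (X.density_continuousOn.comp_continuous
    (continuous_circleMap 0 ρ) fun θ => ?_)) (continuous_circleMap 0 ρ) fun θ => (circleMap_mem h0 h1 θ).1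
  exact mem_closedBall_zero_iff.2 (circleMap_mem h0 h1 θ).2

end IsDiscParam

end DiscParametrization

/-! ### Regularity of the argument of the density on the circle. -/

section Argument

/-- A continuous logarithm is locally given by the principal branch. -/
lemma eventually_eq_log_div {X : Type*} [TopologicalSpace X] {u : X → ℂ} {x : X}
    (hu : ContinuousAt u x) :
    ∀ᶠ y in 𝓝 x, u y = Complex.log (Complex.exp (u y) / Complex.exp (u x)) + u x := by
  have h1 : ∀ᶠ y in 𝓝 x, ‖u y - u x‖ < Real.pi := by
    have h2 : Tendsto (fun y => ‖u y - u x‖) (𝓝 x) (𝓝 ‖u x - u x‖) := (hu.sub continuousAt_const).norm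
    rw [sub_self, norm_zero] at h2
    exact h2.eventually_lt_const Real.pi_pos
  filter_upwards [h1] with y hy
  have h3 := (Complex.abs_im_le_norm (u y - u x)).trans_lt hy
  rw [abs_lt] at h3
  rw [← Complex.exp_sub, Complex.log_exp h3.1 h3.2.le, sub_add_cancel]

lemma ContDiffAt.of_exp {u : ℝ → ℂ} {x : ℝ} (hu : ContinuousAt u x)
    (h : ContDiffAt ℝ 1 (fun y => Complex.exp (u y)) x) : ContDiffAt ℝ 1 u x := by
  have h1 : ContDiffAt ℝ 1 (fun y => Complex.exp (u y) / Complex.exp (u x)) x :=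
    h.div_const _
  have h2 : ContDiffAt ℝ 1 Complex.log (Complex.exp (u x) / Complex.exp (u x)) := by
    rw [div_self (Complex.exp_ne_zero _)]
    exact (Complex.contDiffAt_log Complex.one_mem_slitPlane).restrict_scalars ℝ
  have h3 : ContDiffAt ℝ 1 (fun y => Complex.log (Complex.exp (u y) / Complex.exp (u x)) + u x) x :=
    (ContDiffAt.comp x h2 h1).add contDiffAt_const
  exact h3.congr_of_eventuallyEq (eventually_eq_log_div hu)

lemma DifferentiableAt.of_exp {u : ℂ → ℂ} {x : ℂ} (hu : ContinuousAt u x)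
    (h : DifferentiableAt ℂ (fun y => Complex.exp (u y)) x) : DifferentiableAt ℂ u x := by
  have h1 : DifferentiableAt ℂ (fun y => Complex.exp (u y) / Complex.exp (u x)) x :=
    h.div_const _
  have h3 : DifferentiableAt ℂ (fun y => Complex.log (Complex.exp (u y) / Complex.exp (u x)) + u x) x :=
    (h1.clog (by rw [div_self (Complex.exp_ne_zero _)]; exact Complex.one_mem_slitPlane)).add_const _
  exact h3.congr_of_eventuallyEq (eventually_eq_log_div hu)

/-- A continuous logarithm exists because the plane is simply connected and the continuous extension
of `D` has no zeros; it is holomorphic where `D` is. -/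
lemma exists_log_closedBall {D : ℂ → ℂ} (hD : ContinuousOn D (Metric.closedBall 0 1))
    (hd : DifferentiableOn ℂ D (Metric.ball 0 1)) (hne : ∀ ξ ∈ Metric.closedBall (0 : ℂ) 1, D ξ ≠ 0) :
    ∃ l : ℂ → ℂ, Continuous l ∧ DifferentiableOn ℂ l (Metric.ball 0 1) ∧
      ∀ ξ ∈ Metric.closedBall (0 : ℂ) 1, Complex.exp (l ξ) = D ξ := by
  obtain ⟨D', hD', hDD', hran⟩ := exists_continuous_eqOn_closedBall hD
  have hsc : IsSimplyConnected (univ : Set ℂ) := by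
    have : ContractibleSpace (univ : Set ℂ) := convex_univ.contractibleSpace ⟨0, mem_univ _⟩
    exact (inferInstance : SimplyConnectedSpace (univ : Set ℂ))
  obtain ⟨l, hl, hexp⟩ := Complex.exists_continuousOn_eqOn_exp_comp hsc isOpen_univ hD'.continuousOn (by
    rintro ⟨z, -, hz⟩
    obtain ⟨w, hw, hzw⟩ := hran z
    exact hne w hw (by rw [← hzw, hz]))
  have hlc : Continuous l := continuousOn_univ.1 hl
  have hexp' : ∀ ξ ∈ Metric.closedBall (0 : ℂ) 1, Complex.exp (l ξ) = D ξ := fun ξ hξ =>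
    (hexp (mem_univ ξ)).trans (hDD' hξ)
  refine ⟨l, hlc, fun ξ hξ => ?_, hexp'⟩
  refine (DifferentiableAt.of_exp hlc.continuousAt ?_).differentiableWithinAt
  refine (hd.differentiableAt (Metric.isOpen_ball.mem_nhds hξ)).congr_of_eventuallyEq ?_
  filter_upwards [Metric.isOpen_ball.mem_nhds hξ] with w hw
    using hexp' w (Metric.ball_subset_closedBall hw)

variable {Ω : Set ℂ} {γ : ℝ → ℂ} {N : ℂ → ℝ} {f h G H D : ℂ → ℂ} {a : ℂ}

/-- The gradient is normal to the boundary. -/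
lemma IsRegularExterior.re_gradient_mul_deriv (E : IsRegularExterior Ω γ N f h a) (t : ℝ) :
    (f (γ t) * deriv γ t).re = 0 := by
  have hJ : ∀ s, γ s ∈ frontier Ω := fun s => by rw [← E.param.range_eq]; exact ⟨s, rfl⟩
  have h1 : HasDerivAt γ (deriv γ t) t := (E.param.contDiff.differentiable two_ne_zero t).hasDerivAt
  have h2 := (E.hasFDerivWithinAt _ (frontier_subset_closure (hJ t))).comp_hasDerivWithinAt t
    (h1.hasDerivWithinAt (s := univ)) fun s _ => frontier_subset_closure (hJ s)
  rw [hasDerivWithinAt_univ] at h2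
  have h3 : HasDerivAt (N ∘ γ) 0 t :=
    (hasDerivAt_const t (0 : ℝ)).congr_of_eventuallyEq
      (Eventually.of_forall fun s => E.boundary _ (hJ s))
  exact h2.unique h3

/-- The square of the phase of the density is continuously differentiable on the circle. -/
lemma IsDiscParam.contDiff_phase (X : IsDiscParam Ω N f G H D) (E : IsRegularExterior Ω γ N f h a) :
    ContDiff ℝ 1 (fun θ => D (circleMap 0 1 θ) / (starRingEnd ℂ) (D (circleMap 0 1 θ))) := by
  rw [contDiff_iff_contDiffAt]
  intro θ
  have hmemc : ∀ s, levelCurve G 1 s ∈ closure Ω := fun s => X.mapsTo (circleMap_mem one_pos le_rfl s)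
  have hmem : ∀ s, levelCurve G 1 s ∈ frontier Ω := by
    intro s
    refine E.mem_frontier_of_notMem (hmemc s) fun hs => (E.neg hs).ne ?_
    rw [levelCurve, X.apply_eq (circleMap_mem one_pos le_rfl s), norm_circleMap_zero, abs_one,
      Real.log_one]
  have hΓ : ContDiff ℝ 1 (levelCurve G 1) := X.contDiff_levelCurve one_pos le_rfl
  obtain ⟨t, ht⟩ : levelCurve G 1 θ ∈ range γ := by rw [E.param.range_eq]; exact hmem θ
  obtain ⟨σ, δ, g, C⟩ := exists_boundaryChart E.isOpen E.param t
  have hg : ContDiffAt ℝ 1 g (levelCurve G 1 θ) := ht ▸ C.contDiffAt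
  have hgΓ : ContDiffAt ℝ 1 (fun s => g (levelCurve G 1 s)) θ := hg.comp θ hΓ.contDiffAt
  -- The parameter on `γ` of the boundary point `levelCurve G 1 s`, read off from the chart. It is
  -- `C¹` because the chart and the level curve are.
  set τ : ℝ → ℝ := fun s => t + σ * (g (levelCurve G 1 s)).re with hτ
  have hτc : ContDiffAt ℝ 1 τ θ :=
    contDiffAt_const.add (contDiffAt_const.mul ((Complex.reCLM.contDiff.contDiffAt).comp θ hgΓ))
  have hγτ : ∀ᶠ s in 𝓝 θ, γ (τ s) = levelCurve G 1 s := by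
    have h1 : ∀ᶠ s in 𝓝 θ, g (levelCurve G 1 s) ∈ Metric.ball (0 : ℂ) δ := by
      refine hgΓ.continuousAt.eventually ?_
      change ∀ᶠ y in 𝓝 (g (levelCurve G 1 θ)), _
      rw [← ht, C.apply_base]
      exact Metric.ball_mem_nhds _ C.pos
    have h2 : ∀ᶠ s in 𝓝 θ, curveChart γ t σ (g (levelCurve G 1 s)) = levelCurve G 1 s := by
      have h3 := C.right_inv
      rw [ht] at h3
      exact hΓ.continuous.continuousAt.eventually h3
    filter_upwards [h1, h2] with s hs1 hs2
    have him := C.im_eq_zero _ hs1 (by rw [hs2]; exact hmem s)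
    rw [curveChart_real _ _ _ him] at hs2
    exact hs2
  have hd : ContDiff ℝ 1 (deriv γ) := ((contDiff_succ_iff_deriv (n := 1)).1 E.param.contDiff).2.2
  have hdτ : ContDiffAt ℝ 1 (fun s => deriv γ (τ s)) θ := hd.contDiffAt.comp θ hτc
  have hdτ' : ContDiffAt ℝ 1 (fun s => (starRingEnd ℂ) (deriv γ (τ s))) θ :=
    (Complex.conjCLE.contDiff.contDiffAt).comp θ hdτ
  have hξ : ContDiffAt ℝ 1 (fun s => (circleMap 0 1 s) ^ 2) θ := ((contDiff_circleMap 0 1).pow 2).contDiffAt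
  -- As `N` is constant on the boundary, `f γ'` is purely imaginary. Together with `D f = -ξ` and
  -- `|ξ| = 1` this gives `D / conj D = -ξ² γ' / conj γ'`, in which the modulus of `f` has
  -- disappeared.
  have hall : ContDiffAt ℝ 1
      (fun s => -((circleMap 0 1 s) ^ 2 * deriv γ (τ s)) * ((starRingEnd ℂ) (deriv γ (τ s)))⁻¹) θ := by
    refine ((hξ.mul hdτ).neg).mul (hdτ'.inv ?_)
    simpa using E.param.deriv_ne (τ θ)
  refine hall.congr_of_eventuallyEq ?_
  filter_upwards [hγτ] with s hs
  have hmc := circleMap_mem one_pos le_rfl s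
  have h1 := X.density_mul _ hmc
  have h2 := E.re_gradient_mul_deriv (τ s)
  rw [hs] at h2
  change (f (G (circleMap 0 1 s)) * _).re = 0 at h2
  set ξ := circleMap 0 1 s with hξdef
  set w := f (G ξ) with hw
  set v := deriv γ (τ s) with hv
  have hw0 : w ≠ 0 := E.gradient_ne_zero (hmemc s)
  have hv0 : v ≠ 0 := E.param.deriv_ne _
  have hwv : (starRingEnd ℂ) w * (starRingEnd ℂ) v = -(w * v) := by
    rw [← map_mul]
    refine Complex.ext ?_ ?_
    · rw [Complex.conj_re, Complex.neg_re, h2, neg_zero]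
    · rw [Complex.conj_im, Complex.neg_im]
  have hξ1 : ξ * (starRingEnd ℂ) ξ = 1 := by
    rw [Complex.mul_conj', hξdef, norm_circleMap_zero]
    simp
  have hD0 : D ξ ≠ 0 := X.density_ne_zero _ (mem_closedBall_zero_iff.2 hmc.2)
  have h3 : (starRingEnd ℂ) (D ξ) * (starRingEnd ℂ) w = -(starRingEnd ℂ) ξ := by
    rw [← map_mul, h1, map_neg]
  have hcD : (starRingEnd ℂ) (D ξ) ≠ 0 := by simpa using hD0
  have hcv : (starRingEnd ℂ) v ≠ 0 := by simpa using hv0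
  have hcw : (starRingEnd ℂ) w ≠ 0 := by simpa using hw0
  rw [← div_eq_mul_inv, div_eq_div_iff hcD hcv]
  refine mul_right_cancel₀ (mul_ne_zero hw0 hcw) ?_
  linear_combination ((starRingEnd ℂ) v * (starRingEnd ℂ) w) * h1 + ξ ^ 2 * v * w * h3 - ξ * hwv -
    ξ * w * v * hξ1

/-- The logarithm of the density, whose imaginary part is Lipschitz on the circle. -/
theorem IsDiscParam.exists_log_density (X : IsDiscParam Ω N f G H D)
    (E : IsRegularExterior Ω γ N f h a) : ∃ l : ℂ → ℂ, ∃ L : ℝ, 0 ≤ L ∧ Continuous l ∧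
      DifferentiableOn ℂ l (Metric.ball 0 1) ∧
      (∀ ξ ∈ Metric.closedBall (0 : ℂ) 1, Complex.exp (l ξ) = D ξ) ∧
      ∀ θ ∈ Icc 0 (2 * Real.pi), ∀ τ : ℝ, |τ| ≤ 1 →
        |(l (circleMap 0 1 (θ + τ))).im - (l (circleMap 0 1 θ)).im| ≤ L * |τ| := by
  obtain ⟨l, hl, hld, hexp⟩ := exists_log_closedBall X.density_continuousOn X.density_differentiableOn
    X.density_ne_zero
  -- `u = 2i Im l` is a continuous logarithm of the `C¹` function `D / conj D`, so `Im l` is `C¹`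
  -- along the circle.
  set u : ℝ → ℂ := fun θ => l (circleMap 0 1 θ) - (starRingEnd ℂ) (l (circleMap 0 1 θ)) with hu
  have huc : Continuous u := by
    have h1 : Continuous fun θ => l (circleMap 0 1 θ) := hl.comp (continuous_circleMap 0 1)
    exact h1.sub (Complex.continuous_conj.comp h1)
  have hexpu : ∀ θ, Complex.exp (u θ) =
      D (circleMap 0 1 θ) / (starRingEnd ℂ) (D (circleMap 0 1 θ)) := by
    intro θ
    have h1 := hexp _ (circleMap_mem_closedBall (0 : ℂ) zero_le_one θ)
    rw [hu, Complex.exp_sub, Complex.exp_conj, h1]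
  have huC : ContDiff ℝ 1 u := by
    rw [contDiff_iff_contDiffAt]
    intro θ
    refine ContDiffAt.of_exp huc.continuousAt ?_
    simp only [hexpu]
    exact (X.contDiff_phase E).contDiffAt
  have huim : ∀ θ, (u θ).im = 2 * (l (circleMap 0 1 θ)).im := by
    intro θ
    simp only [hu, Complex.sub_im, Complex.conj_im]
    ring
  obtain ⟨M, hM⟩ := isCompact_Icc.exists_bound_of_continuousOn (s := Icc (-1) (2 * Real.pi + 1))
    (huC.continuous_deriv le_rfl).continuousOn
  have hpi := Real.pi_pos
  have hM0 : 0 ≤ M := (norm_nonneg _).trans (hM 0 ⟨by norm_num, by linarith⟩)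
  refine ⟨l, M, hM0, hl, hld, hexp, fun θ hθ τ hτ => ?_⟩
  obtain ⟨h1, h2⟩ := abs_le.1 hτ
  have h3 := (convex_Icc (-1) (2 * Real.pi + 1)).norm_image_sub_le_of_norm_deriv_le
    (fun x _ => huC.differentiable one_ne_zero x) hM (x := θ) (y := θ + τ)
    ⟨by linarith [hθ.1], by linarith [hθ.2]⟩ ⟨by linarith [hθ.1], by linarith [hθ.2]⟩
  have h4 := (Complex.abs_im_le_norm _).trans h3
  rw [Complex.sub_im, huim, huim, add_sub_cancel_left, Real.norm_eq_abs, ← mul_sub, abs_mul,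
    abs_two] at h4
  have := mul_nonneg hM0 (abs_nonneg τ)
  linarith

end Argument

/-! ### From the argument on the circle to mean square bounds in the disc. -/

section LogarithmicDerivative

/-- If the imaginary part of `l` is Lipschitz on the unit circle, then `Re (ξ l' ξ)` is bounded in
the disc. -/
lemma abs_re_mul_deriv_le {l : ℂ → ℂ} {L : ℝ} (hl : Continuous l)
    (hd : DifferentiableOn ℂ l (Metric.ball 0 1))
    (hlip : ∀ θ ∈ Icc 0 (2 * Real.pi), ∀ τ : ℝ, |τ| ≤ 1 →
      |(l (circleMap 0 1 (θ + τ))).im - (l (circleMap 0 1 θ)).im| ≤ L * |τ|) {ξ : ℂ}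
    (hξ : ξ ∈ Metric.ball (0 : ℂ) 1) : |(ξ * deriv l ξ).re| ≤ L := by
  have hrot : ∀ (τ : ℝ) (z : ℂ), ‖Complex.exp (τ * Complex.I) * z‖ = ‖z‖ := fun τ z => by
    rw [norm_mul, Complex.norm_exp_ofReal_mul_I, one_mul]
  have hrotb : ∀ (τ : ℝ) (z : ℂ), z ∈ Metric.ball (0 : ℂ) 1 →
      Complex.exp (τ * Complex.I) * z ∈ Metric.ball (0 : ℂ) 1 := fun τ z hz => by
    rw [mem_ball_zero_iff] at hz ⊢
    rwa [hrot]
  have key : ∀ (s : ℝ), (s = 1 ∨ s = -1) → ∀ τ : ℝ, |τ| ≤ 1 →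
      s * (l (Complex.exp (τ * Complex.I) * ξ) - l ξ).im ≤ L * |τ| := by
    intro s hs τ hτ
    -- The modulus of `k` is the exponential of `±(Im l (exp (iτ) z) - Im l z)`. The maximum
    -- principle for `k` carries the Lipschitz bound under rotation from the circle into the disc.
    set k : ℂ → ℂ := fun z =>
      Complex.exp (-Complex.I * s * (l (Complex.exp (τ * Complex.I) * z) - l z)) with hk
    have hnk : ∀ z, ‖k z‖ = Real.exp (s * (l (Complex.exp (τ * Complex.I) * z) - l z).im) := by
      intro z
      rw [hk, Complex.norm_exp]
      congr 1
      simp [Complex.mul_re, Complex.mul_im]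
    have hkd : DiffContOnCl ℂ k (Metric.ball 0 1) := by
      refine ⟨fun z hz => ?_, ?_⟩
      · have h1 : DifferentiableAt ℂ l z := hd.differentiableAt (Metric.isOpen_ball.mem_nhds hz)
        have h2 : DifferentiableAt ℂ l (Complex.exp (τ * Complex.I) * z) :=
          hd.differentiableAt (Metric.isOpen_ball.mem_nhds (hrotb τ z hz))
        have h3 : DifferentiableAt ℂ (fun z => l (Complex.exp (τ * Complex.I) * z)) z :=
          h2.comp z (differentiableAt_id.const_mul _)
        exact ((h3.fun_sub h1).const_mul _).cexp.differentiableWithinAt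
      · have : Continuous k := by
          have h3 : Continuous fun z => l (Complex.exp (τ * Complex.I) * z) :=
            hl.comp (continuous_const.mul continuous_id)
          exact Complex.continuous_exp.comp (continuous_const.mul (h3.sub hl))
        exact this.continuousOn
    have h1 := Complex.norm_le_of_forall_mem_frontier_norm_le Metric.isBounded_ball hkd
      (C := Real.exp (L * |τ|)) (fun z hz => by
        rw [frontier_ball _ one_ne_zero, ← abs_one (α := ℝ), ← image_circleMap_Ioc] at hz
        obtain ⟨θ, hθ, rfl⟩ := hz
        rw [hnk, Real.exp_le_exp]
        have h2 : Complex.exp (τ * Complex.I) * circleMap 0 1 θ = circleMap 0 1 (θ + τ) := by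
          simp only [circleMap_zero]
          rw [mul_left_comm, ← Complex.exp_add]
          push_cast
          ring_nf
        rw [h2, Complex.sub_im]
        have h3 := hlip θ (Ioc_subset_Icc_self hθ) τ hτ
        rw [abs_le] at h3
        rcases hs with rfl | rfl <;> linarith [h3.1, h3.2]) (subset_closure hξ)
    rwa [hnk, Real.exp_le_exp] at h1
  -- Differentiating `Im l` along the rotation yields `Im (i ξ l') = Re (ξ l')`.
  have hder : HasDerivAt (fun τ : ℝ => (l (Complex.exp (τ * Complex.I) * ξ)).im)
      ((ξ * deriv l ξ).re) 0 := by
    have e1 : HasDerivAt (fun τ : ℝ => Complex.exp (τ * Complex.I) * ξ) (Complex.I * ξ) 0 := by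
      have e2 : HasDerivAt (fun τ : ℝ => (τ : ℂ) * Complex.I) Complex.I 0 := by
        simpa using (Complex.ofRealCLM.hasDerivAt (x := 0)).mul_const Complex.I
      have e3 := e2.cexp.mul_const ξ
      simpa using e3
    have e4 : HasDerivAt l (deriv l ξ) (Complex.exp (((0 : ℝ) : ℂ) * Complex.I) * ξ) := by
      simpa using (hd.differentiableAt (Metric.isOpen_ball.mem_nhds hξ)).hasDerivAt
    have e5 := e4.comp (0 : ℝ) e1
    refine (Complex.imCLM.hasFDerivAt.comp_hasDerivAt (0 : ℝ) e5).congr_deriv ?_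
    simp
    ring
  have hup := hasDerivAt_iff_tendsto_slope.1 hder
  have hup' : Tendsto (slope (fun τ : ℝ => (l (Complex.exp (τ * Complex.I) * ξ)).im) 0) (𝓝[>] 0)
      (𝓝 (ξ * deriv l ξ).re) := hup.mono_left (nhdsWithin_mono _ fun x hx => ne_of_gt hx)
  have hbd : ∀ᶠ τ : ℝ in 𝓝[>] 0,
      |slope (fun τ : ℝ => (l (Complex.exp (τ * Complex.I) * ξ)).im) 0 τ| ≤ L := by
    filter_upwards [Ioo_mem_nhdsGT one_pos] with τ hτ
    have hτ1 : |τ| ≤ 1 := by rw [abs_of_pos hτ.1]; exact hτ.2.le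
    have h1 := key 1 (Or.inl rfl) τ hτ1
    have h2 := key (-1) (Or.inr rfl) τ hτ1
    rw [abs_of_pos hτ.1, Complex.sub_im] at h1 h2
    rw [slope_def_field, sub_zero, abs_div, abs_of_pos hτ.1, div_le_iff₀ hτ.1, abs_le]
    simp only [Complex.ofReal_zero, zero_mul, Complex.exp_zero, one_mul]
    constructor <;> linarith
  exact le_of_tendsto hup'.abs hbd

/-- A holomorphic function vanishing at the centre is bounded in mean square by its real part. -/
lemma integral_norm_sq_le_of_re_le {q : ℂ → ℂ} {L ρ : ℝ} (hρ : 0 < ρ) (hρ1 : ρ < 1)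
    (hd : DifferentiableOn ℂ q (Metric.ball 0 1)) (hq0 : q 0 = 0)
    (hq : ∀ ξ ∈ Metric.ball (0 : ℂ) 1, |(q ξ).re| ≤ L) :
    ∫ θ in (0 : ℝ)..2 * Real.pi, ‖q (circleMap 0 ρ θ)‖ ^ 2 ≤ 4 * Real.pi * L ^ 2 := by
  have hmem : ∀ θ, circleMap 0 ρ θ ∈ Metric.ball (0 : ℂ) 1 := fun θ => by
    rw [mem_ball_zero_iff, norm_circleMap_zero, abs_of_pos hρ]
    exact hρ1
  have hqc : Continuous fun θ => q (circleMap 0 ρ θ) :=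
    hd.continuousOn.comp_continuous (continuous_circleMap 0 ρ) hmem
  -- The mean value property of `q²` with `q 0 = 0` gives `∫ Re q² = 0`. As `|q|² + Re q² = 2 (Re
  -- q)²`, the real part controls the whole mean square.
  have hdq : DiffContOnCl ℂ (fun z => q z ^ 2) (Metric.ball 0 |ρ|) := by
    rw [abs_of_pos hρ]
    refine DifferentiableOn.diffContOnCl ((hd.pow 2).mono ?_)
    rw [closure_ball _ hρ.ne']
    exact Metric.closedBall_subset_ball hρ1
  have h1 := hdq.circleAverage
  rw [Real.circleAverage_def, hq0, zero_pow two_ne_zero, smul_eq_zero] at h1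
  have h2 : ∫ θ in (0 : ℝ)..2 * Real.pi, q (circleMap 0 ρ θ) ^ 2 = 0 :=
    h1.resolve_left (inv_ne_zero Real.two_pi_pos.ne')
  have h3 : ∫ θ in (0 : ℝ)..2 * Real.pi, (q (circleMap 0 ρ θ) ^ 2).re = 0 := by
    have h4 := Complex.reCLM.intervalIntegral_comp_comm
      (f := fun θ => q (circleMap 0 ρ θ) ^ 2) ((hqc.pow 2).intervalIntegrable (μ := volume) 0 (2 * Real.pi))
    rw [h2, map_zero] at h4
    exact h4
  have hcre : Continuous fun θ => (q (circleMap 0 ρ θ) ^ 2).re := Complex.continuous_re.comp (hqc.pow 2)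
  have hcn : Continuous fun θ => ‖q (circleMap 0 ρ θ)‖ ^ 2 := hqc.norm.pow 2
  have h5 : ∫ θ in (0 : ℝ)..2 * Real.pi, ‖q (circleMap 0 ρ θ)‖ ^ 2 =
      ∫ θ in (0 : ℝ)..2 * Real.pi, (‖q (circleMap 0 ρ θ)‖ ^ 2 + (q (circleMap 0 ρ θ) ^ 2).re) := by
    rw [intervalIntegral.integral_add (hcn.intervalIntegrable _ _) (hcre.intervalIntegrable _ _), h3,
      add_zero]
  rw [h5]
  have h6 : ∫ θ in (0 : ℝ)..2 * Real.pi, (‖q (circleMap 0 ρ θ)‖ ^ 2 + (q (circleMap 0 ρ θ) ^ 2).re) ≤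
      ∫ _ in (0 : ℝ)..2 * Real.pi, 2 * L ^ 2 := by
    refine intervalIntegral.integral_mono_on Real.two_pi_pos.le ((hcn.add hcre).intervalIntegrable _ _)
      (by simp) fun θ _ => ?_
    have h7 := hq _ (hmem θ)
    have h8 : (q (circleMap 0 ρ θ)).re ^ 2 ≤ L ^ 2 := sq_le_sq' (by linarith [(abs_le.1 h7).1]) (abs_le.1 h7).2
    rw [Complex.sq_norm, Complex.normSq_apply, sq (q (circleMap 0 ρ θ)), Complex.mul_re]
    nlinarith
  refine h6.trans (le_of_eq ?_)
  rw [intervalIntegral.integral_const, sub_zero, smul_eq_mul]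
  ring

end LogarithmicDerivative

/-! ### Parseval's identity on circles. -/

section Parseval

/-- Parseval's identity for power series on a circle. -/
theorem hasSum_norm_sq_mul_pow {F : ℂ → ℂ} {a : ℕ → ℂ} {ρ : ℝ} (hρ : 0 < ρ)
    (hsum : Summable fun k => ‖a k‖ * ρ ^ k)
    (hF : ∀ θ : ℝ, HasSum (fun k => a k * circleMap 0 ρ θ ^ k) (F (circleMap 0 ρ θ)))
    (hFc : Continuous fun θ => F (circleMap 0 ρ θ)) :
    HasSum (fun k => ‖a k‖ ^ 2 * ρ ^ (2 * k))
      ((2 * Real.pi)⁻¹ * ∫ θ in (0 : ℝ)..2 * Real.pi, ‖F (circleMap 0 ρ θ)‖ ^ 2) := by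
  have hpi : (2 * Real.pi : ℂ) ≠ 0 := by exact_mod_cast Real.two_pi_pos.ne'
  have hnorm : ∀ θ, ‖circleMap 0 ρ θ‖ = ρ := fun θ => by rw [norm_circleMap_zero, abs_of_pos hρ]
  have horth : ∀ j k : ℕ, ∫ θ in (0 : ℝ)..2 * Real.pi,
      circleMap 0 ρ θ ^ j * (starRingEnd ℂ) (circleMap 0 ρ θ ^ k) =
        if j = k then (2 * Real.pi * ρ ^ (2 * k) : ℂ) else 0 := by
    intro j k
    have h1 : ∀ θ : ℝ, circleMap 0 ρ θ ^ j * (starRingEnd ℂ) (circleMap 0 ρ θ ^ k) =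
        (ρ : ℂ) ^ (j + k) * Complex.exp (((j : ℂ) - k) * Complex.I * θ) := by
      intro θ
      rw [map_pow, conj_circleMap_zero]
      simp only [circleMap_zero, mul_pow, ← Complex.exp_nat_mul]
      rw [mul_mul_mul_comm, ← pow_add, ← Complex.exp_add]
      push_cast
      ring_nf
    simp only [h1]
    rw [intervalIntegral.integral_const_mul]
    split_ifs with hjk
    · subst hjk
      simp
      ring
    · have hc : ((j : ℂ) - k) * Complex.I ≠ 0 :=
        mul_ne_zero (sub_ne_zero.2 (by exact_mod_cast hjk)) Complex.I_ne_zero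
      rw [integral_exp_mul_complex hc]
      have h2 : Complex.exp (((j : ℂ) - k) * Complex.I * ((2 * Real.pi : ℝ) : ℂ)) = 1 := by
        rw [Complex.exp_eq_one_iff]
        exact ⟨(j : ℤ) - k, by push_cast; ring⟩
      rw [h2]
      simp
  have hint1 : ∀ j : ℕ, ∫ θ in (0 : ℝ)..2 * Real.pi,
      circleMap 0 ρ θ ^ j * (starRingEnd ℂ) (F (circleMap 0 ρ θ)) =
        2 * Real.pi * ρ ^ (2 * j) * (starRingEnd ℂ) (a j) := by
    intro j
    have h1 : HasSum (fun k => ∫ θ in (0 : ℝ)..2 * Real.pi,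
        circleMap 0 ρ θ ^ j * (starRingEnd ℂ) (a k * circleMap 0 ρ θ ^ k))
        (∫ θ in (0 : ℝ)..2 * Real.pi, circleMap 0 ρ θ ^ j * (starRingEnd ℂ) (F (circleMap 0 ρ θ))) := by
      refine intervalIntegral.hasSum_integral_of_dominated_convergence
        (fun k _ => ρ ^ j * (‖a k‖ * ρ ^ k)) (fun k => ?_) (fun k => ?_) ?_ ?_ ?_
      · have : Continuous fun θ => circleMap 0 ρ θ ^ j * (starRingEnd ℂ) (a k * circleMap 0 ρ θ ^ k) :=
          ((continuous_circleMap 0 ρ).pow j).mul (Complex.continuous_conj.comp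
            (continuous_const.mul ((continuous_circleMap 0 ρ).pow k)))
        exact this.aestronglyMeasurable
      · refine Eventually.of_forall fun θ _ => ?_
        rw [norm_mul, norm_pow, RCLike.norm_conj, norm_mul, norm_pow, hnorm]
      · exact Eventually.of_forall fun θ _ => hsum.mul_left _
      · simp
      · refine Eventually.of_forall fun θ _ => ?_
        exact ((Complex.hasSum_conj'.2 (hF θ))).mul_left _
    have h2 : ∀ k, ∫ θ in (0 : ℝ)..2 * Real.pi,
        circleMap 0 ρ θ ^ j * (starRingEnd ℂ) (a k * circleMap 0 ρ θ ^ k) =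
        if k = j then 2 * Real.pi * ρ ^ (2 * j) * (starRingEnd ℂ) (a j) else 0 := by
      intro k
      have h3 : ∀ θ, circleMap 0 ρ θ ^ j * (starRingEnd ℂ) (a k * circleMap 0 ρ θ ^ k) =
          (starRingEnd ℂ) (a k) * (circleMap 0 ρ θ ^ j * (starRingEnd ℂ) (circleMap 0 ρ θ ^ k)) := by
        intro θ
        rw [map_mul]
        ring
      simp only [h3]
      rw [intervalIntegral.integral_const_mul, horth]
      by_cases hjk : k = j
      · subst hjk
        simp
        ring
      · rw [if_neg hjk, if_neg (Ne.symm hjk), mul_zero]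
    simp only [h2] at h1
    exact h1.unique (hasSum_ite_eq j _)
  have h1 : HasSum (fun k => ∫ θ in (0 : ℝ)..2 * Real.pi,
      a k * circleMap 0 ρ θ ^ k * (starRingEnd ℂ) (F (circleMap 0 ρ θ)))
      (∫ θ in (0 : ℝ)..2 * Real.pi, F (circleMap 0 ρ θ) * (starRingEnd ℂ) (F (circleMap 0 ρ θ))) := by
    refine intervalIntegral.hasSum_integral_of_dominated_convergence
      (fun k θ => ‖a k‖ * ρ ^ k * ‖F (circleMap 0 ρ θ)‖) (fun k => ?_) (fun k => ?_) ?_ ?_ ?_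
    · have : Continuous fun θ => a k * circleMap 0 ρ θ ^ k * (starRingEnd ℂ) (F (circleMap 0 ρ θ)) :=
        (continuous_const.mul ((continuous_circleMap 0 ρ).pow k)).mul (Complex.continuous_conj.comp hFc)
      exact this.aestronglyMeasurable
    · refine Eventually.of_forall fun θ _ => ?_
      rw [norm_mul, norm_mul, norm_pow, RCLike.norm_conj, hnorm]
    · exact Eventually.of_forall fun θ _ => hsum.mul_right _
    · simp only [tsum_mul_right]
      exact (continuous_const.mul hFc.norm).intervalIntegrable _ _
    · exact Eventually.of_forall fun θ _ => (hF θ).mul_right _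
  have h2 : ∀ k, ∫ θ in (0 : ℝ)..2 * Real.pi,
      a k * circleMap 0 ρ θ ^ k * (starRingEnd ℂ) (F (circleMap 0 ρ θ)) =
      ((2 * Real.pi * (‖a k‖ ^ 2 * ρ ^ (2 * k)) : ℝ) : ℂ) := by
    intro k
    simp only [mul_assoc (a k)]
    rw [intervalIntegral.integral_const_mul, hint1]
    have := Complex.mul_conj' (a k)
    push_cast
    linear_combination (2 * Real.pi * ρ ^ (2 * k) : ℂ) * this
  have h3 : ∫ θ in (0 : ℝ)..2 * Real.pi, F (circleMap 0 ρ θ) * (starRingEnd ℂ) (F (circleMap 0 ρ θ)) =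
      ((∫ θ in (0 : ℝ)..2 * Real.pi, ‖F (circleMap 0 ρ θ)‖ ^ 2 : ℝ) : ℂ) := by
    rw [← intervalIntegral.integral_ofReal]
    refine intervalIntegral.integral_congr fun θ _ => ?_
    simp only [Complex.mul_conj', Complex.ofReal_pow]
  simp only [h2, h3] at h1
  have h4 := (Complex.hasSum_ofReal.1 h1).mul_left (2 * Real.pi)⁻¹
  simpa only [inv_mul_cancel_left₀ Real.two_pi_pos.ne'] using h4

end Parseval

/-! ### Weighted summability of the Taylor coefficients of the density. -/

section Coefficients

lemma hasSum_taylor {F : ℂ → ℂ} (hF : DifferentiableOn ℂ F (Metric.ball 0 1)) {ξ : ℂ}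
    (hξ : ξ ∈ Metric.ball (0 : ℂ) 1) :
    HasSum (fun k : ℕ => (k.factorial : ℂ)⁻¹ * iteratedDeriv k F 0 * ξ ^ k) (F ξ) := by
  have h1 := Complex.hasSum_taylorSeries_on_ball (r := 1) (by simpa using hF)
    (by simpa using hξ : ξ ∈ Metric.ball (0 : ℂ) ((1 : NNReal) : ℝ))
  refine h1.congr_fun ?_
  intro k
  simp only [sub_zero, smul_eq_mul]
  ring

lemma circleMap_mem_ball_one {ρ : ℝ} (h0 : 0 < ρ) (h1 : ρ < 1) (θ : ℝ) :
    circleMap 0 ρ θ ∈ Metric.ball (0 : ℂ) 1 := by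
  rw [mem_ball_zero_iff, norm_circleMap_zero, abs_of_pos h0]
  exact h1

lemma hasSum_parseval_taylor {F : ℂ → ℂ} (hF : DifferentiableOn ℂ F (Metric.ball 0 1)) {ρ : ℝ}
    (h0 : 0 < ρ) (h1 : ρ < 1) :
    HasSum (fun k : ℕ => ‖(k.factorial : ℂ)⁻¹ * iteratedDeriv k F 0‖ ^ 2 * ρ ^ (2 * k))
      ((2 * Real.pi)⁻¹ * ∫ θ in (0 : ℝ)..2 * Real.pi, ‖F (circleMap 0 ρ θ)‖ ^ 2) := by
  refine hasSum_norm_sq_mul_pow h0 ?_ (fun θ => hasSum_taylor hF (circleMap_mem_ball_one h0 h1 θ))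
    (hF.continuousOn.comp_continuous (continuous_circleMap 0 ρ) (circleMap_mem_ball_one h0 h1))
  have h2 := (hasSum_taylor hF (circleMap_mem_ball_one h0 h1 0)).summable.norm
  refine h2.congr fun k => ?_
  rw [norm_mul, norm_pow, norm_circleMap_zero, abs_of_pos h0]

/-- The Taylor coefficients of a nonvanishing function `D = exp l` on the disc are square summable
with the weight `k ^ 2` if `Re (ξ l' ξ)` is bounded. -/
theorem summable_sq_mul_norm_sq {D l : ℂ → ℂ} {L M : ℝ} (hl : DifferentiableOn ℂ l (Metric.ball 0 1))
    (hD : ∀ ξ ∈ Metric.ball (0 : ℂ) 1, Complex.exp (l ξ) = D ξ)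
    (hM : ∀ ξ ∈ Metric.ball (0 : ℂ) 1, ‖D ξ‖ ≤ M)
    (hL : ∀ ξ ∈ Metric.ball (0 : ℂ) 1, |(ξ * deriv l ξ).re| ≤ L) :
    Summable fun k : ℕ => (k : ℝ) ^ 2 * ‖(k.factorial : ℂ)⁻¹ * iteratedDeriv k D 0‖ ^ 2 := by
  have hDd : DifferentiableOn ℂ D (Metric.ball 0 1) := hl.cexp.congr fun ξ hξ => (hD ξ hξ).symm
  have hD'd : DifferentiableOn ℂ (deriv D) (Metric.ball 0 1) := hDd.deriv Metric.isOpen_ball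
  have hl'd : DifferentiableOn ℂ (deriv l) (Metric.ball 0 1) := hl.deriv Metric.isOpen_ball
  have hder : ∀ ξ ∈ Metric.ball (0 : ℂ) 1, deriv D ξ = D ξ * deriv l ξ := by
    intro ξ hξ
    have h1 := (hl.differentiableAt (Metric.isOpen_ball.mem_nhds hξ)).hasDerivAt.cexp
    rw [hD ξ hξ] at h1
    refine (h1.congr_of_eventuallyEq ?_).deriv
    filter_upwards [Metric.isOpen_ball.mem_nhds hξ] with w hw using (hD w hw).symm
  have hM0 : 0 ≤ M := (norm_nonneg _).trans (hM 0 (Metric.mem_ball_self one_pos))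
  -- From `D' = D l'` and `|l'| ≤ 2 |ξ l'|` for `|ξ| ≥ 1/2`, the mean is at most `(2π)⁻¹ · 4M² ·
  -- 4πL²`, uniformly in `ρ`.
  have hbound : ∀ ρ : ℝ, 1 / 2 ≤ ρ → ρ < 1 →
      (2 * Real.pi)⁻¹ * ∫ θ in (0 : ℝ)..2 * Real.pi, ‖deriv D (circleMap 0 ρ θ)‖ ^ 2 ≤
        8 * M ^ 2 * L ^ 2 := by
    intro ρ hρ hρ1
    have hρ0 : 0 < ρ := by linarith
    have hmem := circleMap_mem_ball_one hρ0 hρ1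
    have h1 := integral_norm_sq_le_of_re_le hρ0 hρ1 (q := fun ξ => ξ * deriv l ξ)
      (differentiableOn_id.mul hl'd) (by simp) hL
    have hqc : Continuous fun θ => circleMap 0 ρ θ * deriv l (circleMap 0 ρ θ) :=
      (continuous_circleMap 0 ρ).mul
        (hl'd.continuousOn.comp_continuous (continuous_circleMap 0 ρ) hmem)
    have hDc : Continuous fun θ => deriv D (circleMap 0 ρ θ) :=
      hD'd.continuousOn.comp_continuous (continuous_circleMap 0 ρ) hmem
    have h2 : ∫ θ in (0 : ℝ)..2 * Real.pi, ‖deriv D (circleMap 0 ρ θ)‖ ^ 2 ≤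
        ∫ θ in (0 : ℝ)..2 * Real.pi,
          4 * M ^ 2 * ‖circleMap 0 ρ θ * deriv l (circleMap 0 ρ θ)‖ ^ 2 := by
      refine intervalIntegral.integral_mono_on Real.two_pi_pos.le
        ((hDc.norm.pow 2).intervalIntegrable _ _)
        ((continuous_const.mul (hqc.norm.pow 2)).intervalIntegrable _ _) fun θ _ => ?_
      rw [hder _ (hmem θ), norm_mul, norm_mul, norm_circleMap_zero, abs_of_pos hρ0]
      have h3 : ‖D (circleMap 0 ρ θ)‖ ^ 2 ≤ M ^ 2 := pow_le_pow_left₀ (norm_nonneg _) (hM _ (hmem θ)) 2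
      have h4 : 1 ≤ 4 * ρ ^ 2 := by nlinarith
      have h5 : 0 ≤ ‖deriv l (circleMap 0 ρ θ)‖ ^ 2 := sq_nonneg _
      calc (‖D (circleMap 0 ρ θ)‖ * ‖deriv l (circleMap 0 ρ θ)‖) ^ 2
          = ‖D (circleMap 0 ρ θ)‖ ^ 2 * ‖deriv l (circleMap 0 ρ θ)‖ ^ 2 := by ring
        _ ≤ M ^ 2 * ‖deriv l (circleMap 0 ρ θ)‖ ^ 2 := mul_le_mul_of_nonneg_right h3 h5
        _ ≤ (4 * ρ ^ 2) * (M ^ 2 * ‖deriv l (circleMap 0 ρ θ)‖ ^ 2) :=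
          le_mul_of_one_le_left (by positivity) h4
        _ = 4 * M ^ 2 * (ρ * ‖deriv l (circleMap 0 ρ θ)‖) ^ 2 := by ring
    rw [intervalIntegral.integral_const_mul] at h2
    have h6 : ∫ θ in (0 : ℝ)..2 * Real.pi, ‖deriv D (circleMap 0 ρ θ)‖ ^ 2 ≤
        4 * M ^ 2 * (4 * Real.pi * L ^ 2) := h2.trans (mul_le_mul_of_nonneg_left h1 (by positivity))
    rw [inv_mul_le_iff₀ Real.two_pi_pos]
    linarith
  -- Squared Taylor coefficients of `D'`, that is, `(k + 1)² |d_{k+1}|²`. Their partial sums are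
  -- bounded by letting `ρ → 1` in Parseval's identity.
  set b : ℕ → ℝ := fun k => ‖(k.factorial : ℂ)⁻¹ * iteratedDeriv k (deriv D) 0‖ ^ 2 with hb
  have hbs : Summable b := by
    refine summable_of_sum_range_le (c := 8 * M ^ 2 * L ^ 2) (fun k => sq_nonneg _) fun n => ?_
    have hlim : Tendsto (fun ρ : ℝ => ∑ k ∈ Finset.range n, b k * ρ ^ (2 * k)) (𝓝[<] 1)
        (𝓝 (∑ k ∈ Finset.range n, b k)) := by
      have hc : Continuous fun ρ : ℝ => ∑ k ∈ Finset.range n, b k * ρ ^ (2 * k) := by fun_prop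
      simpa using (hc.tendsto 1).mono_left nhdsWithin_le_nhds
    refine le_of_tendsto hlim ?_
    filter_upwards [Ico_mem_nhdsLT (show (1 / 2 : ℝ) < 1 by norm_num)] with ρ hρ
    have hρ0 : 0 < ρ := by linarith [hρ.1]
    have h1 := hasSum_parseval_taylor hD'd hρ0 hρ.2
    refine (sum_le_hasSum _ (fun k _ => ?_) h1).trans (hbound ρ hρ.1 hρ.2)
    positivity
  rw [← summable_nat_add_iff 1]
  refine hbs.congr fun k => ?_
  rw [hb, iteratedDeriv_succ', Nat.factorial_succ]
  push_cast
  have hk : ((k : ℂ) + 1) ≠ 0 := by exact_mod_cast Nat.succ_ne_zero k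
  have h2 : ‖((k : ℂ) + 1)‖ = (k : ℝ) + 1 := by
    have : ((k : ℂ) + 1) = ((k + 1 : ℝ) : ℂ) := by push_cast; rfl
    rw [this, Complex.norm_real, Real.norm_of_nonneg (by positivity)]
  rw [mul_inv, mul_assoc, norm_mul (((k : ℂ) + 1)⁻¹), norm_inv, h2]
  field_simp

/-- The mean square of the density on circles, as a power series in the radius. -/
theorem IsDiscParam.exists_coeff {Ω : Set ℂ} {γ : ℝ → ℂ} {N : ℂ → ℝ} {f h G H D : ℂ → ℂ} {a : ℂ}
    (X : IsDiscParam Ω N f G H D) (E : IsRegularExterior Ω γ N f h a) : ∃ d : ℕ → ℂ, d 0 ≠ 0 ∧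
      Summable (fun k : ℕ => (k : ℝ) ^ 2 * ‖d k‖ ^ 2) ∧
      (∀ ρ : ℝ, 0 < ρ → ρ ≤ 1 → HasSum (fun k => ‖d k‖ ^ 2 * ρ ^ (2 * k))
        ((2 * Real.pi)⁻¹ * ∫ θ in (0 : ℝ)..2 * Real.pi, ‖D (circleMap 0 ρ θ)‖ ^ 2)) ∧
      ((∀ k ≠ 0, d k = 0) → ∀ ξ ∈ Metric.closedBall (0 : ℂ) 1, D ξ = d 0) := by
  obtain ⟨l, L, -, hlc, hld, hexp, hlip⟩ := X.exists_log_density E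
  obtain ⟨M, hM⟩ := (isCompact_closedBall (0 : ℂ) 1).exists_bound_of_continuousOn X.density_continuousOn
  have hsub := Metric.ball_subset_closedBall (x := (0 : ℂ)) (ε := 1)
  have hs := summable_sq_mul_norm_sq hld (fun ξ hξ => hexp ξ (hsub hξ)) (fun ξ hξ => hM ξ (hsub hξ))
    fun ξ hξ => abs_re_mul_deriv_le hlc hld hlip hξ
  have hT : ∀ ξ ∈ Metric.ball (0 : ℂ) 1, _ := fun ξ hξ => hasSum_taylor X.density_differentiableOn hξ
  have hP : ∀ ρ : ℝ, 0 < ρ → ρ < 1 → _ := fun ρ h0 h1 =>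
    hasSum_parseval_taylor X.density_differentiableOn h0 h1
  set d : ℕ → ℂ := fun k => (k.factorial : ℂ)⁻¹ * iteratedDeriv k D 0 with hd
  have hd2 : Summable fun k => ‖d k‖ ^ 2 := by
    rw [← summable_nat_add_iff 1]
    refine Summable.of_nonneg_of_le (fun k => sq_nonneg _) (fun k => ?_) ((summable_nat_add_iff 1).2 hs)
    refine le_mul_of_one_le_left (sq_nonneg _) ?_
    push_cast
    nlinarith [(Nat.cast_nonneg k : (0 : ℝ) ≤ k)]
  refine ⟨d, ?_, hs, ?_, ?_⟩
  · have : d 0 = D 0 := by simp [hd]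
    rw [this]
    exact X.density_ne_zero 0 (Metric.mem_closedBall_self zero_le_one)
  · intro ρ h0 h1
    rcases h1.lt_or_eq with hlt | rfl
    · exact hP ρ h0 hlt
    -- At `ρ = 1` both sides are limits from `ρ < 1`: the integral by continuity of `D` up to the
    -- circle, the series by summability of `|d_k|²`.
    obtain ⟨D', hD', hDD', -⟩ := exists_continuous_eqOn_closedBall X.density_continuousOn
    have hDint : ∀ ρ : ℝ, 0 < ρ → ρ ≤ 1 → ∫ θ in (0 : ℝ)..2 * Real.pi, ‖D (circleMap 0 ρ θ)‖ ^ 2 =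
        ∫ θ in (0 : ℝ)..2 * Real.pi, ‖D' (circleMap 0 ρ θ)‖ ^ 2 := by
      intro ρ h0 h1
      refine intervalIntegral.integral_congr fun θ _ => ?_
      have h2 := hDD' (mem_closedBall_zero_iff.2 (circleMap_mem h0 h1 θ).2)
      simp only [h2]
    have hcm : Continuous fun p : ℝ × ℝ => circleMap 0 p.1 p.2 := by
      unfold circleMap
      fun_prop
    have hA : Continuous fun ρ : ℝ =>
        (2 * Real.pi)⁻¹ * ∫ θ in (0 : ℝ)..2 * Real.pi, ‖D' (circleMap 0 ρ θ)‖ ^ 2 :=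
      continuous_const.mul (intervalIntegral.continuous_parametric_intervalIntegral_of_continuous'
        ((hD'.comp hcm).norm.pow 2) 0 (2 * Real.pi))
    have hS : ContinuousOn (fun ρ : ℝ => ∑' k, ‖d k‖ ^ 2 * ρ ^ (2 * k)) (Icc 0 1) := by
      refine continuousOn_tsum (fun k => by fun_prop) hd2 fun k ρ hρ => ?_
      rw [norm_mul, norm_pow, norm_norm, norm_pow, Real.norm_of_nonneg hρ.1]
      exact mul_le_of_le_one_right (sq_nonneg _) (pow_le_one₀ hρ.1 hρ.2)
    have hev : ∀ᶠ ρ : ℝ in 𝓝[<] 1, ρ ∈ Ioo (0 : ℝ) 1 := Ioo_mem_nhdsLT one_pos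
    have l1 : Tendsto (fun ρ : ℝ => ∑' k, ‖d k‖ ^ 2 * ρ ^ (2 * k)) (𝓝[<] 1)
        (𝓝 (∑' k, ‖d k‖ ^ 2 * (1 : ℝ) ^ (2 * k))) := by
      refine (hS 1 ⟨zero_le_one, le_rfl⟩).tendsto.comp (tendsto_nhdsWithin_iff.2
        ⟨tendsto_id.mono_left nhdsWithin_le_nhds, ?_⟩)
      filter_upwards [hev] with ρ hρ using ⟨hρ.1.le, hρ.2.le⟩
    have l2 := (hA.tendsto 1).mono_left (nhdsWithin_le_nhds (s := Iio 1))
    have l3 : (∑' k, ‖d k‖ ^ 2 * (1 : ℝ) ^ (2 * k)) =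
        (2 * Real.pi)⁻¹ * ∫ θ in (0 : ℝ)..2 * Real.pi, ‖D' (circleMap 0 1 θ)‖ ^ 2 := by
      refine tendsto_nhds_unique l1 (l2.congr' ?_)
      filter_upwards [hev] with ρ hρ
      rw [(hP ρ hρ.1 hρ.2).tsum_eq, hDint ρ hρ.1 hρ.2.le]
    rw [hDint 1 one_pos le_rfl, ← l3]
    refine Summable.hasSum ?_
    simpa using hd2
  · intro hz ξ hξ
    have hball : EqOn D (fun _ => d 0) (Metric.ball 0 1) := by
      intro w hw
      have h1 := hT w hw
      refine h1.unique ?_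
      have h2 := hasSum_single (f := fun k => d k * w ^ k) 0 fun k hk => by rw [hz k hk, zero_mul]
      simpa using h2
    have h2 := hball.of_subset_closure (s := Metric.ball (0 : ℂ) 1) (t := Metric.closedBall 0 1)
      X.density_continuousOn continuousOn_const hsub (by rw [closure_ball _ one_ne_zero])
    exact h2 hξ

end Coefficients

/-! ### Differentiation on a closed half-line. -/

section HalfLine

/-- Two derivatives on a closed half-line, continuous up to the endpoint. -/
structure HasTwoDerivsIic (F F₁ F₂ : ℝ → ℝ) (b : ℝ) : Prop where
  first : ∀ x ≤ b, HasDerivWithinAt F (F₁ x) (Iic b) x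
  second : ∀ x ≤ b, HasDerivWithinAt F₁ (F₂ x) (Iic b) x
  continuousOn : ContinuousOn F₂ (Iic b)

namespace HasTwoDerivsIic

variable {F F₁ F₂ : ℝ → ℝ} {b : ℝ}

lemma derivWithin_eq (h : HasTwoDerivsIic F F₁ F₂ b) {x : ℝ} (hx : x ≤ b) :
    derivWithin F (Iic b) x = F₁ x :=
  (h.first x hx).derivWithin (uniqueDiffOn_Iic b x hx)

lemma iteratedDerivWithin_eq (h : HasTwoDerivsIic F F₁ F₂ b) {x : ℝ} (hx : x ≤ b) :
    iteratedDerivWithin 2 F (Iic b) x = F₂ x := by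
  rw [iteratedDerivWithin_succ, iteratedDerivWithin_one]
  exact ((h.second x hx).congr (fun y hy => h.derivWithin_eq hy) (h.derivWithin_eq hx)).derivWithin
    (uniqueDiffOn_Iic b x hx)

lemma contDiffOn (h : HasTwoDerivsIic F F₁ F₂ b) : ContDiffOn ℝ 2 F (Iic b) := by
  have h1 : ContDiffOn ℝ 1 F₁ (Iic b) := by
    have := (contDiffOn_succ_iff_derivWithin (n := 0) (f := F₁) (uniqueDiffOn_Iic b)).2
      ⟨fun x hx => (h.second x hx).differentiableWithinAt, by simp, by
        rw [contDiffOn_zero]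
        exact h.continuousOn.congr fun x hx => (h.second x hx).derivWithin (uniqueDiffOn_Iic b x hx)⟩
    simpa using this
  have := (contDiffOn_succ_iff_derivWithin (n := 1) (f := F) (uniqueDiffOn_Iic b)).2
    ⟨fun x hx => (h.first x hx).differentiableWithinAt, by simp, h1.congr fun x hx => h.derivWithin_eq hx⟩
  simpa using! this

lemma congr (h : HasTwoDerivsIic F F₁ F₂ b) {F' : ℝ → ℝ} (hF : ∀ x ≤ b, F' x = F x) :
    HasTwoDerivsIic F' F₁ F₂ b :=
  ⟨fun x hx => (h.first x hx).congr hF (hF x hx), h.second, h.continuousOn⟩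

lemma log (h : HasTwoDerivsIic F F₁ F₂ b) (hpos : ∀ x ≤ b, 0 < F x) :
    HasTwoDerivsIic (fun x => Real.log (F x)) (fun x => F₁ x / F x)
      (fun x => (F₂ x * F x - F₁ x * F₁ x) / F x ^ 2) b := by
  refine ⟨fun x hx => (h.first x hx).log (hpos x hx).ne', fun x hx =>
    (h.second x hx).div (h.first x hx) (hpos x hx).ne', ?_⟩
  have c0 : ContinuousOn F (Iic b) := fun x hx => (h.first x hx).continuousWithinAt
  have c1 : ContinuousOn F₁ (Iic b) := fun x hx => (h.second x hx).continuousWithinAt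
  exact ((h.continuousOn.mul c0).sub (c1.mul c1)).div (c0.pow 2)
    fun x hx => pow_ne_zero 2 (hpos x hx).ne'

lemma convexOn (h : HasTwoDerivsIic F F₁ F₂ b) (h2 : ∀ x ≤ b, 0 ≤ F₂ x) : ConvexOn ℝ (Iic b) F := by
  refine convexOn_of_hasDerivWithinAt2_nonneg (convex_Iic b) (f' := F₁) (f'' := F₂)
    (fun x hx => (h.first x hx).continuousWithinAt) (fun x hx => ?_) (fun x hx => ?_) fun x hx => ?_
  · exact (h.first x (mem_Iic.1 (interior_subset hx))).mono interior_subset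
  · exact (h.second x (mem_Iic.1 (interior_subset hx))).mono interior_subset
  · exact h2 x (mem_Iic.1 (interior_subset hx))

end HasTwoDerivsIic

/-- Termwise differentiation of a series on a closed half-line. -/
lemma hasDerivWithinAt_tsum_Iic {g g' : ℕ → ℝ → ℝ} {b : ℝ}
    (hg : ∀ k y, HasDerivAt (g k) (g' k y) y) (hc : ∀ k, Continuous (g' k))
    (hb : ∀ R : ℝ, ∃ u : ℕ → ℝ, Summable u ∧
      ∀ k, ∀ y ∈ Icc (b - R) b, ‖g k y‖ ≤ u k ∧ ‖g' k y‖ ≤ u k) {x : ℝ} (hx : x ≤ b) :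
    HasDerivWithinAt (fun y => ∑' k, g k y) (∑' k, g' k x) (Iic b) x := by
  have hcont : ∀ R : ℝ, ContinuousOn (fun y => ∑' k, g k y) (Icc (b - R) b) := by
    intro R
    obtain ⟨u, hu, hbd⟩ := hb R
    exact continuousOn_tsum (fun k => (continuous_iff_continuousAt.2 fun y =>
      (hg k y).continuousAt).continuousOn) hu fun k y hy => (hbd k y hy).1
  have hcont' : ∀ R : ℝ, ContinuousOn (fun y => ∑' k, g' k y) (Icc (b - R) b) := by
    intro R
    obtain ⟨u, hu, hbd⟩ := hb R
    exact continuousOn_tsum (fun k => (hc k).continuousOn) hu fun k y hy => (hbd k y hy).2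
  have hint : ∀ y < b, HasDerivAt (fun y => ∑' k, g k y) (∑' k, g' k y) y := by
    intro y hy
    obtain ⟨u, hu, hbd⟩ := hb (b - y + 1)
    have hy' : y ∈ Ioo (b - (b - y + 1)) b := ⟨by linarith, hy⟩
    refine hasDerivAt_tsum_of_isPreconnected hu isOpen_Ioo isPreconnected_Ioo (fun k y _ => hg k y)
      (fun k y hy => (hbd k y (Ioo_subset_Icc_self hy)).2) hy' ?_ hy'
    exact Summable.of_norm_bounded hu fun k => (hbd k y (Ioo_subset_Icc_self hy')).1
  rcases hx.lt_or_eq with hlt | rfl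
  · exact (hint x hlt).hasDerivWithinAt
  -- At the endpoint, the one-sided derivative is the limit of the interior derivatives, since the
  -- sum and the series of derivatives are continuous there.
  · have hcx : ∀ {F : ℝ → ℝ}, ContinuousOn F (Icc (x - 1) x) → Tendsto F (𝓝[<] x) (𝓝 (F x)) := by
      intro F hF
      refine (hF x ⟨by linarith, le_rfl⟩).tendsto.mono_left ?_
      rw [← nhdsWithin_Ioo_eq_nhdsLT (show x - 1 < x by linarith)]
      exact nhdsWithin_mono _ Ioo_subset_Icc_self
    refine hasDerivWithinAt_Iic_of_tendsto_deriv (s := Iio x)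
      (fun y hy => (hint y hy).differentiableAt.differentiableWithinAt) (hcx (hcont 1)) self_mem_nhdsWithin
      ((hcx (hcont' 1)).congr' ?_)
    filter_upwards [self_mem_nhdsWithin] with y hy using (hint y hy).deriv.symm

end HalfLine

/-! ### Exponential series with nonnegative weights. -/

section ExponentialSeries

/-- The general term of the `j`-th derivative of `∑ w k * exp (α (k - 1) (x - b))`. -/
noncomputable def expTerm (w : ℕ → ℝ) (α b : ℝ) (j k : ℕ) (x : ℝ) : ℝ :=
  w k * (α * ((k : ℝ) - 1)) ^ j * Real.exp (α * ((k : ℝ) - 1) * (x - b))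

/-- The `j`-th derivative of `∑ w k * exp (α (k - 1) (x - b))`. -/
noncomputable def expSeries (w : ℕ → ℝ) (α b : ℝ) (j : ℕ) (x : ℝ) : ℝ := ∑' k, expTerm w α b j k x

variable {w : ℕ → ℝ} {α b : ℝ}

lemma hasDerivAt_expTerm (w : ℕ → ℝ) (α b : ℝ) (j k : ℕ) (x : ℝ) :
    HasDerivAt (expTerm w α b j k) (expTerm w α b (j + 1) k x) x := by
  have h1 : HasDerivAt (fun x => α * ((k : ℝ) - 1) * (x - b)) (α * ((k : ℝ) - 1)) x := by
    simpa using ((hasDerivAt_id x).sub_const b).const_mul (α * ((k : ℝ) - 1))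
  refine (h1.exp.const_mul (w k * (α * ((k : ℝ) - 1)) ^ j)).congr_deriv ?_
  rw [expTerm]
  ring

lemma summable_weights (hw : ∀ k, 0 ≤ w k) (hs : Summable fun k : ℕ => (k : ℝ) ^ 2 * w k) :
    Summable w := by
  rw [← summable_nat_add_iff 1]
  refine Summable.of_nonneg_of_le (fun k => hw _) (fun k => ?_) ((summable_nat_add_iff 1).2 hs)
  refine le_mul_of_one_le_left (hw _) ?_
  push_cast
  nlinarith [(Nat.cast_nonneg k : (0 : ℝ) ≤ k)]

/-- To the left of `b` only the term `k = 0` grows, by at most `exp (α R)` on an interval of length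
`R`. Two derivatives cost at most a factor of order `1 + k²`, which the weights absorb. -/
lemma exists_expTerm_bound (hw : ∀ k, 0 ≤ w k) (hs : Summable fun k : ℕ => (k : ℝ) ^ 2 * w k)
    (hα : 0 < α) (R : ℝ) : ∃ u : ℕ → ℝ, Summable u ∧
      ∀ j ≤ 2, ∀ k, ∀ y ∈ Icc (b - R) b, ‖expTerm w α b j k y‖ ≤ u k := by
  refine ⟨fun k => (1 + α) ^ 2 * Real.exp (α * R) * (w k + (k : ℝ) ^ 2 * w k),
    ((summable_weights hw hs).add hs).mul_left _, fun j hj k y hy => ?_⟩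
  have hk : (0 : ℝ) ≤ k := Nat.cast_nonneg k
  have hx1 : 0 ≤ b - y := by linarith [hy.2]
  have hx2 : b - y ≤ R := by linarith [hy.1]
  have hexp : Real.exp (α * ((k : ℝ) - 1) * (y - b)) ≤ Real.exp (α * R) := by
    refine Real.exp_le_exp.2 ?_
    have h1 : ((k : ℝ) - 1) * (y - b) ≤ R := by nlinarith
    have := mul_le_mul_of_nonneg_left h1 hα.le
    linarith
  have hpow : |α * ((k : ℝ) - 1)| ^ j ≤ (1 + α) ^ 2 * (1 + (k : ℝ) ^ 2) := by
    have h1 : |(k : ℝ) - 1| ^ j ≤ 1 + (k : ℝ) ^ 2 := by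
      have h2 : |(k : ℝ) - 1| ^ 2 ≤ 1 + (k : ℝ) ^ 2 := by rw [sq_abs]; nlinarith
      rcases le_total |(k : ℝ) - 1| 1 with h3 | h3
      · exact (pow_le_one₀ (abs_nonneg _) h3).trans (by nlinarith)
      · exact (pow_le_pow_right₀ h3 hj).trans h2
    have h4 : α ^ j ≤ (1 + α) ^ 2 :=
      (pow_le_pow_left₀ hα.le (by linarith) j).trans (pow_le_pow_right₀ (by linarith) hj)
    rw [abs_mul, abs_of_pos hα, mul_pow]
    exact mul_le_mul h4 h1 (by positivity) (by positivity)
  rw [expTerm, norm_mul, norm_mul, norm_pow, Real.norm_of_nonneg (hw k), Real.norm_eq_abs,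
    Real.norm_of_nonneg (Real.exp_pos _).le]
  calc w k * |α * ((k : ℝ) - 1)| ^ j * Real.exp (α * ((k : ℝ) - 1) * (y - b))
      ≤ w k * ((1 + α) ^ 2 * (1 + (k : ℝ) ^ 2)) * Real.exp (α * R) :=
        mul_le_mul (mul_le_mul_of_nonneg_left hpow (hw k)) hexp (Real.exp_pos _).le
          (mul_nonneg (hw k) (by positivity))
    _ = (1 + α) ^ 2 * Real.exp (α * R) * (w k + (k : ℝ) ^ 2 * w k) := by ring

lemma hasSum_expSeries (hw : ∀ k, 0 ≤ w k) (hs : Summable fun k : ℕ => (k : ℝ) ^ 2 * w k)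
    (hα : 0 < α) {j : ℕ} (hj : j ≤ 2) {x : ℝ} (hx : x ≤ b) :
    HasSum (fun k => expTerm w α b j k x) (expSeries w α b j x) := by
  obtain ⟨u, hu, hbd⟩ := exists_expTerm_bound (b := b) hw hs hα (b - x)
  exact (Summable.of_norm_bounded hu fun k => hbd j hj k x ⟨by linarith, hx⟩).hasSum

lemma hasTwoDerivsIic_expSeries (hw : ∀ k, 0 ≤ w k) (hs : Summable fun k : ℕ => (k : ℝ) ^ 2 * w k)
    (hα : 0 < α) :
    HasTwoDerivsIic (expSeries w α b 0) (expSeries w α b 1) (expSeries w α b 2) b := by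
  have hcont : ∀ j k, Continuous (expTerm w α b j k) := fun j k =>
    continuous_iff_continuousAt.2 fun y => (hasDerivAt_expTerm w α b j k y).continuousAt
  have key : ∀ j, j + 1 ≤ 2 → ∀ x ≤ b,
      HasDerivWithinAt (expSeries w α b j) (expSeries w α b (j + 1) x) (Iic b) x := by
    intro j hj x hx
    refine hasDerivWithinAt_tsum_Iic (hasDerivAt_expTerm w α b j) (hcont (j + 1)) (fun R => ?_) hx
    obtain ⟨u, hu, hbd⟩ := exists_expTerm_bound (b := b) hw hs hα R
    exact ⟨u, hu, fun k y hy => ⟨hbd j (by omega) k y hy, hbd (j + 1) hj k y hy⟩⟩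
  refine ⟨key 0 (by norm_num), key 1 le_rfl, fun x hx => ?_⟩
  obtain ⟨u, hu, hbd⟩ := exists_expTerm_bound (b := b) hw hs hα (b - x + 1)
  have h1 : ContinuousOn (expSeries w α b 2) (Icc (b - (b - x + 1)) b) :=
    continuousOn_tsum (fun k => (hcont 2 k).continuousOn) hu (hbd 2 le_rfl)
  refine (h1 x ⟨by linarith, hx⟩).mono_of_mem_nhdsWithin ?_
  filter_upwards [self_mem_nhdsWithin, nhdsWithin_le_nhds (Ioi_mem_nhds (show x - 1 < x by linarith))]
    with y hy hy'
  exact ⟨by linarith [mem_Ioi.1 hy'], hy⟩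

lemma expTerm_zero_nonneg (hw : ∀ k, 0 ≤ w k) (k : ℕ) (x : ℝ) : 0 ≤ expTerm w α b 0 k x := by
  rw [expTerm, pow_zero, mul_one]
  exact mul_nonneg (hw k) (Real.exp_pos _).le

lemma expTerm_succ (w : ℕ → ℝ) (α b : ℝ) (j k : ℕ) (x : ℝ) :
    expTerm w α b (j + 1) k x = α * ((k : ℝ) - 1) * expTerm w α b j k x := by
  rw [expTerm, expTerm]
  ring

lemma expSeries_lower (hw : ∀ k, 0 ≤ w k) (hs : Summable fun k : ℕ => (k : ℝ) ^ 2 * w k)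
    (hα : 0 < α) {x : ℝ} (hx : x ≤ b) :
    w 0 * Real.exp (-(α * (x - b))) ≤ expSeries w α b 0 x := by
  have h1 := le_hasSum (hasSum_expSeries (b := b) hw hs hα (Nat.zero_le 2) hx) 0
    fun k _ => expTerm_zero_nonneg hw k x
  refine le_trans (le_of_eq ?_) h1
  rw [expTerm, pow_zero, mul_one]
  push_cast
  ring_nf

lemma expSeries_pos (hw : ∀ k, 0 ≤ w k) (hw0 : 0 < w 0)
    (hs : Summable fun k : ℕ => (k : ℝ) ^ 2 * w k) (hα : 0 < α) {x : ℝ} (hx : x ≤ b) :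
    0 < expSeries w α b 0 x :=
  (mul_pos hw0 (Real.exp_pos _)).trans_le (expSeries_lower hw hs hα hx)

/-- Logarithmic convexity of the series, with the case of equality. -/
lemma expSeries_log_convex (hw : ∀ k, 0 ≤ w k) (hw0 : 0 < w 0)
    (hs : Summable fun k : ℕ => (k : ℝ) ^ 2 * w k) (hα : 0 < α) {x : ℝ} (hx : x ≤ b) :
    expSeries w α b 1 x ^ 2 ≤ expSeries w α b 0 x * expSeries w α b 2 x ∧
      (expSeries w α b 1 x ^ 2 = expSeries w α b 0 x * expSeries w α b 2 x →
        ∀ k ≠ 0, w k = 0) := by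
  have s0 := hasSum_expSeries (b := b) hw hs hα (Nat.zero_le 2) hx
  have s1 := hasSum_expSeries (b := b) hw hs hα (show 1 ≤ 2 by norm_num) hx
  have s2 := hasSum_expSeries (b := b) hw hs hα (le_refl 2) hx
  have hpos := expSeries_pos (b := b) hw hw0 hs hα hx
  set A := expSeries w α b 0 x with hA
  set B := expSeries w α b 1 x with hB
  set C := expSeries w α b 2 x with hC
  -- The Cauchy–Schwarz defect as a sum of squares: with exponents `λ_k = α (k - 1)` and terms
  -- `e_k`, `∑ e_k (A λ_k - B)² = A (A C - B²)`. If it vanishes, all exponents with nonzero weight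
  -- equal `λ_0`.
  have hsum : HasSum (fun k : ℕ => expTerm w α b 0 k x * (A * (α * ((k : ℝ) - 1)) - B) ^ 2)
      (A * (A * C - B ^ 2)) := by
    have h1 := ((s2.mul_left (A ^ 2)).sub (s1.mul_left (2 * A * B))).add (s0.mul_left (B ^ 2))
    have h2 : A ^ 2 * C - 2 * A * B * B + B ^ 2 * A = A * (A * C - B ^ 2) := by ring
    rw [h2] at h1
    refine h1.congr_fun ?_
    intro k
    rw [expTerm_succ w α b 1, expTerm_succ w α b 0]
    ring
  have hnn : ∀ k : ℕ, 0 ≤ expTerm w α b 0 k x * (A * (α * ((k : ℝ) - 1)) - B) ^ 2 := fun k =>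
    mul_nonneg (expTerm_zero_nonneg hw k x) (sq_nonneg _)
  refine ⟨?_, fun heq k hk => ?_⟩
  · have h3 := hsum.nonneg hnn
    have := (mul_nonneg_iff_of_pos_left hpos).1 h3
    linarith
  · rw [heq, sub_self, mul_zero] at hsum
    have h4 := (hasSum_zero_iff_of_nonneg hnn).1 hsum
    have h5 : ∀ k : ℕ, w k ≠ 0 → A * (α * ((k : ℝ) - 1)) = B := by
      intro k hk
      have h6 := congrFun h4 k
      have h7 : expTerm w α b 0 k x ≠ 0 := by
        rw [expTerm, pow_zero, mul_one]
        exact mul_ne_zero hk (Real.exp_pos _).ne'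
      have h8 := (mul_eq_zero.1 h6).resolve_left h7
      exact sub_eq_zero.1 (pow_eq_zero_iff two_ne_zero |>.1 h8)
    by_contra hwk
    have h9 := (h5 k hwk).trans (h5 0 hw0.ne').symm
    have h10 := mul_left_cancel₀ hα.ne' (mul_left_cancel₀ hpos.ne' h9)
    push_cast at h10
    exact hk (by exact_mod_cast (by linarith : (k : ℝ) = 0))

/-- Adding `α` times the series to its derivative replaces the factor `k - 1` by `k`, so the term `k
= 0` drops out; the others are nonnegative and bounded to the left of `b`. The lower bound gives `𝓛'
≥ -α`, the upper one the limit. -/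
lemma expSeries_add_bounds (hw : ∀ k, 0 ≤ w k) (hs : Summable fun k : ℕ => (k : ℝ) ^ 2 * w k)
    (hα : 0 < α) {x : ℝ} (hx : x ≤ b) :
    0 ≤ expSeries w α b 1 x + α * expSeries w α b 0 x ∧
      expSeries w α b 1 x + α * expSeries w α b 0 x ≤ α * ∑' k : ℕ, (k : ℝ) ^ 2 * w k := by
  have s0 := hasSum_expSeries (b := b) hw hs hα (Nat.zero_le 2) hx
  have s1 := hasSum_expSeries (b := b) hw hs hα (show 1 ≤ 2 by norm_num) hx
  have h1 : HasSum (fun k : ℕ => α * (k : ℝ) * expTerm w α b 0 k x)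
      (expSeries w α b 1 x + α * expSeries w α b 0 x) := by
    refine (s1.add (s0.mul_left α)).congr_fun fun k => ?_
    rw [expTerm_succ w α b 0]
    ring
  refine ⟨h1.nonneg fun k => mul_nonneg (by positivity) (expTerm_zero_nonneg hw k x), ?_⟩
  refine hasSum_le (fun k => ?_) h1 (hs.hasSum.mul_left α)
  rw [mul_assoc]
  refine mul_le_mul_of_nonneg_left ?_ hα.le
  rcases Nat.eq_zero_or_pos k with rfl | hk
  · simp
  have hk1 : (1 : ℝ) ≤ k := by exact_mod_cast hk
  have h2 : expTerm w α b 0 k x ≤ w k := by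
    rw [expTerm, pow_zero, mul_one]
    refine mul_le_of_le_one_right (hw k) (Real.exp_le_one_iff.2 ?_)
    exact mul_nonpos_of_nonneg_of_nonpos (mul_nonneg hα.le (by linarith)) (by linarith)
  calc (k : ℝ) * expTerm w α b 0 k x ≤ (k : ℝ) * w k := mul_le_mul_of_nonneg_left h2 (by linarith)
    _ ≤ (k : ℝ) ^ 2 * w k := mul_le_mul_of_nonneg_right (by nlinarith) (hw k)

/-- The distance of the quotient from `-α` is a bounded quantity divided by the series, which grows
at least like its term `k = 0`. -/
lemma tendsto_expSeries_div (hw : ∀ k, 0 ≤ w k) (hw0 : 0 < w 0)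
    (hs : Summable fun k : ℕ => (k : ℝ) ^ 2 * w k) (hα : 0 < α) :
    Tendsto (fun x => expSeries w α b 1 x / expSeries w α b 0 x) atBot (𝓝 (-α)) := by
  set K := ∑' k : ℕ, (k : ℝ) ^ 2 * w k with hK
  have hup : Tendsto (fun x => -α + α * K / w 0 * Real.exp (α * (x - b))) atBot (𝓝 (-α)) := by
    have h1 : Tendsto (fun x => α * (x - b)) atBot atBot :=
      (tendsto_atBot_add_const_right _ (-b) tendsto_id).const_mul_atBot hα
    have h2 := (Real.tendsto_exp_atBot.comp h1).const_mul (α * K / w 0)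
    simpa using h2.const_add (-α)
  refine tendsto_of_tendsto_of_tendsto_of_le_of_le' tendsto_const_nhds hup ?_ ?_
  · filter_upwards [eventually_le_atBot b] with x hx
    rw [le_div_iff₀ (expSeries_pos hw hw0 hs hα hx)]
    linarith [(expSeries_add_bounds (b := b) hw hs hα hx).1]
  · filter_upwards [eventually_le_atBot b] with x hx
    have hpos := expSeries_pos (b := b) hw hw0 hs hα hx
    have h3 := (expSeries_add_bounds (b := b) hw hs hα hx).2
    have h4 := expSeries_lower (b := b) hw hs hα hx
    have hK0 : 0 ≤ K := tsum_nonneg fun k => mul_nonneg (sq_nonneg _) (hw k)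
    rw [div_le_iff₀ hpos]
    have h5 : α * K ≤ α * K / w 0 * Real.exp (α * (x - b)) * expSeries w α b 0 x := by
      have h6 : α * K / w 0 * Real.exp (α * (x - b)) * (w 0 * Real.exp (-(α * (x - b)))) = α * K := by
        rw [Real.exp_neg]
        have := (Real.exp_pos (α * (x - b))).ne'
        field_simp
      rw [← h6]
      conv_rhs => rw [h6]
      exact mul_le_mul_of_nonneg_left h4 (by positivity)
    linarith

end ExponentialSeries

/-! ### From the Dirichlet problem to the exponential series. -/

section Potential

lemma norm_gradForm (w : ℂ) : ‖gradForm w‖ = ‖w‖ := by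
  refine le_antisymm (ContinuousLinearMap.opNorm_le_bound _ (norm_nonneg _) fun v => ?_) ?_
  · rw [gradForm_apply, Real.norm_eq_abs, ← norm_mul]
    exact Complex.abs_re_le_norm _
  · by_cases hw : w = 0
    · rw [hw, norm_zero]
      exact norm_nonneg _
    have h1 := (gradForm w).le_opNorm ((starRingEnd ℂ) w)
    rw [gradForm_apply, Complex.mul_conj', RCLike.norm_conj, ← Complex.ofReal_pow, Complex.ofReal_re,
      Real.norm_of_nonneg (sq_nonneg _), sq] at h1
    exact le_of_mul_le_mul_right h1 (norm_pos_iff.2 hw)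

/-- Every real linear form on the plane is of the form `v ↦ Re (w v)`. -/
lemma gradForm_partials (A : ℂ →L[ℝ] ℝ) (c : ℝ) :
    gradForm (c * ((A 1 : ℂ) - Complex.I * A Complex.I)) = c • A := by
  ext v
  have hv : A v = v.re * A 1 + v.im * A Complex.I := by
    have h1 : v = v.re • (1 : ℂ) + v.im • Complex.I := by
      simp only [Complex.real_smul, mul_one]
      exact (Complex.re_add_im v).symm
    conv_lhs => rw [h1]
    rw [map_add, map_smul, map_smul, smul_eq_mul, smul_eq_mul]
  rw [gradForm_apply, smul_apply, smul_eq_mul, hv]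
  simp [Complex.mul_re, Complex.mul_im]
  ring

lemma IsSmoothJordanCurve.exists_param {J : Set ℂ} (h : IsSmoothJordanCurve J) :
    ∃ γ, IsCurveParam J γ := by
  obtain ⟨γ, h1, h2, h3, h4, h5⟩ := h
  exact ⟨γ, contDiff_infty.1 h1 2, h2, h3, h4, h5⟩

lemma IsCurveParam.image_Ico {J : Set ℂ} {γ : ℝ → ℂ} (P : IsCurveParam J γ) : γ '' Ico 0 1 = J := by
  rw [← P.range_eq]
  refine (image_subset_range _ _).antisymm ?_
  rintro _ ⟨t, rfl⟩
  obtain ⟨y, hy, hty⟩ := P.periodic.exists_mem_Ico₀ one_pos t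
  exact ⟨y, hy, hty.symm⟩

lemma IsCurveParam.arcLength_pos {J : Set ℂ} {γ : ℝ → ℂ} (P : IsCurveParam J γ) :
    0 < arcLength J := by
  have hγ : ContDiff ℝ 1 γ := P.contDiff.of_le (by norm_num)
  have h1 := (integral_hausdorffMeasure_image_curve hγ P.injOn fun _ => (1 : ℝ)).2
  rw [P.image_Ico] at h1
  rw [arcLength, arcIntegral, h1, integral_Ico_eq_integral_Ioc,
    ← intervalIntegral.integral_of_le zero_le_one]
  have hc : Continuous fun t => ‖deriv γ t‖ * 1 := ((hγ.continuous_deriv le_rfl).norm).mul_const 1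
  refine intervalIntegral.intervalIntegral_pos_of_pos (hc.intervalIntegrable _ _) (fun t => ?_) one_pos
  rw [mul_one]
  exact norm_pos_iff.2 (P.deriv_ne t)

/-- The scale inside the logarithm and the value `φ₀` contribute only bounded terms, negligible
against `log |z|`. -/
lemma tendsto_div_log_of_isEquivalent {U : ℂ → ℝ} {q l φ₀ c : ℝ} (hl : 0 < l) (hcq : c * q = 1)
    (h : U ~[Bornology.cobounded ℂ] fun z => -q * Real.log (2 * Real.pi * ‖z‖ / l)) :
    Tendsto (fun z => c * (U z - φ₀) / Real.log ‖z‖) (Bornology.cobounded ℂ) (𝓝 (-1)) := by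
  obtain ⟨u, hu, hUu⟩ := h.exists_eq_mul
  have hlog : Tendsto (fun z : ℂ => Real.log ‖z‖) (Bornology.cobounded ℂ) atTop :=
    Real.tendsto_log_atTop.comp tendsto_norm_cobounded_atTop
  have hinv : Tendsto (fun z : ℂ => (Real.log ‖z‖)⁻¹) (Bornology.cobounded ℂ) (𝓝 0) :=
    tendsto_inv_atTop_zero.comp hlog
  set K := Real.log (2 * Real.pi / l) with hK
  have hlim : Tendsto (fun z : ℂ => -(u z * (K * (Real.log ‖z‖)⁻¹ + 1)) - c * φ₀ * (Real.log ‖z‖)⁻¹)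
      (Bornology.cobounded ℂ) (𝓝 (-(1 * (K * 0 + 1)) - c * φ₀ * 0)) :=
    ((hu.mul ((hinv.const_mul K).add_const 1)).neg).sub (hinv.const_mul (c * φ₀))
  simp only [mul_zero, zero_add, one_mul, sub_zero] at hlim
  refine hlim.congr' ?_
  have hpos : ∀ᶠ z : ℂ in Bornology.cobounded ℂ, 1 < ‖z‖ :=
    tendsto_norm_cobounded_atTop.eventually_gt_atTop 1
  filter_upwards [hUu, hpos] with z hz hz1
  have hlz : Real.log ‖z‖ ≠ 0 := (Real.log_pos hz1).ne'
  have h1 : Real.log (2 * Real.pi * ‖z‖ / l) = K + Real.log ‖z‖ := by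
    rw [mul_div_right_comm, Real.log_mul (by positivity) (by positivity)]
  rw [hz, Pi.mul_apply, h1]
  field_simp
  linear_combination u z * (K + Real.log ‖z‖) * hcq

namespace IsExteriorDirichlet

variable {Ω : Set ℂ} {U : ℂ → ℝ} {φ₀ Φ : ℝ}

/-- The gradient of the normalized potential, as a complex function. -/
noncomputable def complexGradient (Ω : Set ℂ) (U : ℂ → ℝ) (c : ℝ) (z : ℂ) : ℂ :=
  c * ((closedDifferential Ω U z 1 : ℂ) - Complex.I * closedDifferential Ω U z Complex.I)

lemma fieldIntensity_eq {c : ℝ} (hc : 0 < c) (z : ℂ) :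
    fieldIntensity Ω U z = ‖complexGradient Ω U c z‖ / c := by
  rw [complexGradient, ← norm_gradForm, gradForm_partials, norm_smul, Real.norm_of_nonneg hc.le,
    mul_div_cancel_left₀ _ hc.ne', fieldIntensity]

/-- The solution of the exterior Dirichlet problem is given by a conformal map onto the exterior of
the disc. -/
theorem exists_isRegularExterior (h : IsExteriorDirichlet Ω U φ₀ Φ) :
    ∃ γ g a, IsRegularExterior Ω γ (fun z => 2 * Real.pi / Φ * (U z - φ₀))
      (complexGradient Ω U (2 * Real.pi / Φ)) g a := by
  obtain ⟨γ, P⟩ := h.smooth_boundary.exists_param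
  have hΦ := h.flux_pos
  -- The normalization for which the logarithmic coefficient at infinity is `-1`, so that `exp N` is
  -- the modulus of a single-valued function with a simple zero at infinity.
  set c := 2 * Real.pi / Φ with hc
  have hud : UniqueDiffOn ℝ (closure Ω) := uniqueDiffOn_closure h.isOpen P
  have hfc : ContinuousOn (complexGradient Ω U c) (closure Ω) := by
    have h1 : ContinuousOn (fun z => closedDifferential Ω U z) (closure Ω) :=
      h.regular.continuousOn_fderivWithin hud le_rfl
    have h2 : ∀ v : ℂ, ContinuousOn (fun z => ((closedDifferential Ω U z v : ℝ) : ℂ)) (closure Ω) :=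
      fun v => Complex.continuous_ofReal.comp_continuousOn (h1.clm_apply continuousOn_const)
    exact continuousOn_const.mul ((h2 1).sub (continuousOn_const.mul (h2 Complex.I)))
  have hNd : ∀ z ∈ closure Ω, HasFDerivWithinAt (fun z => c * (U z - φ₀))
      (gradForm (complexGradient Ω U c z)) (closure Ω) z := by
    intro z hz
    have h1 := (h.regular.differentiableOn one_ne_zero z hz).hasFDerivWithinAt
    have h2 := (h1.sub_const φ₀).const_smul c
    rw [complexGradient, gradForm_partials]
    exact h2
  have hNΩ : ∀ z ∈ Ω, HasFDerivAt (fun z => c * (U z - φ₀))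
      (gradForm (complexGradient Ω U c z)) z := fun z hz =>
    (hNd z (subset_closure hz)).hasFDerivAt (mem_of_superset (h.isOpen.mem_nhds hz) subset_closure)
  have hfd : DifferentiableOn ℂ (complexGradient Ω U c) Ω := by
    intro z hz
    have h1 := (HarmonicAt.differentiableAt_complex_partial (h.harmonic z hz)).const_mul (c : ℂ)
    refine (h1.congr_of_eventuallyEq ?_).differentiableWithinAt
    filter_upwards [h.isOpen.mem_nhds hz] with w hw
    rw [complexGradient, closedDifferential,
      fderivWithin_of_mem_nhds (mem_of_superset (h.isOpen.mem_nhds hw) subset_closure)]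
  obtain ⟨R, hR, hout⟩ := exists_norm_gt_subset h.isOpen h.unbounded P.isCompact.isBounded
  have hlim : Tendsto (fun z => c * (U z - φ₀) / Real.log ‖z‖) (Bornology.cobounded ℂ) (𝓝 (-1)) :=
    tendsto_div_log_of_isEquivalent P.arcLength_pos (q := Φ / (2 * Real.pi))
      (by rw [hc]; field_simp) h.asymptotic
  have hfr : frontier Ω = γ '' Icc 0 1 := by
    have := P.image_Icc 0
    rw [zero_add] at this
    exact this.symm
  obtain ⟨g, a, ha, hder, hnorm, hinf⟩ := exists_holomorphic_of_potential h.isOpen h.isConnected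
    (P.contDiff.of_le (by norm_num)) hfr hR hout hfd hNΩ hlim
  refine ⟨γ, g, a, ⟨⟨h.isOpen, h.isConnected, ⟨R, hR, hout⟩, fun z hz =>
    (hNd z hz).continuousWithinAt, fun z hz => ?_, hder, hnorm, ha, hinf⟩, P, hNd, hfc⟩⟩
  rw [h.dirichlet z hz, sub_self, mul_zero]

end IsExteriorDirichlet

namespace IsDiscParam

variable {Ω : Set ℂ} {N : ℂ → ℝ} {f G H D : ℂ → ℂ}

/-- The line integral of `1 / |f|` over a level curve. -/
lemma integral_level (X : IsDiscParam Ω N f G H D) {ρ c : ℝ} (h0 : 0 < ρ) (h1 : ρ ≤ 1) :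
    IntegrableOn (fun z => c / ‖f z‖) {z ∈ closure Ω | N z = Real.log ρ}
        (Measure.hausdorffMeasure 1) ∧
      ∫ z in {z ∈ closure Ω | N z = Real.log ρ}, c / ‖f z‖ ∂(Measure.hausdorffMeasure 1) =
        c / ρ ^ 2 * ∫ θ in (0 : ℝ)..2 * Real.pi, ‖D (circleMap 0 ρ θ)‖ ^ 2 := by
  obtain ⟨hi, he⟩ := integral_hausdorffMeasure_image_curve (X.contDiff_levelCurve h0 h1)
    (X.injOn_levelCurve h0 h1) fun z => c / ‖f z‖
  rw [X.image_levelCurve h0 h1] at hi he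
  -- Both the speed of the level curve and `1 / |f|` equal `|D| / ρ`; their product produces the
  -- square.
  have hpt : ∀ θ, ‖deriv (levelCurve G ρ) θ‖ * (c / ‖f (levelCurve G ρ θ)‖) =
      c / ρ ^ 2 * ‖D (circleMap 0 ρ θ)‖ ^ 2 := by
    intro θ
    have hm := circleMap_mem h0 h1 θ
    have h2 := congrArg norm (X.density_mul _ hm)
    have h3 : ‖D (circleMap 0 ρ θ)‖ ≠ 0 :=
      norm_ne_zero_iff.2 (X.density_ne_zero _ (mem_closedBall_zero_iff.2 hm.2))
    rw [norm_mul, norm_neg, norm_circleMap_zero, abs_of_pos h0] at h2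
    have h4 : ‖f (G (circleMap 0 ρ θ))‖ = ρ / ‖D (circleMap 0 ρ θ)‖ := by
      rw [eq_div_iff h3, mul_comm]
      exact h2
    rw [(X.hasDerivAt_levelCurve h0 h1 θ).deriv, levelCurve, h4, norm_div, norm_mul, norm_neg,
      Complex.norm_I, one_mul, norm_circleMap_zero, abs_of_pos h0]
    field_simp
  simp only [hpt] at hi he
  have hc : Continuous fun θ => c / ρ ^ 2 * ‖D (circleMap 0 ρ θ)‖ ^ 2 := by
    refine continuous_const.mul ((X.density_continuousOn.comp_continuous
      (continuous_circleMap 0 ρ) fun θ => ?_).norm.pow 2)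
    exact mem_closedBall_zero_iff.2 (circleMap_mem h0 h1 θ).2
  refine ⟨hi.2 ((hc.integrableOn_Icc).mono_set Ico_subset_Icc_self), ?_⟩
  rw [he, integral_Ico_eq_integral_Ioc, ← intervalIntegral.integral_of_le Real.two_pi_pos.le,
    intervalIntegral.integral_const_mul]

/-- A constant density belongs to the exterior of a circle. -/
lemma exists_sphere_of_density_const (X : IsDiscParam Ω N f G H D) {d : ℂ}
    (hD : ∀ ξ ∈ Metric.closedBall (0 : ℂ) 1, D ξ = d) :
    ∃ (p : ℂ) (r : ℝ), 0 < r ∧ {z ∈ closure Ω | N z = 0} = Metric.sphere p r := by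
  have hd : d ≠ 0 := by
    have h0 := Metric.mem_closedBall_self (x := (0 : ℂ)) (zero_le_one (α := ℝ))
    rw [← hD 0 h0]
    exact X.density_ne_zero 0 h0
  have hne : ∀ θ, circleMap 0 1 θ ≠ 0 := fun θ => circleMap_ne_center one_ne_zero
  -- With `D = d`, the velocity `-i d / ξ` is that of `d / ξ`, so the boundary is traced by `p + d /
  -- ξ` with `|ξ| = 1`.
  have hder : ∀ θ, HasDerivAt (fun θ => levelCurve G 1 θ - d * (circleMap 0 1 θ)⁻¹) 0 θ := by
    intro θ
    have h1 := X.hasDerivAt_levelCurve one_pos le_rfl θ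
    rw [hD _ (mem_closedBall_zero_iff.2 (circleMap_mem one_pos le_rfl θ).2)] at h1
    have h2 := (((hasDerivAt_circleMap 0 1 θ).fun_inv (hne θ))).const_mul d
    refine (h1.fun_sub h2).congr_deriv ?_
    have := hne θ
    field_simp
    ring
  set p := levelCurve G 1 0 - d * (circleMap 0 1 0)⁻¹ with hp
  have hconst : ∀ θ, levelCurve G 1 θ = p + d * (circleMap 0 1 θ)⁻¹ := by
    intro θ
    have h3 := is_const_of_deriv_eq_zero (fun θ => (hder θ).differentiableAt)
      (fun θ => (hder θ).deriv) θ 0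
    rw [hp, ← h3]
    ring
  refine ⟨p, ‖d‖, norm_pos_iff.2 hd, ?_⟩
  have h4 := X.image_levelCurve one_pos le_rfl
  rw [Real.log_one] at h4
  rw [← h4]
  ext z
  constructor
  · rintro ⟨θ, -, rfl⟩
    rw [hconst, mem_sphere_iff_norm, add_sub_cancel_left, norm_mul, norm_inv, norm_circleMap_zero,
      abs_one, inv_one, mul_one]
  · intro hz
    rw [mem_sphere_iff_norm] at hz
    have hzp : z - p ≠ 0 := norm_pos_iff.1 (by rw [hz]; exact norm_pos_iff.2 hd)
    have h5 : d / (z - p) ∈ range (circleMap 0 1) := by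
      rw [range_circleMap, mem_sphere_zero_iff_norm, norm_div, hz, abs_one,
        div_self (norm_ne_zero_iff.2 hd)]
    obtain ⟨θ, hθ⟩ := h5
    obtain ⟨y, hy, hyθ⟩ := (periodic_circleMap 0 1).exists_mem_Ico₀ Real.two_pi_pos θ
    refine ⟨y, hy, ?_⟩
    rw [hconst, ← hyθ, hθ]
    field_simp
    ring

end IsDiscParam

/-- The functional is an exponential series with nonnegative coefficients. -/
theorem IsExteriorDirichlet.exists_expSeries {Ω : Set ℂ} {U : ℂ → ℝ} {φ₀ Φ : ℝ}
    (h : IsExteriorDirichlet Ω U φ₀ Φ) : ∃ w : ℕ → ℝ, (∀ k, 0 ≤ w k) ∧ 0 < w 0 ∧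
      Summable (fun k : ℕ => (k : ℝ) ^ 2 * w k) ∧
      (∀ φ ≤ φ₀, (∀ z ∈ potentialLevel Ω U φ, 0 < fieldIntensity Ω U z) ∧
        IntegrableOn (fun z => 1 / fieldIntensity Ω U z) (potentialLevel Ω U φ)
          (Measure.hausdorffMeasure 1) ∧
        inverseFieldIntegral Ω U φ = expSeries w (4 * Real.pi / Φ) φ₀ 0 φ) ∧
      ((∀ k ≠ 0, w k = 0) →
        ∃ (c : ℂ) (r : ℝ), 0 < r ∧ frontier Ω = Metric.sphere c r) := by
  obtain ⟨γ, g, a, E⟩ := h.exists_isRegularExterior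
  obtain ⟨G, H, D, X⟩ := E.exists_discParam
  obtain ⟨d, hd0, hds, hdP, hdc⟩ := X.exists_coeff E
  have hc : 0 < 2 * Real.pi / Φ := div_pos Real.two_pi_pos h.flux_pos
  set c := 2 * Real.pi / Φ with hcdef
  have hpc : 0 < 2 * Real.pi * c := mul_pos Real.two_pi_pos hc
  have hlevel : ∀ φ, potentialLevel Ω U φ =
      {z ∈ closure Ω | c * (U z - φ₀) = Real.log (Real.exp (c * (φ - φ₀)))} := by
    intro φ
    ext z
    rw [Real.log_exp, potentialLevel]
    simp [hc.ne']
  have hE : ∀ z, 1 / fieldIntensity Ω U z = c / ‖complexGradient Ω U c z‖ := fun z => by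
    rw [fieldIntensity_eq hc, one_div_div]
  -- For `ρ = exp (c (φ - φ₀))` the factor `ρ ^ (2k - 2)` is the exponential with exponent `2c (k -
  -- 1) (φ - φ₀)`, and `2c = 4π/Φ`. The shift from `k` to `k - 1` comes from the prefactor `1 / ρ²`.
  refine ⟨fun k => 2 * Real.pi * c * ‖d k‖ ^ 2, fun k => by positivity, by positivity, ?_,
    fun φ hφ => ⟨fun z hz => ?_, ?_⟩, fun hw => ?_⟩
  · refine (hds.mul_left (2 * Real.pi * c)).congr fun k => ?_
    ring
  · rw [fieldIntensity_eq hc]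
    exact div_pos (norm_pos_iff.2 (E.gradient_ne_zero hz.1)) hc
  · set ρ := Real.exp (c * (φ - φ₀)) with hρ
    have h0 : 0 < ρ := Real.exp_pos _
    have h1 : ρ ≤ 1 :=
      Real.exp_le_one_iff.2 (mul_nonpos_of_nonneg_of_nonpos hc.le (by linarith))
    obtain ⟨hi, he⟩ := X.integral_level (c := c) h0 h1
    simp only [hE, inverseFieldIntegral, arcIntegral, hlevel φ]
    refine ⟨hi, ?_⟩
    rw [he]
    have h2 := (hdP ρ h0 h1).mul_left (2 * Real.pi * c / ρ ^ 2)
    have h4 : HasSum (fun k => expTerm (fun k => 2 * Real.pi * c * ‖d k‖ ^ 2) (4 * Real.pi / Φ) φ₀ 0 k φ)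
        (2 * Real.pi * c / ρ ^ 2 *
          ((2 * Real.pi)⁻¹ * ∫ θ in (0 : ℝ)..2 * Real.pi, ‖D (circleMap 0 ρ θ)‖ ^ 2)) := by
      refine h2.congr_fun fun k => ?_
      have h3 : Real.exp (4 * Real.pi / Φ * ((k : ℝ) - 1) * (φ - φ₀)) = ρ ^ (2 * k) / ρ ^ 2 := by
        rw [hρ, ← Real.exp_nat_mul, ← Real.exp_nat_mul, ← Real.exp_sub, hcdef]
        congr 1
        push_cast
        ring
      rw [expTerm, pow_zero, mul_one, h3]
      ring
    have := Real.pi_pos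
    rw [expSeries, h4.tsum_eq]
    field_simp
  · obtain ⟨p, r, hr, hs⟩ := X.exists_sphere_of_density_const (hdc fun k hk => by
      have h1 := (mul_eq_zero.1 (hw k hk)).resolve_left hpc.ne'
      exact norm_eq_zero.1 (pow_eq_zero_iff two_ne_zero |>.1 h1))
    refine ⟨p, r, hr, ?_⟩
    rw [← hs]
    ext z
    constructor
    · intro hz
      exact ⟨frontier_subset_closure hz, E.boundary z hz⟩
    · rintro ⟨hz, hN⟩
      exact E.mem_frontier_of_notMem hz fun hzΩ => (E.neg hzΩ).ne hN

end Potential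

/-! ### Longinetti's inequality. -/

theorem mainTheorem7 (Ω : Set ℂ) (U : ℂ → ℝ) (φ₀ Φ : ℝ) (h : IsExteriorDirichlet Ω U φ₀ Φ) :
    -- the functional is well defined for every `φ ≤ φ₀`, and twice continuously differentiable
    (∀ φ ≤ φ₀, (∀ z ∈ potentialLevel Ω U φ, 0 < fieldIntensity Ω U z) ∧
      IntegrableOn (fun z => 1 / fieldIntensity Ω U z) (potentialLevel Ω U φ)
        (Measure.hausdorffMeasure 1) ∧
      0 < inverseFieldIntegral Ω U φ) ∧
    ContDiffOn ℝ 2 (inverseFieldIntegral Ω U) (Iic φ₀) ∧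
    ContDiffOn ℝ 2 (longinetti Ω U) (Iic φ₀) ∧
    -- convexity
    ConvexOn ℝ (Iic φ₀) (longinetti Ω U) ∧
    (∀ φ ≤ φ₀, 0 ≤ iteratedDerivWithin 2 (longinetti Ω U) (Iic φ₀) φ ∧
      (derivWithin (inverseFieldIntegral Ω U) (Iic φ₀) φ) ^ 2 ≤
        inverseFieldIntegral Ω U φ *
          iteratedDerivWithin 2 (inverseFieldIntegral Ω U) (Iic φ₀) φ) ∧
    -- equality, at any single `φ`, only for a circle
    (∀ φ ≤ φ₀, (iteratedDerivWithin 2 (longinetti Ω U) (Iic φ₀) φ = 0 ∨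
        (derivWithin (inverseFieldIntegral Ω U) (Iic φ₀) φ) ^ 2 =
          inverseFieldIntegral Ω U φ *
            iteratedDerivWithin 2 (inverseFieldIntegral Ω U) (Iic φ₀) φ) →
      ∃ (c : ℂ) (r : ℝ), 0 < r ∧ frontier Ω = Metric.sphere c r) ∧
    -- the limit of the derivative at `-∞`, and the resulting lower bound
    Tendsto (derivWithin (longinetti Ω U) (Iic φ₀)) atBot (𝓝 (-(4 * Real.pi / Φ))) ∧
    (∀ φ ≤ φ₀, -(4 * Real.pi / Φ) ≤ derivWithin (longinetti Ω U) (Iic φ₀) φ) := by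

  obtain ⟨w, hw, hw0, hs, hI, hcirc⟩ := h.exists_expSeries
  have hα : 0 < 4 * Real.pi / Φ := div_pos (by positivity) h.flux_pos
  set α := 4 * Real.pi / Φ with hαdef
  have hpos : ∀ φ ≤ φ₀, 0 < inverseFieldIntegral Ω U φ := fun φ hφ => by
    rw [(hI φ hφ).2.2]
    exact expSeries_pos hw hw0 hs hα hφ
  have hT : HasTwoDerivsIic (inverseFieldIntegral Ω U) (expSeries w α φ₀ 1) (expSeries w α φ₀ 2) φ₀ :=
    (hasTwoDerivsIic_expSeries hw hs hα).congr fun φ hφ => (hI φ hφ).2.2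
  have hL : HasTwoDerivsIic (longinetti Ω U) _ _ φ₀ := hT.log hpos
  have hconv : ∀ φ ≤ φ₀, _ := fun φ hφ => expSeries_log_convex hw hw0 hs hα hφ
  have hnn : ∀ φ ≤ φ₀, 0 ≤ (expSeries w α φ₀ 2 φ * inverseFieldIntegral Ω U φ -
      expSeries w α φ₀ 1 φ * expSeries w α φ₀ 1 φ) / inverseFieldIntegral Ω U φ ^ 2 := by
    intro φ hφ
    refine div_nonneg ?_ (sq_nonneg _)
    rw [(hI φ hφ).2.2]
    have := (hconv φ hφ).1
    linarith
  have hderiv : ∀ φ ≤ φ₀, derivWithin (longinetti Ω U) (Iic φ₀) φ =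
      expSeries w α φ₀ 1 φ / expSeries w α φ₀ 0 φ := fun φ hφ => by
    rw [hL.derivWithin_eq hφ, (hI φ hφ).2.2]
  refine ⟨fun φ hφ => ⟨(hI φ hφ).1, (hI φ hφ).2.1, hpos φ hφ⟩, hT.contDiffOn, hL.contDiffOn,
    hL.convexOn hnn, fun φ hφ => ⟨?_, ?_⟩, fun φ hφ heq => ?_, ?_, fun φ hφ => ?_⟩
  · rw [hL.iteratedDerivWithin_eq hφ]
    exact hnn φ hφ
  · rw [hT.derivWithin_eq hφ, hT.iteratedDerivWithin_eq hφ, (hI φ hφ).2.2]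
    exact (hconv φ hφ).1
  · refine hcirc ((hconv φ hφ).2 ?_)
    rw [hL.iteratedDerivWithin_eq hφ, hT.derivWithin_eq hφ, hT.iteratedDerivWithin_eq hφ] at heq
    rcases heq with heq | heq
    -- The numerator of `𝓛'' = (I'' I - I'²) / I²` vanishes, so both forms of equality reduce to the
    -- equality case for the series.
    · have h1 := (div_eq_zero_iff.1 heq).resolve_right (pow_ne_zero 2 (hpos φ hφ).ne')
      rw [(hI φ hφ).2.2] at h1
      linarith
    · rwa [(hI φ hφ).2.2] at heq
  · refine (tendsto_expSeries_div (b := φ₀) hw hw0 hs hα).congr' ?_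
    filter_upwards [eventually_le_atBot φ₀] with φ hφ using (hderiv φ hφ).symm
  · rw [hderiv φ hφ, le_div_iff₀ (expSeries_pos hw hw0 hs hα hφ)]
    linarith [(expSeries_add_bounds (b := φ₀) hw hs hα hφ).1]
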